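/- A \emph{double poset} is a finite set with two strict partial orders $<_{W}$ and $<_{S}$; a \emph{morphism} of double posets is a map that strictly preserves both orders. A permutation $\sigma\in\mathfrak S(n)$ is regarded as the double poset $\mathrm{DP}(\sigma)$ on $[n]$ with first order $1<\dots<n$ and second order $\sigma^{-1}(1)<\dots<\sigma^{-1}(n)$. An \emph{SN polytree} is a directed graph whose underlying undirected graph is a tree and whose edges are labelled by $S$ or $N$. It generates two relations: for every edge from $u$ to $v$ we have $v<_{W}u$, and $v<_{S}u$ if its label is $S$, $u<_{S}v$ if its label is $N$. Let $\mathsf{ArboNE}$ be the family of double posets obtained (up to isomorphism) as follows. Start with $\mathrm{DP}([3\,2\,1\,4])$ on the points $1,2,3,4$. Let any finite number of finite SN polytrees dangle from the points $1$, $2$ or $3$: each of them has a root, all its edges are labelled $S$ and all its arrows point away from the root, and it is attached by an edge labelled $S$ that points from one of the points $1,2,3$ to its root. Optionally, remove the point $2$ together with all polytrees dangling from it. The two orders are the transitive closures of the relations generated in this way. \textbf{Theorem.} Let $D\in\mathsf{ArboNE}$ be fixed. Given $n$ and a permutation $\Pi\in\mathfrak S(n)$, the number \[ \langle \mathsf{DPC}^{\mathrm{mor}}(\mathrm{DP}(\Pi)),D\rangle=\#\{\text{morphisms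 of double posets } D\to \mathrm{DP}(\Pi)\} \] can be computed in time $\tilde{\mathcal O}(n^{5/3})$ and space $\tilde{\mathcal O}(n)$. That is, there is one program that computes this number for all $n$ and all $\Pi\in\mathfrak S(n)$, on a word RAM with words of $O(\log n)$ bits, in $O(n^{5/3}(\log n)^k)$ steps and with $O(n(\log n)^{k'})$ words of memory, for some $k,k'\in\mathbb N$; the program, $k$, $k'$ and the implied constants may depend on $D$. -/

import Mathlib

open Filter Asymptotics

/-! ### Double posets and their morphisms -/

/-- A finite (strict) double poset: a finite set with two strict partial orders. -/
structure DoublePoset where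
  carrier : Type
  finite : Finite carrier
  /-- the first order, also written `<_West` -/
  west : carrier → carrier → Prop
  /-- the second order, also written `<_South` -/
  south : carrier → carrier → Prop
  west_strict : IsStrictOrder carrier west
  south_strict : IsStrictOrder carrier south

namespace DoublePoset

/-- Morphisms of double posets: maps that strictly preserve both orders. -/
def Mor (A B : DoublePoset) : Type :=
  {f : A.carrier → B.carrier //
    (∀ a b, A.west a b → B.west (f a) (f b)) ∧ (∀ a b, A.south a b → B.south (f a) (f b))}

/-- Isomorphism of double posets. -/
def IsIso (A B : DoublePoset) : Prop :=
  ∃ e : A.carrier ≃ B.carrier,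
    (∀ a b, A.west a b ↔ B.west (e a) (e b)) ∧ (∀ a b, A.south a b ↔ B.south (e a) (e b))

/-- The number `⟨DPC^mor(B), A⟩` of morphisms from `A` to `B`. -/
noncomputable def DPCmor (B A : DoublePoset) : ℕ := Nat.card (Mor A B)

/-- A permutation `σ` as a double poset: the first order is `1 < ⋯ < n`, the second one is
`σ⁻¹(1) < ⋯ < σ⁻¹(n)`, in which `a` precedes `b` exactly if `σ a < σ b`. -/
def ofPerm {n : ℕ} (σ : Equiv.Perm (Fin n)) : DoublePoset where
  carrier := Fin n
  finite := inferInstance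
  west a b := a < b
  south a b := σ a < σ b
  west_strict := { irrefl := fun a => lt_irrefl a, trans := fun _ _ _ h k => lt_trans h k }
  south_strict := { irrefl := fun a => lt_irrefl (σ a), trans := fun _ _ _ h k => lt_trans h k }

end DoublePoset

/-! ### SN polytrees and the family `ArboNE` -/

/-- The two edge labels. -/
inductive SNLabel
  | N
  | S

/-- An SN polytree on `V`: a directed graph whose underlying undirected graph is a tree, with its
edges labelled by `N` or `S` (the value of `label` matters only on edges). -/
structure SNPolytree (V : Type) where
  /-- `arrow u v`: there is an edge pointing from `u` to `v` -/
  arrow : V → V → Prop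
  label : V → V → SNLabel
  asymm : ∀ u v, arrow u v → ¬ arrow v u
  isTree : (SimpleGraph.fromRel arrow).IsTree

namespace SNPolytree

variable {V : Type}

/-- Edges point to the west: the target of an edge is west of its source. -/
def westGen (T : SNPolytree V) (u v : V) : Prop := T.arrow v u

/-- The label of an edge is the position of the target with respect to the source. -/
def southGen (T : SNPolytree V) (u v : V) : Prop :=
  (T.arrow v u ∧ T.label v u = SNLabel.S) ∨ (T.arrow u v ∧ T.label u v = SNLabel.N)

end SNPolytree

/-- A finite SN polytree with a chosen vertex `root` such that all edges are labelled `S` and all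
arrows point away from the root. -/
structure DanglingTree where
  V : Type
  finite : Finite V
  tree : SNPolytree V
  root : V
  all_south : ∀ u v, tree.arrow u v → tree.label u v = SNLabel.S
  outward : ∀ u v, tree.arrow u v →
    (SimpleGraph.fromRel tree.arrow).dist root u < (SimpleGraph.fromRel tree.arrow).dist root v

/-- The permutation `[3 2 1 4]`. Throughout, the points `1, 2, 3, 4` are `0, 1, 2, 3 : Fin 4`. -/
def perm3214 : Equiv.Perm (Fin 4) := Equiv.swap 0 2

/-- The data of an element of `ArboNE`: the points of `[3 2 1 4]`, with or without the point `2`,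
and finitely many dangling trees, each hanging off one of the remaining points other than `4`. -/
structure ArboNEData where
  hasTwo : Bool
  ι : Type
  finite : Finite ι
  T : ι → DanglingTree
  base : ι → {k : Fin 4 // hasTwo = true ∨ k ≠ 1}
  base_ne_four : ∀ i, (base i).1 ≠ 3

namespace ArboNEData

/-- The points of `[3 2 1 4]` that are kept. -/
abbrev Core (A : ArboNEData) : Type := {k : Fin 4 // A.hasTwo = true ∨ k ≠ 1}

abbrev Vertex (A : ArboNEData) : Type := A.Core ⊕ (Σ i, (A.T i).V)

/-- The relations that generate the first order: those of the double poset of `[3 2 1 4]`, those of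
the dangling trees, and for each dangling tree an edge from its base to its root. -/
inductive WestGen (A : ArboNEData) : A.Vertex → A.Vertex → Prop
  | core (u v : A.Core) (h : (DoublePoset.ofPerm perm3214).west u.1 v.1) :
      WestGen A (Sum.inl u) (Sum.inl v)
  | tree (i : A.ι) (u v : (A.T i).V) (h : (A.T i).tree.westGen u v) :
      WestGen A (Sum.inr ⟨i, u⟩) (Sum.inr ⟨i, v⟩)
  | attach (i : A.ι) : WestGen A (Sum.inr ⟨i, (A.T i).root⟩) (Sum.inl (A.base i))

/-- The relations that generate the second order. The edge from the base of a dangling tree to its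
root has the label `S`. -/
inductive SouthGen (A : ArboNEData) : A.Vertex → A.Vertex → Prop
  | core (u v : A.Core) (h : (DoublePoset.ofPerm perm3214).south u.1 v.1) :
      SouthGen A (Sum.inl u) (Sum.inl v)
  | tree (i : A.ι) (u v : (A.T i).V) (h : (A.T i).tree.southGen u v) :
      SouthGen A (Sum.inr ⟨i, u⟩) (Sum.inr ⟨i, v⟩)
  | attach (i : A.ι) : SouthGen A (Sum.inr ⟨i, (A.T i).root⟩) (Sum.inl (A.base i))

/-- A height function along which both generating relations increase; it shows that their
transitive closures are strict. -/
noncomputable def height (A : ArboNEData) (σ : Equiv.Perm (Fin 4)) : A.Vertex → ℤ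
  | Sum.inl u => ((σ u.1).1 : ℤ) + 1
  | Sum.inr ⟨i, v⟩ => -((SimpleGraph.fromRel (A.T i).tree.arrow).dist (A.T i).root v : ℤ)

theorem height_lt_of_westGen (A : ArboNEData) {x y : A.Vertex} (h : A.WestGen x y) :
    A.height 1 x < A.height 1 y := by
  cases h with
  | core u v h =>
    have h' : (u.1 : Fin 4) < v.1 := h
    simp only [height, Equiv.Perm.one_apply]
    omega
  | tree i u v h =>
    have := (A.T i).outward v u h
    simp only [height]
    omega
  | attach i =>
    simp only [height, SimpleGraph.dist_self]
    omega

theorem height_lt_of_southGen (A : ArboNEData) {x y : A.Vertex} (h : A.SouthGen x y) :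
    A.height perm3214 x < A.height perm3214 y := by
  cases h with
  | core u v h =>
    have h' : perm3214 u.1 < perm3214 v.1 := h
    simp only [height]
    omega
  | tree i u v h =>
    rcases h with ⟨h, -⟩ | ⟨h, hl⟩
    · have := (A.T i).outward v u h
      simp only [height]
      omega
    · rw [(A.T i).all_south u v h] at hl
      cases hl
  | attach i =>
    simp only [height, SimpleGraph.dist_self]
    omega

theorem transGen_strict {α : Type} {r : α → α → Prop} (f : α → ℤ)
    (hf : ∀ {x y}, r x y → f x < f y) : IsStrictOrder α (Relation.TransGen r) := by
  have key : ∀ {x y}, Relation.TransGen r x y → f x < f y := by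
    intro x y h
    induction h with
    | single h => exact hf h
    | tail _ h ih => exact ih.trans (hf h)
  exact { irrefl := fun a h => lt_irrefl _ (key h), trans := fun _ _ _ h k => h.trans k }

/-- The double poset given by the data: both orders are the transitive closures of the
generating relations. -/
def toDoublePoset (A : ArboNEData) : DoublePoset where
  carrier := A.Vertex
  finite := by
    have := A.finite
    have := fun i => (A.T i).finite
    infer_instance
  west := Relation.TransGen A.WestGen
  south := Relation.TransGen A.SouthGen
  west_strict := transGen_strict (A.height 1) A.height_lt_of_westGen
  south_strict := transGen_strict (A.height perm3214) A.height_lt_of_southGen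

end ArboNEData

/-- The family `ArboNE`, closed under isomorphism of double posets. -/
def ArboNE : Set DoublePoset := {D | ∃ A : ArboNEData, D.IsIso A.toDoublePoset}

/-! ### Word RAM programs

A machine has registers, of which a program can name only finitely many, and a random access
memory. All numbers are natural numbers that have to fit into a word of `w` bits, and the memory has
`S` words. A run that produces a number `≥ 2 ^ w` or accesses an address `≥ S` gets stuck.
Every operation on words takes one step. -/

namespace WordRAM

/-- The contents of the registers and of the memory. -/
structure State where
  reg : ℕ → ℕ
  mem : ℕ → ℕ

inductive BinOp
  | add
  | sub
  | mul
  | div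
  | lt
  | eq

/-- Operations on words: subtraction is truncated at `0`, division is rounded down (and gives `0`
for the divisor `0`), comparisons give `1` if true and `0` otherwise. -/
def BinOp.eval : BinOp → ℕ → ℕ → ℕ
  | .add, x, y => x + y
  | .sub, x, y => x - y
  | .mul, x, y => x * y
  | .div, x, y => x / y
  | .lt, x, y => if x < y then 1 else 0
  | .eq, x, y => if x = y then 1 else 0

/-- Expressions: constants, registers, memory cells (addressed by an expression), operations. -/
inductive Expr
  | const (c : ℕ)
  | reg (r : ℕ)
  | load (a : Expr)
  | op (o : BinOp) (a b : Expr)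

/-- The number of steps that it takes to evaluate an expression. -/
def Expr.cost : Expr → ℕ
  | .const _ => 1
  | .reg _ => 1
  | .load a => a.cost + 1
  | .op _ a b => a.cost + b.cost + 1

/-- A number, provided that it fits into a word of `w` bits. -/
def fit (w x : ℕ) : Option ℕ := if x < 2 ^ w then some x else none

/-- The value of an expression on a machine with `S` memory words of `w` bits; `none` if some
intermediate value does not fit into a word or some address is not below `S`. -/
def Expr.eval (w S : ℕ) (s : State) : Expr → Option ℕ
  | .const c => fit w c
  | .reg r => fit w (s.reg r)
  | .load a => (a.eval w S s).bind fun i => if i < S then fit w (s.mem i) else none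
  | .op o a b => (a.eval w S s).bind fun x => (b.eval w S s).bind fun y => fit w (o.eval x y)

/-- Programs. -/
inductive Cmd
  | skip
  | assign (r : ℕ) (e : Expr)
  | store (a e : Expr)
  | seq (p q : Cmd)
  | ite (b : Expr) (p q : Cmd)
  | loop (b : Expr) (p : Cmd)

/-- `Exec w S p s t s'`: on a machine with `S` memory words of `w` bits, the program `p`, started in
the state `s`, halts after `t` steps in the state `s'`. The command `loop b p` repeats `p` as long
as the value of `b` is not zero. -/
inductive Exec (w S : ℕ) : Cmd → State → ℕ → State → Prop
  | skip (s : State) : Exec w S .skip s 1 s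
  | assign (r : ℕ) (e : Expr) (s : State) (v : ℕ) (he : e.eval w S s = some v) :
      Exec w S (.assign r e) s (e.cost + 1) ⟨Function.update s.reg r v, s.mem⟩
  | store (a e : Expr) (s : State) (i v : ℕ) (ha : a.eval w S s = some i) (hi : i < S)
      (he : e.eval w S s = some v) :
      Exec w S (.store a e) s (a.cost + e.cost + 1) ⟨s.reg, Function.update s.mem i v⟩
  | seq (p q : Cmd) (s s' s'' : State) (t t' : ℕ) (hp : Exec w S p s t s')
      (hq : Exec w S q s' t' s'') : Exec w S (.seq p q) s (t + t') s''
  | ite_true (b : Expr) (p q : Cmd) (s s' : State) (v t : ℕ) (hb : b.eval w S s = some v)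
      (hv : v ≠ 0) (hp : Exec w S p s t s') : Exec w S (.ite b p q) s (b.cost + 1 + t) s'
  | ite_false (b : Expr) (p q : Cmd) (s s' : State) (t : ℕ) (hb : b.eval w S s = some 0)
      (hq : Exec w S q s t s') : Exec w S (.ite b p q) s (b.cost + 1 + t) s'
  | loop_done (b : Expr) (p : Cmd) (s : State) (hb : b.eval w S s = some 0) :
      Exec w S (.loop b p) s (b.cost + 1) s
  | loop_step (b : Expr) (p : Cmd) (s s' s'' : State) (v t t' : ℕ) (hb : b.eval w S s = some v)
      (hv : v ≠ 0) (hp : Exec w S p s t s') (hl : Exec w S (.loop b p) s' t' s'') :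
      Exec w S (.loop b p) s (b.cost + 1 + t + t') s''

/-- The initial state for the input `σ`: register `0` holds `n`, the memory cells `0, …, n - 1` hold
the values of `σ` (all counted from `0`), everything else is `0`. -/
def init {n : ℕ} (σ : Equiv.Perm (Fin n)) : State where
  reg r := if r = 0 then n else 0
  mem i := if h : i < n then (σ ⟨i, h⟩ : ℕ) else 0

end WordRAM

/-- `f = Õ(g)`: `f(n) = O(g(n) (log n)^k)` for some `k`. -/
def IsSoftO (f : ℕ → ℕ) (g : ℕ → ℝ) : Prop :=
  ∃ k : ℕ, (fun n => (f n : ℝ)) =O[atTop] fun n => g n * Real.log n ^ k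

/-- The number `F n σ` can be computed from `σ ∈ 𝔖(n)` in time `Õ(g)` and space `Õ(h)`: one program
does so for all `n` and `σ`, on a machine whose word length is `O(log n)` bits and whose memory
(with room for the input) has `Õ(h)` words. At the end the result is in register `0`. -/
def FeasibleIn (F : (n : ℕ) → Equiv.Perm (Fin n) → ℕ) (g h : ℕ → ℝ) : Prop :=
  ∃ (p : WordRAM.Cmd) (c : ℕ) (T S : ℕ → ℕ), IsSoftO T g ∧ IsSoftO S h ∧
    (∀ n, n ≤ S n) ∧ ∀ (n : ℕ) (σ : Equiv.Perm (Fin n)), ∃ (t : ℕ) (s : WordRAM.State), t ≤ T n ∧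
      WordRAM.Exec (c * (Nat.log 2 n + 1)) (S n) p (WordRAM.init σ) t s ∧ s.reg 0 = F n σ

/-!
The number of morphisms from `D` to `DP(σ)` is computed in two stages.

**The dangling trees.** A map to `DP(σ)` is a morphism if and only if it sends the core, that is
`[3 2 1 4]` or the part without the point `2`, to an occurrence of this pattern in `σ`, and every
vertex of a dangling tree to a point that precedes its parent in both orders
(`ArboNEData.isMor_iff`; parents are unique because the trees are trees and all arrows point away
from the roots). Summing over the position of a leaf multiplies the weight of its parent by a
dominance sum `x ↦ ∑ w q`, over the points `q` to the south-west of `x`. Removing one leaf after the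
other (`exists_weights`) leaves a sum over the occurrences of the pattern, with a product of four
weights that are built from `1` by products and dominance sums (`Weight`). Such weights can be
tabulated in time `Õ(n)` by sweeping over the points with a binary tree for prefix sums
(`Weight.run_prog`).

**The pattern.** Let `x₀ < x₁ < x₂ < x₃` be the positions of the points of the pattern `[3 2 1 4]`
and write `y x` for `σ x`, so that `y x₂ < y x₁ < y x₀ < y x₃`. Cut the positions and the heights
into bands of width `s ~ n^(1/3)`, so that there are about `n^(2/3)` bands. The occurrences are
split into three classes (`InversePerms.patternSum_eq`).

* The height `y x₀` lies in a lower band than `y x₃`. For each band of `y x₃`, the condition on the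
  heights is `y x₀ < h`, where `h` is the lower end of the band. One sweep over all positions sums
  up the decreasing chains `x₀`, `x₁`, `x₂` below `h` with two trees. This takes `n^(2/3)` sweeps of
  time `Õ(n)`.
* The heights `y x₀` and `y x₃` lie in one band, but `x₂` lies in a band to the left of that of
  `x₃`. With positions and heights exchanged, and the chain read backwards, this is the same
  computation, except that the partial sums start afresh in each band.
* The heights `y x₀`, `y x₃` lie in one band, and so do `x₂`, `x₃`. For given `x₂` there are at most
  `s` choices of `x₃`, and then at most `s` choices of `x₀`, thus `n s² ~ n^(5/3)` triples. The sum
  of the weights of `x₁` is a sum over a rectangle, hence a combination of four dominance sums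
  (`InversePerms.innerSum_eq`). Two of them are taken at points of `σ` and have been tabulated, the
  other two are found by tree queries in two sweeps over `x₂`, by position and by height.

The programs are written in a small language of array programs (`Prog`), in which loops run over
read-only parameters and all stored values are reduced modulo `(n + 2)^k`, a number greater than the
result. Hence neither overflow nor data-dependent running times can occur, and a program can be
compiled to the word RAM once and for all (`exec_compile`, `feasibleIn_of_prog`). Its values may be
reasoned about in any commutative ring in which the modulus vanishes, in particular with
subtractions.
-/

namespace WordRAM

/-! ### A language of bounded array programs -/

/-- Terms of the array language: constants, variables, read-only parameters, array entries
(`get d i` is the entry of the array number `d` at the index `i`, reduced modulo the common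
length of the arrays), operations. -/
inductive Tm
  | const (c : ℕ)
  | var (r : ℕ)
  | par (k : ℕ)
  | get (d : ℕ) (i : Tm)
  | op (o : BinOp) (a b : Tm)

/-- Array programs. `loop k r p` runs `p` with the variable `r` set to `0, 1, …` below the value of
the parameter `k`; as parameters are never written, the running time does not depend on the data. -/
inductive Prog
  | skip
  | assign (r : ℕ) (e : Tm)
  | store (d : ℕ) (i e : Tm)
  | seq (p q : Prog)
  | ite (b : Tm) (p q : Prog)
  | loop (k r : ℕ) (p : Prog)

/-- The data of an array program: variables and arrays. -/
structure St where
  var : ℕ → ℕ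
  arr : ℕ → ℕ → ℕ

namespace St

/-- Write a variable. -/
def setV (s : St) (r v : ℕ) : St := ⟨Function.update s.var r v, s.arr⟩

/-- Replace an array. -/
def setArr (s : St) (d : ℕ) (a : ℕ → ℕ) : St := ⟨s.var, Function.update s.arr d a⟩

/-- Write an entry of an array. -/
def setA (s : St) (d i v : ℕ) : St := s.setArr d (Function.update (s.arr d) i v)

@[simp] theorem setV_var (s : St) (r v r' : ℕ) :
    (s.setV r v).var r' = if r' = r then v else s.var r' := by
  simp [setV, Function.update_apply]

@[simp] theorem setV_arr (s : St) (r v : ℕ) : (s.setV r v).arr = s.arr := rfl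

@[simp] theorem setArr_arr (s : St) (d : ℕ) (a : ℕ → ℕ) (d' : ℕ) :
    (s.setArr d a).arr d' = if d' = d then a else s.arr d' := by
  simp [setArr, Function.update_apply]

@[simp] theorem setA_var (s : St) (d i v : ℕ) : (s.setA d i v).var = s.var := rfl

theorem setA_arr (s : St) (d i v d' : ℕ) :
    (s.setA d i v).arr d' = if d' = d then Function.update (s.arr d) i v else s.arr d' := by
  simp [setA]

@[simp] theorem setA_arr_apply (s : St) (d i v d' i' : ℕ) :
    (s.setA d i v).arr d' i' = if d' = d ∧ i' = i then v else s.arr d' i' := by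
  rw [setA_arr]
  by_cases h : d' = d
  · subst h
    simp [Function.update_apply]
  · simp [h]

end St

/-- Apply `f 0, f 1, …, f (m - 1)` in turn. -/
def iter {α : Type} (f : ℕ → α → α) : ℕ → α → α
  | 0, a => a
  | m + 1, a => f m (iter f m a)

/-- The value of a term. The parameter `2` is the length of the arrays. -/
def Tm.ev (ρ : ℕ → ℕ) (s : St) : Tm → ℕ
  | .const c => c
  | .var r => s.var r
  | .par k => ρ k
  | .get d i => s.arr d (i.ev ρ s % ρ 2)
  | .op o a b => o.eval (a.ev ρ s) (b.ev ρ s)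

/-- The effect of a program. All values are reduced modulo the parameter `1` when they are stored,
so that no overflow can occur. -/
def Prog.run (ρ : ℕ → ℕ) : Prog → St → St
  | .skip, s => s
  | .assign r e, s => s.setV r (e.ev ρ s % ρ 1)
  | .store d i e, s => s.setA d (i.ev ρ s % ρ 2) (e.ev ρ s % ρ 1)
  | .seq p q, s => q.run ρ (p.run ρ s)
  | .ite b p q, s => if b.ev ρ s ≠ 0 then p.run ρ s else q.run ρ s
  | .loop k r p, s => iter (fun j s => p.run ρ (s.setV r j)) (ρ k) s

/-! ### Compilation to word RAM programs -/

/-- `e` modulo `m`. -/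
def Expr.mod (e m : Expr) : Expr := .op .sub e (.op .mul (.op .div e m) m)

/-- The address of the entry `i` of the array `d`. -/
def Expr.addr (d : ℕ) (i : Expr) : Expr :=
  .op .add (.op .mul (.const d) (.reg 7)) (i.mod (.reg 7))

/-- The parameter `k` is kept in the register `3 * k + 1`, the variable `r` in `3 * r + 2`. -/
def Tm.compile : Tm → Expr
  | .const c => .const c
  | .var r => .reg (3 * r + 2)
  | .par k => .reg (3 * k + 1)
  | .get d i => .load (.addr d i.compile)
  | .op o a b => .op o a.compile b.compile

/-- The compiled program; the loops that enclose it use the registers `3 * j`, `j < c`, as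
counters. -/
def Prog.compile : Prog → ℕ → Cmd
  | .skip, _ => .skip
  | .assign r e, _ => .assign (3 * r + 2) (e.compile.mod (.reg 4))
  | .store d i e, _ => .store (.addr d i.compile) (e.compile.mod (.reg 4))
  | .seq p q, c => .seq (p.compile c) (q.compile c)
  | .ite b p q, c => .ite b.compile (p.compile c) (q.compile c)
  | .loop k r p, c => .seq (.assign (3 * c) (.const 0))
      (.loop (.op .lt (.reg (3 * c)) (.reg (3 * k + 1)))
        (.seq (.assign (3 * r + 2) (.reg (3 * c)))
          (.seq (p.compile (c + 1)) (.assign (3 * c) (.op .add (.reg (3 * c)) (.const 1))))))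

/-- A bound for the number of steps of the compiled program. -/
def Prog.time (ρ : ℕ → ℕ) : Prog → ℕ
  | .skip => 1
  | .assign _ e => (e.compile.mod (.reg 4)).cost + 1
  | .store d i e => (Expr.addr d i.compile).cost + (e.compile.mod (.reg 4)).cost + 1
  | .seq p q => p.time ρ + q.time ρ
  | .ite b p q => b.compile.cost + 1 + (p.time ρ + q.time ρ)
  | .loop k _ p => 6 + ρ k * (p.time ρ + 10)

/-- If all data are less than `M`, then all values that occur in the evaluation of the term are
less than `M ^ e.size`. -/
def Tm.size : Tm → ℕ
  | .const c => c + 1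
  | .var _ => 2
  | .par _ => 2
  | .get d i => i.size + d + 4
  | .op _ a b => a.size + b.size

/-- The maximal size of a term in the program. -/
def Prog.size : Prog → ℕ
  | .skip => 2
  | .assign _ e => e.size + 2
  | .store d i e => (Tm.get d i).size + e.size + 2
  | .seq p q => max p.size q.size
  | .ite b p q => max b.size (max p.size q.size)
  | .loop _ _ p => max 2 p.size

/-- The numbers of all arrays in the term are less than `K`. -/
def Tm.Slots (K : ℕ) : Tm → Prop
  | .const _ => True
  | .var _ => True
  | .par _ => True
  | .get d i => d < K ∧ i.Slots K
  | .op _ a b => a.Slots K ∧ b.Slots K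

/-- The numbers of all arrays in the program are less than `K`. -/
def Prog.Slots (K : ℕ) : Prog → Prop
  | .skip => True
  | .assign _ e => e.Slots K
  | .store d i e => d < K ∧ i.Slots K ∧ e.Slots K
  | .seq p q => p.Slots K ∧ q.Slots K
  | .ite b p q => b.Slots K ∧ p.Slots K ∧ q.Slots K
  | .loop _ _ p => p.Slots K

theorem Tm.Slots.mono {K K' : ℕ} (h : K ≤ K') {e : Tm} (he : e.Slots K) : e.Slots K' := by
  induction e with
  | const | var | par => trivial
  | get d i ih => exact ⟨he.1.trans_le h, ih he.2⟩
  | op o a b iha ihb => exact ⟨iha he.1, ihb he.2⟩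

theorem Prog.Slots.mono {K K' : ℕ} (h : K ≤ K') {p : Prog} (hp : p.Slots K) : p.Slots K' := by
  induction p with
  | skip => trivial
  | assign r e => exact Tm.Slots.mono h hp
  | store d i e => exact ⟨hp.1.trans_le h, hp.2.1.mono h, hp.2.2.mono h⟩
  | seq p q ihp ihq => exact ⟨ihp hp.1, ihq hp.2⟩
  | ite b p q ihp ihq => exact ⟨hp.1.mono h, ihp hp.2.1, ihq hp.2.2⟩
  | loop k r p ih => exact ih hp

theorem Tm.exists_slots (e : Tm) : ∃ K, e.Slots K := by
  induction e with
  | const | var | par => exact ⟨0, trivial⟩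
  | get d i ih =>
    obtain ⟨K, hK⟩ := ih
    exact ⟨K + d + 1, by omega, hK.mono (by omega)⟩
  | op o a b iha ihb =>
    obtain ⟨K, hK⟩ := iha
    obtain ⟨K', hK'⟩ := ihb
    exact ⟨K + K', hK.mono (by omega), hK'.mono (by omega)⟩

theorem Prog.exists_slots (p : Prog) : ∃ K, p.Slots K := by
  induction p with
  | skip => exact ⟨0, trivial⟩
  | assign r e => exact e.exists_slots
  | store d i e =>
    obtain ⟨K, hK⟩ := i.exists_slots
    obtain ⟨K', hK'⟩ := e.exists_slots
    exact ⟨K + K' + d + 1, by omega, hK.mono (by omega), hK'.mono (by omega)⟩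
  | seq p q ihp ihq =>
    obtain ⟨K, hK⟩ := ihp
    obtain ⟨K', hK'⟩ := ihq
    exact ⟨K + K', hK.mono (by omega), hK'.mono (by omega)⟩
  | ite b p q ihp ihq =>
    obtain ⟨K, hK⟩ := ihp
    obtain ⟨K', hK'⟩ := ihq
    obtain ⟨K'', hK''⟩ := b.exists_slots
    exact ⟨K + K' + K'', hK''.mono (by omega), hK.mono (by omega), hK'.mono (by omega)⟩
  | loop k r p ih => exact ih

/-- The parameters are suitable for a machine with `S` words of `w` bits and `K` arrays, if the
terms have size at most `b`. -/
structure Suitable (ρ : ℕ → ℕ) (w S K b : ℕ) : Prop where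
  two_le : 2 ≤ ρ 1
  pos : 0 < ρ 2
  le : ∀ k, ρ k ≤ ρ 1
  slots : K * ρ 2 ≤ S
  word : ρ 1 ^ b ≤ 2 ^ w

/-- The state `m` of the machine represents the data `s`. -/
structure Rel (ρ : ℕ → ℕ) (K : ℕ) (s : St) (m : State) : Prop where
  par : ∀ k, m.reg (3 * k + 1) = ρ k
  var : ∀ r, m.reg (3 * r + 2) = s.var r
  arr : ∀ d < K, ∀ i < ρ 2, m.mem (d * ρ 2 + i) = s.arr d i
  var_lt : ∀ r, s.var r < ρ 1
  arr_lt : ∀ d i, s.arr d i < ρ 1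

theorem fit_of_lt {w x : ℕ} (h : x < 2 ^ w) : fit w x = some x := if_pos h

theorem eval_op {w S : ℕ} {m : State} {a b : Expr} {x y : ℕ} (o : BinOp)
    (ha : a.eval w S m = some x) (hb : b.eval w S m = some y) (h : o.eval x y < 2 ^ w) :
    (Expr.op o a b).eval w S m = some (o.eval x y) := by
  simp only [Expr.eval, ha, hb, Option.bind_some]
  exact fit_of_lt h

theorem eval_mod {w S : ℕ} {m : State} {a b : Expr} {x y : ℕ}
    (ha : a.eval w S m = some x) (hb : b.eval w S m = some y) (h : x < 2 ^ w) :
    (a.mod b).eval w S m = some (x % y) := by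
  have h1 : x / y * y ≤ x := Nat.div_mul_le_self x y
  have h2 := eval_op .div ha hb (lt_of_le_of_lt (Nat.div_le_self x y) h)
  have h3 := eval_op .mul h2 hb (lt_of_le_of_lt h1 h)
  have h4 := eval_op .sub ha h3 (lt_of_le_of_lt (Nat.sub_le _ _) h)
  refine h4.trans ?_
  have := Nat.div_add_mod x y
  simp only [BinOp.eval, Option.some.injEq]
  rw [mul_comm] at this
  omega

theorem lt_pow_of_lt {M x a b : ℕ} (hM : 2 ≤ M) (hx : x < M ^ a) (h : a ≤ b) : x < M ^ b :=
  hx.trans_le (Nat.pow_le_pow_right (by omega) h)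

theorem BinOp.eval_lt {M x y a b : ℕ} (hM : 2 ≤ M) (hx : x < M ^ a) (hy : y < M ^ b)
    (ha : 0 < a + b) (o : BinOp) : o.eval x y < M ^ (a + b) := by
  have hp : M ^ a * M ^ b = M ^ (a + b) := (pow_add M a b).symm
  have ha0 : 0 < M ^ a := by positivity
  have hb0 : 0 < M ^ b := by positivity
  have hxa : x < M ^ (a + b) := lt_pow_of_lt hM hx (by omega)
  have h1 : 1 < M ^ (a + b) := Nat.one_lt_pow (by omega) (by omega)
  cases o with
  | add =>
    simp only [BinOp.eval]
    nlinarith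
  | sub => exact lt_of_le_of_lt (Nat.sub_le _ _) hxa
  | mul =>
    simp only [BinOp.eval]
    rw [← hp]
    exact Nat.mul_lt_mul'' hx hy
  | div => exact lt_of_le_of_lt (Nat.div_le_self _ _) hxa
  | lt =>
    simp only [BinOp.eval]
    split <;> omega
  | eq =>
    simp only [BinOp.eval]
    split <;> omega

theorem Tm.size_pos (e : Tm) : 0 < e.size := by
  induction e <;> simp only [Tm.size] <;> omega

section Correctness

variable {ρ : ℕ → ℕ} {w S K b : ℕ} {s : St} {m : State}

theorem eval_addr (H : Suitable ρ w S K b) (R : Rel ρ K s m) {d x : ℕ} (hd : d < K)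
    (hb : d + 4 ≤ b) {i : Expr} (hi : i.eval w S m = some x) (hx : x < 2 ^ w) :
    (Expr.addr d i).eval w S m = some (d * ρ 2 + x % ρ 2) ∧ d * ρ 2 + x % ρ 2 < S := by
  have hM := H.two_le
  have hN : m.reg 7 = ρ 2 := R.par 2
  have hmod := Nat.mod_lt x H.pos
  have hdw : d < ρ 1 ^ d := Nat.lt_pow_self (by omega)
  have hNle : ρ 2 < ρ 1 ^ 2 := by
    have := H.le 2
    nlinarith
  have hsum : d * ρ 2 + x % ρ 2 < ρ 1 ^ b := by
    have h1 : d * ρ 2 + x % ρ 2 < (d + 1) * ρ 2 := by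
      rw [add_mul]
      omega
    have h2 : (d + 1) * ρ 2 ≤ ρ 1 ^ d * ρ 1 ^ 2 := Nat.mul_le_mul hdw hNle.le
    rw [← pow_add] at h2
    exact lt_pow_of_lt hM (h1.trans_le h2) (by omega)
  have hc : (Expr.const d).eval w S m = some d :=
    fit_of_lt ((lt_pow_of_lt hM hdw (by omega)).trans_le H.word)
  have hr : (Expr.reg 7).eval w S m = some (ρ 2) := by
    rw [Expr.eval, hN]
    exact fit_of_lt ((lt_pow_of_lt hM hNle (by omega)).trans_le H.word)
  have h1 := eval_op .mul hc hr (lt_of_le_of_lt (Nat.le_add_right _ _) (hsum.trans_le H.word))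
  have h2 := eval_op .add h1 (eval_mod hi hr hx) (hsum.trans_le H.word)
  refine ⟨h2, ?_⟩
  calc d * ρ 2 + x % ρ 2 < (d + 1) * ρ 2 := by
        rw [add_mul]
        omega
    _ ≤ K * ρ 2 := Nat.mul_le_mul_right _ hd
    _ ≤ S := H.slots

/-- A compiled term evaluates to the value of the term, without overflow. -/
theorem eval_compile (H : Suitable ρ w S K b) (R : Rel ρ K s m) (e : Tm) (he : e.Slots K)
    (hb : e.size ≤ b) :
    e.compile.eval w S m = some (e.ev ρ s) ∧ e.ev ρ s < ρ 1 ^ e.size := by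
  have hM := H.two_le
  have fits : ∀ {x : ℕ} {e' : Tm}, e'.size ≤ b → x < ρ 1 ^ e'.size → x < 2 ^ w :=
    fun h hx => (lt_pow_of_lt hM hx h).trans_le H.word
  have hsq : ρ 1 < ρ 1 ^ 2 := by nlinarith
  induction e with
  | const c =>
    have h : c < ρ 1 ^ (Tm.const c).size :=
      (Nat.lt_pow_self (by omega)).trans_le (Nat.pow_le_pow_right (by omega) (Nat.le_succ c))
    exact ⟨fit_of_lt (fits hb h), h⟩
  | var r =>
    have h : s.var r < ρ 1 ^ (Tm.var r).size := (R.var_lt r).trans hsq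
    refine ⟨?_, h⟩
    simp only [Tm.compile, Expr.eval, R.var]
    exact fit_of_lt (fits hb h)
  | par k =>
    have h : ρ k < ρ 1 ^ (Tm.par k).size := (H.le k).trans_lt hsq
    refine ⟨?_, h⟩
    simp only [Tm.compile, Expr.eval, R.par]
    exact fit_of_lt (fits hb h)
  | get d i ih =>
    simp only [Tm.size] at hb
    obtain ⟨h1, h2⟩ := ih he.2 (by omega)
    obtain ⟨h3, h4⟩ := eval_addr H R he.1 (by omega) h1 (fits (by omega) h2)
    have hmem := R.arr d he.1 (i.ev ρ s % ρ 2) (Nat.mod_lt _ H.pos)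
    have h5 : (Tm.get d i).ev ρ s < ρ 1 ^ (Tm.get d i).size :=
      lt_pow_of_lt hM ((R.arr_lt _ _).trans hsq) (by simp only [Tm.size]; omega)
    refine ⟨?_, h5⟩
    simp only [Tm.compile, Expr.eval, h3, Option.bind_some, if_pos h4, hmem]
    exact fit_of_lt (fits (by simpa only [Tm.size] using hb) h5)
  | op o x y ihx ihy =>
    simp only [Tm.size] at hb
    obtain ⟨h1, h2⟩ := ihx he.1 (by omega)
    obtain ⟨h3, h4⟩ := ihy he.2 (by omega)
    have h5 := BinOp.eval_lt hM h2 h4 (by have := x.size_pos; omega) o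
    exact ⟨eval_op o h1 h3 (fits (e' := .op o x y) (by simpa only [Tm.size] using hb) h5), h5⟩

theorem eval_compile_mod (H : Suitable ρ w S K b) (R : Rel ρ K s m) (e : Tm) (he : e.Slots K)
    (hb : e.size + 2 ≤ b) :
    (e.compile.mod (.reg 4)).eval w S m = some (e.ev ρ s % ρ 1) := by
  obtain ⟨h1, h2⟩ := eval_compile H R e he (by omega)
  have hM := H.two_le
  have hr : (Expr.reg 4).eval w S m = some (ρ 1) := by
    have : m.reg 4 = ρ 1 := R.par 1
    rw [Expr.eval, this]
    exact fit_of_lt ((lt_pow_of_lt (a := 2) hM (by nlinarith) (by omega)).trans_le H.word)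
  exact eval_mod h1 hr ((lt_pow_of_lt hM h2 (by omega)).trans_le H.word)

theorem Rel.setV (R : Rel ρ K s m) (r : ℕ) {v : ℕ} (hv : v < ρ 1) :
    Rel ρ K (s.setV r v) ⟨Function.update m.reg (3 * r + 2) v, m.mem⟩ where
  par k := by
    rw [← R.par k]
    exact Function.update_of_ne (by omega) _ _
  var r' := by
    simp only [Function.update_apply, St.setV_var, R.var]
    congr 1
    simp
  arr := R.arr
  var_lt r' := by
    rw [St.setV_var]
    split
    · exact hv
    · exact R.var_lt r'
  arr_lt := R.arr_lt

theorem Rel.setCounter (R : Rel ρ K s m) (c v : ℕ) :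
    Rel ρ K s ⟨Function.update m.reg (3 * c) v, m.mem⟩ where
  par k := by
    rw [← R.par k]
    exact Function.update_of_ne (by omega) _ _
  var r := by
    rw [← R.var r]
    exact Function.update_of_ne (by omega) _ _
  arr := R.arr
  var_lt := R.var_lt
  arr_lt := R.arr_lt

theorem Rel.setA (R : Rel ρ K s m) (d : ℕ) {i v : ℕ} (hi : i < ρ 2) (hv : v < ρ 1) :
    Rel ρ K (s.setA d i v) ⟨m.reg, Function.update m.mem (d * ρ 2 + i) v⟩ where
  par := R.par
  var := R.var
  arr d' hd' i' hi' := by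
    have key : d' * ρ 2 + i' = d * ρ 2 + i ↔ d' = d ∧ i' = i := by
      constructor
      · intro h
        have h1 := congrArg (· / ρ 2) h
        have h2 := congrArg (· % ρ 2) h
        have hp : 0 < ρ 2 := by omega
        simp only [mul_comm _ (ρ 2), Nat.mul_add_div hp, Nat.mul_add_mod,
          Nat.div_eq_of_lt hi, Nat.div_eq_of_lt hi', Nat.mod_eq_of_lt hi,
          Nat.mod_eq_of_lt hi', add_zero] at h1 h2
        exact ⟨h1, h2⟩
      · rintro ⟨rfl, rfl⟩
        rfl
    simp only [Function.update_apply, St.setA_arr_apply, key, R.arr d' hd' i' hi']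
  var_lt := R.var_lt
  arr_lt d' i' := by
    rw [St.setA_arr_apply]
    split
    · exact hv
    · exact R.arr_lt d' i'

/-- The compiled program runs without getting stuck, within the time bound, and its effect is the
effect of the array program. -/
theorem exec_compile (H : Suitable ρ w S K b) (p : Prog) : ∀ (c : ℕ) (s : St) (m : State),
    p.Slots K → p.size ≤ b → Rel ρ K s m →
    ∃ (t : ℕ) (m' : State), Exec w S (p.compile c) m t m' ∧ t ≤ p.time ρ ∧
      Rel ρ K (p.run ρ s) m' ∧ ∀ j < c, m'.reg (3 * j) = m.reg (3 * j) := by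
  have hM := H.two_le
  induction p with
  | skip => exact fun c s m _ _ R => ⟨1, m, .skip m, le_rfl, R, fun _ _ => rfl⟩
  | assign r e =>
    intro c s m hK hb R
    have h := eval_compile_mod H R e hK hb
    refine ⟨_, _, .assign _ _ _ _ h, le_rfl, R.setV r (Nat.mod_lt _ (by omega)), fun j _ => ?_⟩
    exact Function.update_of_ne (by omega) _ _
  | store d i e =>
    intro c s m hK hb R
    simp only [Prog.size, Tm.size] at hb
    obtain ⟨h1, h2⟩ := eval_compile H R i hK.2.1 (by omega)
    obtain ⟨h3, h4⟩ := eval_addr H R hK.1 (by omega) h1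
      ((lt_pow_of_lt hM h2 (by omega)).trans_le H.word)
    have h := eval_compile_mod H R e hK.2.2 (by omega)
    exact ⟨_, _, .store _ _ _ _ _ h3 h4 h, le_rfl,
      R.setA d (Nat.mod_lt _ H.pos) (Nat.mod_lt _ (by omega)), fun _ _ => rfl⟩
  | seq p q ihp ihq =>
    intro c s m hK hb R
    simp only [Prog.size] at hb
    obtain ⟨t1, m1, e1, l1, R1, f1⟩ := ihp c s m hK.1 (by omega) R
    obtain ⟨t2, m2, e2, l2, R2, f2⟩ := ihq c _ m1 hK.2 (by omega) R1
    exact ⟨_, m2, .seq _ _ _ _ _ _ _ e1 e2, Nat.add_le_add l1 l2, R2,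
      fun j hj => (f2 j hj).trans (f1 j hj)⟩
  | ite e p q ihp ihq =>
    intro c s m hK hb R
    simp only [Prog.size] at hb
    obtain ⟨h1, -⟩ := eval_compile H R e hK.1 (by omega)
    by_cases he : e.ev ρ s = 0
    · obtain ⟨t, m', e2, l2, R2, f2⟩ := ihq c s m hK.2.2 (by omega) R
      refine ⟨_, m', .ite_false _ _ _ _ _ _ (he ▸ h1) e2, ?_, ?_, f2⟩
      · simp only [Prog.time]
        omega
      · simpa only [Prog.run, he, ne_eq, not_true_eq_false, if_false] using R2
    · obtain ⟨t, m', e2, l2, R2, f2⟩ := ihp c s m hK.2.1 (by omega) R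
      refine ⟨_, m', .ite_true _ _ _ _ _ _ _ h1 he e2, ?_, ?_, f2⟩
      · simp only [Prog.time]
        omega
      · simpa only [Prog.run, ne_eq, he, not_false_eq_true, if_true] using R2
  | loop k r p ih =>
    intro c s m hK hb R
    simp only [Prog.size] at hb
    have hMw : ρ 1 < 2 ^ w :=
      (lt_pow_of_lt (a := 2) hM (by nlinarith) (by omega)).trans_le H.word
    have fits : ∀ {x}, x ≤ ρ 1 → x < 2 ^ w := fun h => lt_of_le_of_lt h hMw
    set f : ℕ → St → St := fun j s => p.run ρ (s.setV r j) with hf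
    set body : Cmd := .seq (.assign (3 * r + 2) (.reg (3 * c)))
      (.seq (p.compile (c + 1)) (.assign (3 * c) (.op .add (.reg (3 * c)) (.const 1)))) with hbody
    -- Induction on the number `u` of the remaining rounds.
    have main : ∀ (u j : ℕ) (m : State), j + u = ρ k → m.reg (3 * c) = j →
        Rel ρ K (iter f j s) m → ∃ (t : ℕ) (m' : State),
          Exec w S (.loop (.op .lt (.reg (3 * c)) (.reg (3 * k + 1))) body) m t m' ∧
          t ≤ 4 + u * (p.time ρ + 10) ∧ Rel ρ K (iter f (ρ k) s) m' ∧
          ∀ j < c, m'.reg (3 * j) = m.reg (3 * j) := by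
      intro u
      induction u with
      | zero =>
        intro j m hj hm R
        have hjk : j = ρ k := by omega
        have h : (Expr.op .lt (.reg (3 * c)) (.reg (3 * k + 1))).eval w S m = some 0 := by
          have hk := H.le k
          have h1 : (Expr.reg (3 * c)).eval w S m = some j := by
            rw [Expr.eval, hm]
            exact fit_of_lt (fits (by omega))
          have h2 : (Expr.reg (3 * k + 1)).eval w S m = some (ρ k) := by
            rw [Expr.eval, R.par]
            exact fit_of_lt (fits hk)
          have := eval_op .lt h1 h2 (by simp [BinOp.eval, hjk])
          simpa [BinOp.eval, hjk] using this
        exact ⟨_, m, .loop_done _ _ _ h, by simp [Expr.cost], hjk ▸ R, fun _ _ => rfl⟩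
      | succ u ihu =>
        intro j m hj hm R
        have hjk : j < ρ k := by omega
        have hk := H.le k
        have h1 : (Expr.reg (3 * c)).eval w S m = some j := by
          rw [Expr.eval, hm]
          exact fit_of_lt (fits (by omega))
        have h2 : (Expr.reg (3 * k + 1)).eval w S m = some (ρ k) := by
          rw [Expr.eval, R.par]
          exact fit_of_lt (fits hk)
        have h : (Expr.op .lt (.reg (3 * c)) (.reg (3 * k + 1))).eval w S m = some 1 := by
          have := eval_op .lt h1 h2 (by simp only [BinOp.eval, if_pos hjk]; exact fits (by omega))
          simpa [BinOp.eval, hjk] using this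
        have R1 := R.setV r (v := j) (by omega)
        obtain ⟨t, m2, e2, l2, R2, f2⟩ := ih (c + 1) _ _ hK (by omega) R1
        have hm2 : m2.reg (3 * c) = j := by
          rw [f2 c (by omega), ← hm]
          exact Function.update_of_ne (by omega) _ _
        have h3 : (Expr.op .add (.reg (3 * c)) (.const 1)).eval w S m2 = some (j + 1) := by
          have h1 : (Expr.reg (3 * c)).eval w S m2 = some j := by
            rw [Expr.eval, hm2]
            exact fit_of_lt (fits (by omega))
          have h2 : (Expr.const 1).eval w S m2 = some 1 := fit_of_lt (fits (by omega))
          exact eval_op .add h1 h2 (fits (by simp only [BinOp.eval]; omega))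
        have R3 := R2.setCounter c (j + 1)
        obtain ⟨t', m4, e4, l4, R4, f4⟩ := ihu (j + 1) _ (by omega)
          (Function.update_self _ _ _) R3
        refine ⟨_, m4, .loop_step _ _ _ _ _ _ _ _ h one_ne_zero
          (.seq _ _ _ _ _ _ _ (.assign _ _ _ _ h1) (.seq _ _ _ _ _ _ _ e2 (.assign _ _ _ _ h3)))
          e4, ?_, R4, ?_⟩
        · simp only [Expr.cost]
          rw [add_mul]
          omega
        · intro i hi
          rw [f4 i hi]
          refine (Function.update_of_ne (by omega) _ _).trans ?_
          rw [f2 i (by omega)]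
          exact Function.update_of_ne (by omega) _ _
    have h0 : (Expr.const 0).eval w S m = some 0 := fit_of_lt (fits (by omega))
    obtain ⟨t, m', e2, l2, R2, f2⟩ := main (ρ k) 0 _ (by omega) (Function.update_self _ _ _)
      (R.setCounter c 0)
    refine ⟨_, m', .seq _ _ _ _ _ _ _ (.assign _ _ _ _ h0) e2, ?_, R2, ?_⟩
    · simp only [Prog.time, Expr.cost]
      omega
    · intro i hi
      rw [f2 i hi]
      exact Function.update_of_ne (by omega) _ _

end Correctness

/-! ### Running times of array programs -/

/-- The exponent of `B` in the running time, if the parameter `k` is of the order `B ^ e k`. -/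
def Prog.expo (e : ℕ → ℕ) : Prog → ℕ
  | .skip => 0
  | .assign _ _ => 0
  | .store _ _ _ => 0
  | .seq p q => max (p.expo e) (q.expo e)
  | .ite _ p q => max (p.expo e) (q.expo e)
  | .loop k _ p => e k + p.expo e

/-- The running time, with `B` for the cube root of the input length and `Λ` for its logarithm. -/
theorem Prog.time_le (e : ℕ → ℕ) (C₀ : ℕ) (p : Prog) : ∃ C d : ℕ, ∀ (ρ : ℕ → ℕ) (B Λ : ℕ),
    1 ≤ B → 1 ≤ Λ → (∀ k, ρ k ≤ C₀ * B ^ e k * Λ) →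
    p.time ρ ≤ C * B ^ p.expo e * Λ ^ d := by
  have const : ∀ c : ℕ, ∃ C d : ℕ, ∀ (ρ : ℕ → ℕ) (B Λ : ℕ),
    1 ≤ B → 1 ≤ Λ → (∀ k, ρ k ≤ C₀ * B ^ e k * Λ) → c ≤ C * B ^ 0 * Λ ^ d :=
    fun c => ⟨c, 0, fun _ _ _ _ _ _ => by simp⟩
  have mono : ∀ {C B Λ x y d d' : ℕ}, 1 ≤ B → 1 ≤ Λ → x ≤ y → d ≤ d' →
      C * B ^ x * Λ ^ d ≤ C * B ^ y * Λ ^ d' := fun hB hΛ hx hd =>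
    Nat.mul_le_mul (Nat.mul_le_mul_left _ (Nat.pow_le_pow_right hB hx))
      (Nat.pow_le_pow_right hΛ hd)
  induction p with
  | skip => exact const _
  | assign r t => exact const _
  | store d i t => exact const _
  | seq p q ihp ihq =>
    obtain ⟨C, d, h⟩ := ihp
    obtain ⟨C', d', h'⟩ := ihq
    refine ⟨C + C', d + d', fun ρ B Λ hB hΛ hρ => ?_⟩
    have h1 := (h ρ B Λ hB hΛ hρ).trans
      (mono hB hΛ (le_max_left (p.expo e) (q.expo e)) (Nat.le_add_right d d'))
    have h2 := (h' ρ B Λ hB hΛ hρ).trans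
      (mono hB hΛ (le_max_right (p.expo e) (q.expo e)) (Nat.le_add_left d' d))
    simp only [Prog.time, Prog.expo, add_mul]
    omega
  | ite b p q ihp ihq =>
    obtain ⟨C, d, h⟩ := ihp
    obtain ⟨C', d', h'⟩ := ihq
    refine ⟨b.compile.cost + 1 + (C + C'), d + d', fun ρ B Λ hB hΛ hρ => ?_⟩
    have h1 := (h ρ B Λ hB hΛ hρ).trans
      (mono hB hΛ (le_max_left (p.expo e) (q.expo e)) (Nat.le_add_right d d'))
    have h2 := (h' ρ B Λ hB hΛ hρ).trans
      (mono hB hΛ (le_max_right (p.expo e) (q.expo e)) (Nat.le_add_left d' d))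
    have h3 : b.compile.cost + 1 ≤
        (b.compile.cost + 1) * B ^ (max (p.expo e) (q.expo e)) * Λ ^ (d + d') := by
      rw [mul_assoc]
      exact Nat.le_mul_of_pos_right _ (by positivity)
    simp only [Prog.time, Prog.expo]
    rw [add_mul (b.compile.cost + 1), add_mul C, add_mul _ _ (Λ ^ (d + d')),
      add_mul _ _ (Λ ^ (d + d'))]
    omega
  | loop k r p ih =>
    obtain ⟨C, d, h⟩ := ih
    refine ⟨6 + C₀ * (C + 10), d + 1, fun ρ B Λ hB hΛ hρ => ?_⟩
    have h1 := h ρ B Λ hB hΛ hρ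
    have hpos : 1 ≤ B ^ p.expo e * Λ ^ d := Nat.one_le_iff_ne_zero.2 (by positivity)
    have h2 : p.time ρ + 10 ≤ (C + 10) * (B ^ p.expo e * Λ ^ d) := by
      rw [add_mul, ← mul_assoc]
      omega
    have h3 := Nat.mul_le_mul (hρ k) h2
    have hpos' : 6 ≤ 6 * (B ^ (e k + p.expo e) * Λ ^ (d + 1)) :=
      Nat.le_mul_of_pos_right _ (by positivity)
    have h4 : C₀ * B ^ e k * Λ * ((C + 10) * (B ^ p.expo e * Λ ^ d)) =
        C₀ * (C + 10) * (B ^ (e k + p.expo e) * Λ ^ (d + 1)) := by ring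
    simp only [Prog.time, Prog.expo]
    rw [mul_assoc, add_mul]
    omega

/-- A natural number slightly above the cube root. -/
noncomputable def cubeRoot (n : ℕ) : ℕ := ⌈(n : ℝ) ^ ((1 : ℝ) / 3)⌉₊ + 1

theorem le_cubeRoot_pow (n : ℕ) : n ≤ cubeRoot n ^ 3 := by
  have h1 : (n : ℝ) ^ ((1 : ℝ) / 3) ≤ (cubeRoot n : ℝ) := by
    rw [cubeRoot]
    push_cast
    linarith [Nat.le_ceil ((n : ℝ) ^ ((1 : ℝ) / 3))]
  have h2 : ((n : ℝ) ^ ((1 : ℝ) / 3)) ^ 3 ≤ (cubeRoot n : ℝ) ^ 3 :=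
    pow_le_pow_left₀ (by positivity) h1 3
  have h3 : ((n : ℝ) ^ ((1 : ℝ) / 3)) ^ 3 = n := by
    rw [← Real.rpow_natCast, ← Real.rpow_mul (by positivity)]
    norm_num
  rw [h3] at h2
  exact_mod_cast h2

theorem isSoftO_time (C d : ℕ) :
    IsSoftO (fun n => C * cubeRoot n ^ 5 * (Nat.log 2 n + 3) ^ d)
      (fun n => (n : ℝ) ^ ((5 : ℝ) / 3)) := by
  refine ⟨d, IsBigO.of_bound (C * 3 ^ 5 * 6 ^ d) ?_⟩
  filter_upwards [eventually_ge_atTop 3] with n hn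
  have hn' : (3 : ℝ) ≤ n := by exact_mod_cast hn
  have hlog1 : 1 ≤ Real.log n := by
    rw [Real.le_log_iff_exp_le (by linarith)]
    linarith [Real.exp_one_lt_d9]
  have hroot : 1 ≤ (n : ℝ) ^ ((1 : ℝ) / 3) := Real.one_le_rpow (by linarith) (by norm_num)
  have hB : (cubeRoot n : ℝ) ≤ 3 * (n : ℝ) ^ ((1 : ℝ) / 3) := by
    rw [cubeRoot]
    push_cast
    linarith [Nat.ceil_lt_add_one (a := (n : ℝ) ^ ((1 : ℝ) / 3)) (by positivity)]
  have hΛ : ((Nat.log 2 n + 3 : ℕ) : ℝ) ≤ 6 * Real.log n := by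
    have h1 : (Nat.log 2 n : ℝ) ≤ Real.logb 2 n := by
      exact_mod_cast Real.natLog_le_logb n 2
    have h2 : Real.logb 2 n ≤ 2 * Real.log n := by
      rw [Real.logb, div_le_iff₀ (Real.log_pos (by norm_num))]
      nlinarith [Real.log_two_gt_d9]
    push_cast
    linarith
  have h53 : ((n : ℝ) ^ ((1 : ℝ) / 3)) ^ 5 = (n : ℝ) ^ ((5 : ℝ) / 3) := by
    rw [← Real.rpow_natCast, ← Real.rpow_mul (by positivity)]
    norm_num
  have h5 : (cubeRoot n : ℝ) ^ 5 ≤ 3 ^ 5 * (n : ℝ) ^ ((5 : ℝ) / 3) := by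
    rw [← h53, ← mul_pow]
    exact pow_le_pow_left₀ (by positivity) hB 5
  have hd : ((Nat.log 2 n + 3 : ℕ) : ℝ) ^ d ≤ 6 ^ d * Real.log n ^ d := by
    rw [← mul_pow]
    exact pow_le_pow_left₀ (by positivity) hΛ d
  rw [Real.norm_of_nonneg (by positivity), Real.norm_of_nonneg (by positivity)]
  push_cast at hd ⊢
  calc (C : ℝ) * (cubeRoot n : ℝ) ^ 5 * ((Nat.log 2 n : ℝ) + 3) ^ d
      ≤ C * (3 ^ 5 * (n : ℝ) ^ ((5 : ℝ) / 3)) * (6 ^ d * Real.log n ^ d) := by gcongr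
    _ = _ := by ring

theorem isSoftO_space (C : ℕ) : IsSoftO (fun n => C * (4 * n + 4)) (fun n => (n : ℝ)) := by
  refine ⟨0, IsBigO.of_bound (8 * C) ?_⟩
  filter_upwards [eventually_ge_atTop 1] with n hn
  have hn' : (1 : ℝ) ≤ n := by exact_mod_cast hn
  rw [Real.norm_of_nonneg (by positivity), Real.norm_of_nonneg (by positivity)]
  push_cast
  have : (C : ℝ) * (4 * n + 4) ≤ C * (8 * n) := by gcongr; linarith
  linarith

/-! ### The parameters of the programs -/

/-- The exponents of the parameters, with respect to the cube root of `n`. -/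
def paramExpo (k : ℕ) : ℕ → ℕ
  | 0 => 3
  | 1 => 3 * k
  | 2 => 3
  | 3 => 3
  | 5 => 1
  | 6 => 2
  | _ => 0

/-- The parameters: `n`, the modulus `M = (n + 2) ^ k`, the length of the arrays, a power `2 ^ L` of
two that is at least `n`, its exponent `L`, the width `s` of the bands, their number. -/
structure Params (k n : ℕ) (ρ : ℕ → ℕ) : Prop where
  size : ρ 0 = n
  modulus : ρ 1 = (n + 2) ^ k
  length : ρ 2 = 4 * n + 4
  pow : ρ 3 = 2 ^ ρ 4
  le_pow : n ≤ ρ 3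
  pow_le : ρ 3 ≤ 2 * n + 2
  width_pos : 1 ≤ ρ 5
  width : n ≤ ρ 5 ^ 3
  width_le : ρ 5 = 1 ∨ (ρ 5 - 1) ^ 3 < n
  bands : ρ 6 = n / ρ 5 + 1
  other : ∀ j, 7 ≤ j → ρ j = 0

namespace Params

variable {k n : ℕ} {ρ : ℕ → ℕ}

theorem four_mul_le (hk : 2 ≤ k) : 4 * n + 4 ≤ (n + 2) ^ k := by
  have h : (n + 2) ^ 2 ≤ (n + 2) ^ k := Nat.pow_le_pow_right (by omega) hk
  nlinarith

theorem log_le (h : Params k n ρ) : ρ 4 ≤ Nat.log 2 n + 2 := by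
  have h1 : 2 ^ ρ 4 ≤ 2 * n + 2 := h.pow ▸ h.pow_le
  have h2 : n < 2 ^ (Nat.log 2 n + 1) := Nat.lt_pow_succ_log_self (by norm_num) n
  have h3 : 2 ^ ρ 4 ≤ 2 ^ (Nat.log 2 n + 2) := by
    rw [pow_succ 2 (Nat.log 2 n + 1)]
    omega
  exact (Nat.pow_le_pow_iff_right (by norm_num)).1 h3

theorem width_le_succ (h : Params k n ρ) : ρ 5 ≤ n + 1 := by
  rcases h.width_le with h1 | h1
  · omega
  · have := Nat.le_self_pow (n := 3) (by norm_num) (ρ 5 - 1)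
    omega

theorem le_modulus (h : Params k n ρ) (hk : 2 ≤ k) (j : ℕ) : ρ j ≤ ρ 1 := by
  have h4 := four_mul_le (n := n) hk
  rw [← h.modulus] at h4
  have hw := h.width_le_succ
  have h0 := h.size
  have h2 := h.length
  have h3 := h.pow_le
  have hL : ρ 4 < ρ 3 := h.pow ▸ Nat.lt_two_pow_self
  have h6 := h.bands
  have h6' := Nat.div_le_self n (ρ 5)
  by_cases hj : 7 ≤ j
  · rw [h.other j hj]
    omega
  · interval_cases j <;> omega

/-- All parameters have the orders of magnitude given by `paramExpo`. -/
theorem le_expo (h : Params k n ρ) (j : ℕ) :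
    ρ j ≤ (8 + 3 ^ k) * cubeRoot n ^ paramExpo k j * (Nat.log 2 n + 3) := by
  set B := cubeRoot n with hB
  set Λ := Nat.log 2 n + 3 with hΛ
  have hB1 : 1 ≤ B := Nat.le_add_left _ _
  have hn : n ≤ B ^ 3 := le_cubeRoot_pow n
  have hB3 : 1 ≤ B ^ 3 := Nat.one_le_pow _ _ hB1
  have hw : ρ 5 ≤ B := by
    rcases h.width_le with h1 | h1
    · omega
    · have := lt_of_pow_lt_pow_left₀ 3 (Nat.zero_le B) (h1.trans_le hn)
      omega
  have hm : n / ρ 5 ≤ B ^ 2 := by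
    refine Nat.div_le_of_le_mul ?_
    have := h.width
    have h2 : ρ 5 ^ 2 ≤ B ^ 2 := Nat.pow_le_pow_left hw 2
    nlinarith
  have hB2 : 1 ≤ B ^ 2 := Nat.one_le_pow _ _ hB1
  have eight : ∀ {x y : ℕ}, x ≤ 8 * y → x ≤ (8 + 3 ^ k) * y * Λ := fun {x y} hx =>
    calc x ≤ 8 * y * 1 := by omega
      _ ≤ (8 + 3 ^ k) * y * Λ := by gcongr <;> first | exact Nat.le_add_right _ _ | omega
  have h0 := h.size
  have h2 := h.length
  have h3 := h.pow_le
  have h6 := h.bands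
  by_cases hj : 7 ≤ j
  · rw [h.other j hj]
    exact Nat.zero_le _
  · interval_cases j
    · exact eight (by simp only [paramExpo]; omega)
    · rw [h.modulus]
      calc (n + 2) ^ k ≤ (3 * B ^ 3) ^ k := Nat.pow_le_pow_left (by omega) k
        _ = 3 ^ k * B ^ (3 * k) * 1 := by rw [mul_pow, ← pow_mul, mul_one]
        _ ≤ (8 + 3 ^ k) * B ^ (3 * k) * Λ := by gcongr <;> omega
    · exact eight (by simp only [paramExpo]; omega)
    · exact eight (by simp only [paramExpo]; omega)
    · have := h.log_le
      simp only [paramExpo, pow_zero, mul_one]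
      calc ρ 4 ≤ 1 * Λ := by omega
        _ ≤ (8 + 3 ^ k) * Λ := by gcongr; exact (Nat.le_add_left 1 7).trans (Nat.le_add_right 8 _)
    · exact eight (by simp only [paramExpo, pow_one]; omega)
    · exact eight (by simp only [paramExpo]; omega)

end Params

/-- The invariant rule for iterations. -/
theorem iter_inv {α : Type} {f : ℕ → α → α} {m : ℕ} {a : α} (I : ℕ → α → Prop) (h0 : I 0 a)
    (h : ∀ j < m, ∀ a, I j a → I (j + 1) (f j a)) : I m (iter f m a) := by
  induction m with
  | zero => exact h0
  | succ m ih => exact h m (by omega) _ (ih fun j hj => h j (by omega))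

/-- The parameters that are known at the beginning. -/
def params₀ (k n : ℕ) (j : ℕ) : ℕ :=
  if j = 0 then n else if j = 1 then (n + 2) ^ k else if j = 2 then 4 * n + 4 else 0

/-- All parameters; the last four of them are the values of the variables `0` to `3`. -/
def params (k n : ℕ) (s : St) (j : ℕ) : ℕ :=
  if j < 3 then params₀ k n j else if j < 7 then s.var (j - 3) else 0

/-- Computes a power of two that is at least `n`, and its exponent, by `n` attempts to double. -/
def powProg : Prog :=
  .loop 0 4 (.ite (.op .lt (.var 0) (.par 0))
    (.seq (.assign 0 (.op .mul (.var 0) (.const 2))) (.assign 1 (.op .add (.var 1) (.const 1))))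
    .skip)

/-- Computes the cube root of `n`, rounded up, by `n` attempts to add one. -/
def rootProg : Prog :=
  .loop 0 4 (.ite (.op .lt (.op .mul (.var 2) (.op .mul (.var 2) (.var 2))) (.par 0))
    (.assign 2 (.op .add (.var 2) (.const 1))) .skip)

/-- Computes the parameters. -/
def paramProg : Prog :=
  .seq (.assign 0 (.const 1)) <| .seq (.assign 1 (.const 0)) <| .seq powProg <|
  .seq (.assign 2 (.const 1)) <| .seq rootProg <|
  .assign 3 (.op .add (.op .div (.par 0) (.var 2)) (.const 1))

theorem run_powProg {k n : ℕ} (hk : 2 ≤ k) (s : St) (h0 : s.var 0 = 1) (h1 : s.var 1 = 0) :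
    let s' := powProg.run (params₀ k n) s
    s'.arr = s.arr ∧ s'.var 0 = 2 ^ s'.var 1 ∧ s'.var 0 ≤ 2 * n + 2 ∧ n ≤ s'.var 0 := by
  have hM := Params.four_mul_le (n := n) hk
  have e0 : params₀ k n 0 = n := rfl
  have e1 : params₀ k n 1 = (n + 2) ^ k := rfl
  suffices h : (powProg.run (params₀ k n) s).arr = s.arr ∧ (powProg.run (params₀ k n) s).var 0 =
      2 ^ (powProg.run (params₀ k n) s).var 1 ∧ (powProg.run (params₀ k n) s).var 0 ≤ 2 * n + 2 ∧
      (n ≤ (powProg.run (params₀ k n) s).var 0 ∨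
        params₀ k n 0 + 1 ≤ (powProg.run (params₀ k n) s).var 0) by
    refine ⟨h.1, h.2.1, h.2.2.1, ?_⟩
    have := h.2.2.2
    omega
  refine iter_inv (fun j (s' : St) => s'.arr = s.arr ∧ s'.var 0 = 2 ^ s'.var 1 ∧
    s'.var 0 ≤ 2 * n + 2 ∧ (n ≤ s'.var 0 ∨ j + 1 ≤ s'.var 0)) ?_ ?_
  · simp [h0, h1]
  · rintro j hj s' ⟨h1, h2, h3, h4⟩
    have hlt : s'.var 1 < 2 ^ s'.var 1 := Nat.lt_two_pow_self
    by_cases h : s'.var 0 < n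
    · have h5 : s'.var 0 * 2 % (n + 2) ^ k = s'.var 0 * 2 := Nat.mod_eq_of_lt (by omega)
      have h6 : (s'.var 1 + 1) % (n + 2) ^ k = s'.var 1 + 1 := Nat.mod_eq_of_lt (by omega)
      have h7 : 2 ^ (s'.var 1 + 1) = s'.var 0 * 2 := by rw [pow_succ, h2]
      simp [Prog.run, Tm.ev, BinOp.eval, e0, e1, h, h5, h6, h1, h7]
      omega
    · simp [Prog.run, Tm.ev, BinOp.eval, e0, h, h1, ← h2]
      omega

theorem run_rootProg {k n : ℕ} (hk : 2 ≤ k) (s : St) (h0 : s.var 2 = 1) :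
    let s' := rootProg.run (params₀ k n) s
    s'.arr = s.arr ∧ s'.var 0 = s.var 0 ∧ s'.var 1 = s.var 1 ∧ 1 ≤ s'.var 2 ∧
      (s'.var 2 = 1 ∨ (s'.var 2 - 1) ^ 3 < n) ∧ s'.var 2 ≤ params₀ k n 0 + 1 ∧
      (n ≤ s'.var 2 ^ 3 ∨ s'.var 2 = params₀ k n 0 + 1) := by
  have hM := Params.four_mul_le (n := n) hk
  have e0 : params₀ k n 0 = n := rfl
  have e1 : params₀ k n 1 = (n + 2) ^ k := rfl
  refine iter_inv (fun j (s' : St) => s'.arr = s.arr ∧ s'.var 0 = s.var 0 ∧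
      s'.var 1 = s.var 1 ∧ 1 ≤ s'.var 2 ∧ (s'.var 2 = 1 ∨ (s'.var 2 - 1) ^ 3 < n) ∧
      s'.var 2 ≤ j + 1 ∧ (n ≤ s'.var 2 ^ 3 ∨ s'.var 2 = j + 1)) ?_ ?_
  · simp [h0]
  · rintro j hj s' ⟨h1, h2, h3, h4, h5, h6, h7⟩
    have hc : s'.var 2 * (s'.var 2 * s'.var 2) = s'.var 2 ^ 3 := by ring
    by_cases h : s'.var 2 ^ 3 < n
    · have h8 : (s'.var 2 + 1) % (n + 2) ^ k = s'.var 2 + 1 := Nat.mod_eq_of_lt (by omega)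
      simp [Prog.run, Tm.ev, BinOp.eval, e0, e1, hc, h, h8, h1, h2, h3]
      omega
    · simp [Prog.run, Tm.ev, BinOp.eval, e0, hc, h, h1, h2, h3, h4, h5]
      omega

theorem run_paramProg {k n : ℕ} (hk : 2 ≤ k) (s : St) :
    (paramProg.run (params₀ k n) s).arr = s.arr ∧
      Params k n (params k n (paramProg.run (params₀ k n) s)) := by
  have hM := Params.four_mul_le (n := n) hk
  have e0 : params₀ k n 0 = n := rfl
  have e1 : params₀ k n 1 = (n + 2) ^ k := rfl
  have h1M : 1 % (n + 2) ^ k = 1 := Nat.mod_eq_of_lt (by omega)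
  simp only [paramProg, Prog.run, e1]
  set s₂ := (s.setV 0 _).setV 1 _ with hs₂
  obtain ⟨a1, a2, a3, a4⟩ := run_powProg (n := n) hk s₂ (by simp [hs₂, Tm.ev, h1M])
    (by simp [hs₂, Tm.ev])
  set s₃ := powProg.run (params₀ k n) s₂
  set s₄ := s₃.setV 2 _ with hs₄
  obtain ⟨b1, b2, b3, b4, b5, b6, b7⟩ := run_rootProg (n := n) hk s₄ (by simp [hs₄, Tm.ev, h1M])
  set s₅ := rootProg.run (params₀ k n) s₄
  have c0 : s₄.var 0 = s₃.var 0 := by simp [hs₄]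
  have c1 : s₄.var 1 = s₃.var 1 := by simp [hs₄]
  have h6 : (n / s₅.var 2 + 1) % (n + 2) ^ k = n / s₅.var 2 + 1 := by
    have := Nat.div_le_self n (s₅.var 2)
    exact Nat.mod_eq_of_lt (by omega)
  refine ⟨by simp [b1, hs₄, a1, hs₂], ?_⟩
  have e : ∀ j, params k n (s₅.setV 3 ((Tm.op BinOp.add (Tm.op BinOp.div (Tm.par 0) (Tm.var 2))
    (Tm.const 1)).ev (params₀ k n) s₅ % (n + 2) ^ k)) j = if j < 3 then params₀ k n j else
      if j < 6 then s₅.var (j - 3) else if j = 6 then n / s₅.var 2 + 1 else 0 := by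
    intro j
    simp only [params, Tm.ev, BinOp.eval, e0, h6, St.setV_var]
    split_ifs <;> first | rfl | omega
  constructor <;> simp only [e] <;> norm_num [params₀]
  · rw [b2, b3, c0, c1, a2]
  · omega
  · omega
  · exact b4
  · rcases b7 with h | h
    · exact h
    · rw [h, e0]
      exact (Nat.le_succ n).trans (Nat.le_self_pow (by norm_num) _)
  · exact b5
  · intro j hj
    split_ifs <;> omega

/-! ### From array programs to feasibility -/

/-- The expression `(n + 2) ^ k`, where `n` is in register `0`. -/
def powExpr : ℕ → Expr
  | 0 => .const 1
  | k + 1 => .op .mul (powExpr k) (.op .add (.reg 0) (.const 2))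

theorem eval_powExpr {w S n k : ℕ} {m : State} (hm : m.reg 0 = n) (hw : (n + 2) ^ k < 2 ^ w)
    (h2 : n + 2 < 2 ^ w) : (powExpr k).eval w S m = some ((n + 2) ^ k) := by
  induction k with
  | zero => exact fit_of_lt hw
  | succ k ih =>
    have h1 : (n + 2) ^ k ≤ (n + 2) ^ (k + 1) := Nat.pow_le_pow_right (by omega) (by omega)
    have hn : (Expr.reg 0).eval w S m = some n := by
      rw [Expr.eval, hm]
      exact fit_of_lt (by omega)
    have hc : (Expr.const 2).eval w S m = some 2 := fit_of_lt (by omega)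
    exact eval_op .mul (ih (lt_of_le_of_lt h1 hw)) (eval_op .add hn hc h2) hw

/-- Initializes the parameters that are known at the beginning. -/
def startCmd (k : ℕ) : Cmd :=
  .seq (.assign 1 (.reg 0)) <| .seq (.assign 4 (powExpr k)) <|
  .assign 7 (.op .add (.op .mul (.const 4) (.reg 0)) (.const 4))

/-- Copies the variables `0` to `3` to the parameters `3` to `6`. -/
def copyCmd : Cmd :=
  .seq (.assign 10 (.reg 2)) <| .seq (.assign 13 (.reg 5)) <|
  .seq (.assign 16 (.reg 8)) <| .assign 19 (.reg 11)

theorem exec_startCmd {w S k n : ℕ} (hk : 2 ≤ k) (m : State) (hm : m.reg 0 = n)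
    (h0 : ∀ r, r ≠ 0 → m.reg r = 0) (hw : (n + 2) ^ k < 2 ^ w) :
    ∃ (t : ℕ) (m' : State), Exec w S (startCmd k) m t m' ∧ t ≤ (powExpr k).cost + 9 ∧
      m'.mem = m.mem ∧ (∀ j, m'.reg (3 * j + 1) = params₀ k n j) ∧
      ∀ r, m'.reg (3 * r + 2) = 0 := by
  have hN := Params.four_mul_le (n := n) hk
  have ev0 : ∀ m' : State, m'.reg 0 = n → (Expr.reg 0).eval w S m' = some n := fun m' h => by
    rw [Expr.eval, h]
    exact fit_of_lt (by omega)
  have hc : ∀ m', (Expr.const 4).eval w S m' = some 4 := fun m' => fit_of_lt (by omega)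
  refine ⟨_, _, .seq _ _ _ _ _ _ _ (.assign _ _ _ _ (ev0 _ hm)) <|
    .seq _ _ _ _ _ _ _ (.assign _ _ _ _ (eval_powExpr (n := n) ?_ hw ?_)) <|
    .assign _ _ _ _ (eval_op .add (eval_op .mul (hc _) (ev0 _ ?_) ?_) (hc _) ?_), ?_, ?_, ?_, ?_⟩
  · simpa using hm
  · omega
  · simpa using hm
  · simp only [BinOp.eval]
    omega
  · simp only [BinOp.eval]
    omega
  · simp only [Expr.cost]
    omega
  · rfl
  · intro j
    simp only [Function.update_apply, params₀, BinOp.eval]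
    split_ifs <;> first | rfl | omega | exact h0 _ (by omega)
  · intro r
    simp only [Function.update_apply]
    split_ifs <;> first | omega | exact h0 _ (by omega)

theorem exec_copyCmd {w S k n K : ℕ} (hM : (n + 2) ^ k ≤ 2 ^ w) {s : St} {m : State}
    (R : Rel (params₀ k n) K s m) :
    ∃ (m' : State), Exec w S copyCmd m 8 m' ∧ Rel (params k n s) K s m' := by
  have ev : ∀ (m' : State) (r : ℕ), m'.reg (3 * r + 2) = s.var r →
      (Expr.reg (3 * r + 2)).eval w S m' = some (s.var r) := fun m' r h => by
    rw [Expr.eval, h]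
    exact fit_of_lt ((R.var_lt r).trans_le hM)
  refine ⟨_, .seq _ _ _ _ _ _ _ (.assign _ _ _ _ (ev _ 0 ?_)) <|
    .seq _ _ _ _ _ _ _ (.assign _ _ _ _ (ev _ 1 ?_)) <|
    .seq _ _ _ _ _ _ _ (.assign _ _ _ _ (ev _ 2 ?_)) (.assign _ _ _ _ (ev _ 3 ?_)), ?_⟩
  · exact R.var 0
  · simpa using R.var 1
  · simpa using R.var 2
  · simpa using R.var 3
  · constructor
    · intro j
      by_cases hj : j < 7
      · have h := R.par j
        interval_cases j <;> simp [params, params₀] at h ⊢ <;> exact h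
      · have h := R.par j
        simp only [Function.update_apply]
        rw [if_neg (by omega), if_neg (by omega), if_neg (by omega), if_neg (by omega), h]
        simp only [params, params₀]
        split_ifs <;> first | rfl | omega
    · intro r
      simp only [Function.update_apply]
      rw [if_neg (by omega), if_neg (by omega), if_neg (by omega), if_neg (by omega)]
      exact R.var r
    · exact R.arr
    · exact R.var_lt
    · exact R.arr_lt

/-- An array program with parameters as in `Params`, whose running time is `O(n ^ (5/3))` up to
logarithmic factors, and which computes `F n σ` if the array `0` contains `σ`, shows that `F` is
feasible. -/
theorem feasibleIn_of_prog {F : (n : ℕ) → Equiv.Perm (Fin n) → ℕ} {k : ℕ} (hk : 2 ≤ k) (p : Prog)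
    (hexp : p.expo (paramExpo k) ≤ 5) (out : ℕ)
    (h : ∀ (n : ℕ) (σ : Equiv.Perm (Fin n)) (ρ : ℕ → ℕ) (s : St), Params k n ρ →
      (∀ i (hi : i < n), s.arr 0 i = σ ⟨i, hi⟩) → (∀ d i, s.arr d i < ρ 1) →
      (p.run ρ s).var out = F n σ) :
    FeasibleIn F (fun n => (n : ℝ) ^ ((5 : ℝ) / 3)) (fun n => (n : ℝ)) := by
  obtain ⟨K₁, hK₁⟩ := p.exists_slots
  set K := K₁ + 1 with hK
  have hpK : p.Slots K := hK₁.mono (by omega)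
  have hqK : paramProg.Slots K := by simp [paramProg, powProg, rootProg, Prog.Slots, Tm.Slots]
  set b := max 2 (max paramProg.size p.size) with hb
  obtain ⟨C₁, d₁, T₁⟩ := Prog.time_le (paramExpo k) (8 + 3 ^ k) p
  obtain ⟨C₂, d₂, T₂⟩ := Prog.time_le (paramExpo k) (8 + 3 ^ k) paramProg
  have hqexp : paramProg.expo (paramExpo k) ≤ 5 := by
    simp [paramProg, powProg, rootProg, Prog.expo, paramExpo]
  refine ⟨.seq (startCmd k) (.seq (paramProg.compile 0) (.seq copyCmd (.seq (p.compile 0)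
    (.assign 0 (.reg (3 * out + 2)))))), 2 * k * b,
    fun n => ((powExpr k).cost + 19 + C₁ + C₂) * cubeRoot n ^ 5 * (Nat.log 2 n + 3) ^ (d₁ + d₂),
    fun n => K * (4 * n + 4), isSoftO_time _ _, isSoftO_space _, ?_, ?_⟩
  · intro n
    simp only [hK, add_mul]
    omega
  intro n σ
  set w := 2 * k * b * (Nat.log 2 n + 1) with hw
  have hM2 : 2 ≤ (n + 2) ^ k := by
    have := Params.four_mul_le (n := n) hk
    omega
  have hword : ((n + 2) ^ k) ^ b ≤ 2 ^ w := by
    set X := 2 ^ (Nat.log 2 n + 1) with hX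
    have h1 : n < X := Nat.lt_pow_succ_log_self (by norm_num) n
    have h2 : 2 ≤ X := Nat.le_self_pow (by omega) 2
    have h3 : n + 2 ≤ X ^ 2 := by nlinarith
    calc ((n + 2) ^ k) ^ b ≤ ((X ^ 2) ^ k) ^ b :=
          Nat.pow_le_pow_left (Nat.pow_le_pow_left h3 k) b
      _ = 2 ^ w := by
          rw [hX, hw, ← pow_mul, ← pow_mul, ← pow_mul]
          congr 1
          ring
  have hb2 : 2 ≤ b := le_max_left _ _
  have hMw : (n + 2) ^ k < 2 ^ w := by
    refine lt_of_lt_of_le ?_ hword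
    calc (n + 2) ^ k = ((n + 2) ^ k) ^ 1 := (pow_one _).symm
      _ < ((n + 2) ^ k) ^ b := Nat.pow_lt_pow_right (by omega) (by omega)
  obtain ⟨t₁, m₁, x₁, l₁, f₁, f₂, f₃⟩ := exec_startCmd (S := K * (4 * n + 4)) hk (init σ) rfl
    (fun r hr => if_neg hr) hMw
  set s₀ : St := ⟨fun _ => 0, fun d i => if i < 4 * n + 4 then
    (init σ).mem (d * (4 * n + 4) + i) else 0⟩ with hs₀
  have hmem : ∀ i, (init σ).mem i < (n + 2) ^ k := by
    intro i
    have := Params.four_mul_le (n := n) hk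
    simp only [init]
    split
    · exact (Fin.is_lt _).trans (by omega)
    · omega
  have R₁ : Rel (params₀ k n) K s₀ m₁ := by
    refine ⟨f₂, f₃, fun d _ i hi => ?_, fun _ => ?_, fun d i => ?_⟩
    · have hi' : i < 4 * n + 4 := hi
      have : params₀ k n 2 = 4 * n + 4 := rfl
      simp only [hs₀, if_pos hi', f₁, this]
    · exact lt_of_lt_of_le (by norm_num) hM2
    · simp only [hs₀]
      split
      · exact hmem _
      · exact lt_of_lt_of_le (by norm_num) hM2
  obtain ⟨harr, hρ⟩ := run_paramProg (k := k) (n := n) hk s₀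
  set ρ := params k n (paramProg.run (params₀ k n) s₀) with hρdef
  have H₁ : Suitable (params₀ k n) w (K * (4 * n + 4)) K b := by
    refine ⟨hM2, Nat.succ_pos _, fun j => ?_, le_rfl, hword⟩
    have h4 := Params.four_mul_le (n := n) hk
    have e1 : params₀ k n 1 = (n + 2) ^ k := rfl
    rw [e1, params₀]
    split_ifs <;> omega
  have H₂ : Suitable ρ w (K * (4 * n + 4)) K b :=
    ⟨hM2, Nat.succ_pos _, hρ.le_modulus hk, le_rfl, hword⟩
  obtain ⟨t₂, m₂, x₂, l₂, R₂, -⟩ := exec_compile H₁ paramProg 0 s₀ m₁ hqK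
    ((le_max_left _ _).trans (le_max_right _ _)) R₁
  obtain ⟨m₃, x₃, R₃⟩ := exec_copyCmd (S := K * (4 * n + 4)) hMw.le R₂
  obtain ⟨t₄, m₄, x₄, l₄, R₄, -⟩ := exec_compile H₂ p 0 _ m₃ hpK
    ((le_max_right _ _).trans (le_max_right _ _)) R₃
  have hout := h n σ ρ (paramProg.run (params₀ k n) s₀) hρ (fun i hi => by
    rw [harr]
    have : i < 4 * n + 4 := by omega
    simp [hs₀, init, hi, this]) (fun d i => R₂.arr_lt d i)
  have hev : (Expr.reg (3 * out + 2)).eval w (K * (4 * n + 4)) m₄ = some (F n σ) := by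
    rw [Expr.eval, R₄.var, ← hout]
    exact fit_of_lt ((R₄.var_lt out).trans hMw)
  refine ⟨_, _, ?_, .seq _ _ _ _ _ _ _ x₁ (.seq _ _ _ _ _ _ _ x₂ (.seq _ _ _ _ _ _ _ x₃
    (.seq _ _ _ _ _ _ _ x₄ (.assign _ _ _ _ hev)))), by simp⟩
  set B := cubeRoot n
  set Λ := Nat.log 2 n + 3
  have hB : 1 ≤ B := Nat.le_add_left _ _
  have hΛ : 1 ≤ Λ := Nat.le_add_left _ _
  have bound : ∀ {C d e : ℕ}, e ≤ 5 → d ≤ d₁ + d₂ →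
      C * B ^ e * Λ ^ d ≤ C * (B ^ 5 * Λ ^ (d₁ + d₂)) := fun {C d e} he hd => by
    rw [mul_assoc]
    gcongr
  have u₁ := (T₁ ρ B Λ hB hΛ hρ.le_expo).trans (bound hexp (Nat.le_add_right _ _))
  have hle₀ : ∀ j, params₀ k n j ≤ ρ j := by
    intro j
    rw [hρdef, params]
    by_cases hj : j < 3
    · rw [if_pos hj]
    · have : params₀ k n j = 0 := by
        rw [params₀, if_neg (by omega), if_neg (by omega), if_neg (by omega)]
      omega
  have u₂ := (T₂ (params₀ k n) B Λ hB hΛ fun j => (hle₀ j).trans (hρ.le_expo j)).trans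
    (bound hqexp (Nat.le_add_left _ _))
  have hY : (powExpr k).cost + 19 ≤
      ((powExpr k).cost + 19) * (B ^ 5 * Λ ^ (d₁ + d₂)) :=
    Nat.le_mul_of_pos_right _ (by positivity)
  change _ ≤ ((powExpr k).cost + 19 + C₁ + C₂) * B ^ 5 * Λ ^ (d₁ + d₂)
  simp only [Expr.cost]
  rw [mul_assoc, add_mul _ C₂, add_mul _ C₁]
  omega

/-! ### Reasoning about loops -/

/-- The variable `v` is not written. -/
def Prog.KeepsV (v : ℕ) : Prog → Prop
  | .skip => True
  | .assign r _ => v ≠ r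
  | .store _ _ _ => True
  | .seq p q => p.KeepsV v ∧ q.KeepsV v
  | .ite _ p q => p.KeepsV v ∧ q.KeepsV v
  | .loop _ r p => v ≠ r ∧ p.KeepsV v

/-- The array `d` is not written. -/
def Prog.KeepsA (d : ℕ) : Prog → Prop
  | .skip => True
  | .assign _ _ => True
  | .store d' _ _ => d ≠ d'
  | .seq p q => p.KeepsA d ∧ q.KeepsA d
  | .ite _ p q => p.KeepsA d ∧ q.KeepsA d
  | .loop _ _ p => p.KeepsA d

section Loops

variable {ρ : ℕ → ℕ}

theorem Prog.run_var {v : ℕ} : ∀ {p : Prog} {s : St}, p.KeepsV v → (p.run ρ s).var v = s.var v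
  | .skip, _, _ => rfl
  | .assign r e, s, h => by
    have h' : v ≠ r := h
    simp [Prog.run, h']
  | .store d i e, s, _ => rfl
  | .seq p q, s, h => (run_var h.2).trans (run_var h.1)
  | .ite b p q, s, h => by
    simp only [Prog.run]
    split
    · exact run_var h.1
    · exact run_var h.2
  | .loop k r p, s, h => by
    refine iter_inv (fun _ (s' : St) => s'.var v = s.var v) rfl fun j _ s' hs' => ?_
    have h' : v ≠ r := h.1
    rw [run_var h.2]
    simpa [h'] using hs'

theorem Prog.run_arr {d : ℕ} : ∀ {p : Prog} {s : St}, p.KeepsA d → (p.run ρ s).arr d = s.arr d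
  | .skip, _, _ => rfl
  | .assign r e, s, _ => rfl
  | .store d' i e, s, h => by
    have h' : d ≠ d' := h
    simp [Prog.run, St.setA_arr, h']
  | .seq p q, s, h => (run_arr h.2).trans (run_arr h.1)
  | .ite b p q, s, h => by
    simp only [Prog.run]
    split
    · exact run_arr h.1
    · exact run_arr h.2
  | .loop k r p, s, h => by
    refine iter_inv (fun _ (s' : St) => s'.arr d = s.arr d) rfl fun j _ s' hs' => ?_
    exact (run_arr (p := p) h).trans hs'

/-- The invariant rule for loops; what the loop does not write may be assumed to be unchanged. -/
theorem run_loop {k r : ℕ} {p : Prog} {s : St} (I : ℕ → St → Prop) (h0 : I 0 s)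
    (h : ∀ j < ρ k, ∀ s' : St, (∀ v, v ≠ r → p.KeepsV v → s'.var v = s.var v) →
      (∀ d, p.KeepsA d → s'.arr d = s.arr d) → I j s' → I (j + 1) (p.run ρ (s'.setV r j))) :
    I (ρ k) ((Prog.loop k r p).run ρ s) := by
  refine (iter_inv (fun j s' => ((∀ v, v ≠ r → p.KeepsV v → s'.var v = s.var v) ∧
    (∀ d, p.KeepsA d → s'.arr d = s.arr d)) ∧ I j s')
    ⟨⟨fun _ _ _ => rfl, fun _ _ => rfl⟩, h0⟩ ?_).2
  rintro j hj s' ⟨⟨h1, h2⟩, h3⟩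
  refine ⟨⟨fun v hv hp => ?_, fun d hd => ?_⟩, h j hj s' h1 h2 h3⟩
  · rw [Prog.run_var hp, St.setV_var, if_neg hv, h1 v hv hp]
  · rw [Prog.run_arr hd, St.setV_arr, h2 d hd]

theorem cast_mod {R : Type} [CommRing R] (hR : ((ρ 1 : ℕ) : R) = 0) (x : ℕ) :
    ((x % ρ 1 : ℕ) : R) = x := by
  conv_rhs => rw [← Nat.mod_add_div x (ρ 1)]
  push_cast
  rw [hR, zero_mul, add_zero]

/-- A loop that only accumulates a sum in the variable `a`. -/
theorem run_loop_sum {R : Type} [CommRing R] {k r a : ℕ} {p : Prog} {s : St} (F : ℕ → R)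
    (ha : a ≠ r) (h : ∀ j < ρ k, ∀ s' : St, s'.var r = j →
      (∀ v, v ≠ r → p.KeepsV v → s'.var v = s.var v) →
      (∀ d, p.KeepsA d → s'.arr d = s.arr d) →
      (((p.run ρ s').var a : ℕ) : R) = (s'.var a : R) + F j) :
    ((((Prog.loop k r p).run ρ s).var a : ℕ) : R) =
      (s.var a : R) + ∑ j ∈ Finset.range (ρ k), F j := by
  refine run_loop (fun j s' => ((s'.var a : ℕ) : R) = (s.var a : R) + ∑ j ∈ Finset.range j, F j)
    (by simp) fun j hj s' h1 h2 h3 => ?_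
  rw [h j hj (s'.setV r j) (by simp) (fun v hv hp => by simp [hv, h1 v hv hp])
    (fun d hd => by simp [h2 d hd]), Finset.sum_range_succ, ← add_assoc, ← h3]
  simp [ha]

end Loops

/-! ### Trees for prefix sums -/

section Trees

variable {R : Type} [CommRing R]

/-- The array `a` is a binary tree for the prefix sums `G`: the leaves below the node `x` have the
numbers `i` with `(2 ^ L + i) / 2 ^ (L - log x) = x`, and the entry `a x` is the sum of their values
`f i`, for every node `x` other than the root `1`. -/
def PrefixTree (L : ℕ) (a : ℕ → ℕ) (G : ℕ → R) : Prop :=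
  ∃ f : ℕ → R,
    (∀ x, 1 ≤ Nat.log 2 x → Nat.log 2 x ≤ L → (a x : R) =
      ∑ i ∈ Finset.range (2 ^ L), if (2 ^ L + i) / 2 ^ (L - Nat.log 2 x) = x then f i else 0) ∧
    ∀ j, G j = ∑ i ∈ Finset.range (2 ^ L), if i < j then f i else 0

theorem PrefixTree.zero {L : ℕ} {a : ℕ → ℕ} (h : ∀ x < 2 * 2 ^ L, a x = 0) :
    PrefixTree L a (fun _ => (0 : R)) := by
  refine ⟨fun _ => 0, fun x _ hx => ?_, fun j => by simp⟩
  have : x < 2 * 2 ^ L := by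
    rw [← pow_succ']
    exact (Nat.lt_pow_succ_log_self (by norm_num) x).trans_le
      (Nat.pow_le_pow_right (by norm_num) (by omega))
  simp [h x this]

theorem PrefixTree.congr {L : ℕ} {a : ℕ → ℕ} {G G' : ℕ → R} (h : PrefixTree L a G)
    (hG : ∀ j, G' j = G j) : PrefixTree L a G' := by
  rwa [show G' = G from funext hG]

/-- Set the array `d` to zero. -/
def clearProg (d : ℕ) : Prog := .loop 2 21 (.store d (.var 21) (.const 0))

/-- Add the variable `v` to the leaf whose number is in the variable `a`. -/
def insertProg (d a v : ℕ) : Prog :=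
  .seq (.assign 20 (.op .add (.par 3) (.var a))) <|
  .loop 4 21 <|
    .seq (.store d (.var 20) (.op .add (.get d (.var 20)) (.var v))) <|
    .assign 20 (.op .div (.var 20) (.const 2))

/-- Put the sum of the leaves before the one whose number is in the variable `a` into the
variable `r`. -/
def queryProg (d a r : ℕ) : Prog :=
  .seq (.assign 20 (.op .add (.par 3) (.var a))) <|
  .seq (.assign r (.const 0)) <|
  .loop 4 21 <|
    .seq (.ite (.op .sub (.var 20) (.op .mul (.op .div (.var 20) (.const 2)) (.const 2)))
      (.assign r (.op .add (.var r) (.get d (.op .sub (.var 20) (.const 1))))) .skip) <|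
    .assign 20 (.op .div (.var 20) (.const 2))

variable {k n : ℕ} {ρ : ℕ → ℕ}

theorem Params.two_mul_pow_le (hP : Params k n ρ) : 2 * 2 ^ ρ 4 ≤ ρ 2 := by
  have h1 := hP.pow
  have h2 := hP.pow_le
  have h3 := hP.length
  omega

theorem Params.length_le (hk : 2 ≤ k) (hP : Params k n ρ) : ρ 2 ≤ ρ 1 := hP.le_modulus hk 2

theorem run_clearProg (hP : Params k n ρ) (d : ℕ) (s : St) :
    PrefixTree (ρ 4) (((clearProg d).run ρ s).arr d) (fun _ => (0 : R)) := by
  refine PrefixTree.zero fun x hx => ?_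
  have hx' := hx.trans_le hP.two_mul_pow_le
  refine run_loop (ρ := ρ) (fun j s' => ∀ x < j, s'.arr d x = 0) (by simp)
    (fun j hj s' _ _ h x hx => ?_) x hx'
  simp only [Prog.run, Tm.ev, St.setV_var, if_true, St.setA_arr_apply, true_and,
    Nat.mod_eq_of_lt hj, Nat.zero_mod, St.setV_arr]
  split
  · rfl
  · exact h x (by omega)

/-- The insertion adds the variable `v` to the nodes on the way from a leaf to the root. -/
theorem run_insertProg (hk : 2 ≤ k) (hP : Params k n ρ) (hR : ((ρ 1 : ℕ) : R) = 0) {d a v : ℕ}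
    (hv : v ≠ 20) (hv' : v ≠ 21) {s : St} (ha : s.var a < ρ 3) {G : ℕ → R}
    (hG : PrefixTree (ρ 4) (s.arr d) G) :
    PrefixTree (ρ 4) (((insertProg d a v).run ρ s).arr d)
      (fun j => G j + if s.var a < j then (s.var v : R) else 0) := by
  have hNM := hP.length_le hk
  have h2P := hP.two_mul_pow_le
  rw [hP.pow] at ha
  set L := ρ 4 with hL
  set i₀ := s.var a with hi₀
  have hmod : (2 ^ L + i₀) % ρ 1 = 2 ^ L + i₀ := Nat.mod_eq_of_lt (by omega)
  have hlog : Nat.log 2 (2 ^ L + i₀) = L :=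
    Nat.log_eq_of_pow_le_of_lt_pow (by omega) (by rw [pow_succ]; omega)
  -- After `j` rounds, the ancestors of the leaf in the lowest `j` levels have been increased.
  have main : ∀ s', (insertProg d a v).run ρ s = s' → ∀ x, (s'.arr d x : R) = (s.arr d x : R) +
      if L - Nat.log 2 x < L ∧ x = (2 ^ L + i₀) / 2 ^ (L - Nat.log 2 x) then (s.var v : R)
        else 0 := by
    rintro s' rfl
    refine (run_loop (ρ := ρ) (k := 4) (fun j s' => s'.var 20 = (2 ^ L + i₀) / 2 ^ j ∧
      ∀ x, (s'.arr d x : R) = (s.arr d x : R) +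
        if L - Nat.log 2 x < j ∧ x = (2 ^ L + i₀) / 2 ^ (L - Nat.log 2 x) then (s.var v : R)
          else 0) ?_ ?_).2
    · simp [Prog.run, Tm.ev, BinOp.eval, hP.pow, ← hi₀, hmod, ← hL]
    · rintro j hj s' h1 - ⟨h2, h3⟩
      have hle : (2 ^ L + i₀) / 2 ^ j ≤ 2 ^ L + i₀ := Nat.div_le_self _ _
      have h4 : (2 ^ L + i₀) / 2 ^ j % ρ 2 = (2 ^ L + i₀) / 2 ^ j := Nat.mod_eq_of_lt (by omega)
      have h5 : (2 ^ L + i₀) / 2 ^ j / 2 % ρ 1 = (2 ^ L + i₀) / 2 ^ (j + 1) := by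
        rw [Nat.mod_eq_of_lt (by omega), Nat.div_div_eq_div_mul, pow_succ]
      have h6 : s'.var v = s.var v := by
        rw [h1 v hv' (by simp [Prog.KeepsV, hv])]
        simp [Prog.run, hv]
      have hX : Nat.log 2 ((2 ^ L + i₀) / 2 ^ j) = L - j := by rw [Nat.log_div_base_pow, hlog]
      refine ⟨by simp [Prog.run, Tm.ev, BinOp.eval, h2, h5], fun x => ?_⟩
      simp only [Prog.run, Tm.ev, BinOp.eval, St.setV_var, St.setV_arr, St.setA_arr_apply, h2,
        true_and]
      simp only [show (20 : ℕ) ≠ 21 by norm_num, if_false, h4, hv', h6]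
      by_cases hx : x = (2 ^ L + i₀) / 2 ^ j
      · have hx' : L - Nat.log 2 x = j := by
          rw [hx, hX]
          omega
        have h7 := h3 x
        rw [hx', if_neg (by omega), add_zero] at h7
        rw [if_pos hx, cast_mod hR, hx', if_pos ⟨by omega, hx⟩, ← hx]
        push_cast
        rw [h7]
      · rw [if_neg hx, h3 x]
        congr 1
        refine if_congr ⟨fun h => ⟨by omega, h.2⟩, fun h => ⟨?_, h.2⟩⟩ rfl rfl
        rcases Nat.lt_succ_iff_lt_or_eq.1 h.1 with h' | h'
        · exact h'
        · exact absurd (h' ▸ h.2) hx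
  obtain ⟨f, hf, hG⟩ := hG
  refine ⟨fun i => f i + if i = i₀ then (s.var v : R) else 0, fun x h1 h2 => ?_, fun j => ?_⟩
  · rw [main _ rfl x, hf x h1 h2]
    simp only [ite_add_zero, Finset.sum_add_distrib]
    congr 1
    rw [Finset.sum_eq_single i₀]
    · have h3 : L - Nat.log 2 x < L := by omega
      simp only [h3, true_and, if_true]
      exact if_congr eq_comm rfl rfl
    · intro i _ hi
      simp [hi]
    · intro h
      simp only [Finset.mem_range] at h
      omega
  · simp only [hG j]
    simp only [ite_add_zero, Finset.sum_add_distrib]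
    congr 1
    rw [Finset.sum_eq_single i₀]
    · simp
    · intro i _ hi
      simp [hi]
    · intro h
      simp only [Finset.mem_range] at h
      omega

/-- On the way from the leaf to the root, the query adds up the left siblings of the nodes that are
right children. -/
theorem run_queryProg (hk : 2 ≤ k) (hP : Params k n ρ) (hR : ((ρ 1 : ℕ) : R) = 0) {d a r : ℕ}
    (hr : r ≠ 20) (hr' : r ≠ 21) {s : St} (ha : s.var a < ρ 3) {G : ℕ → R}
    (hG : PrefixTree (ρ 4) (s.arr d) G) :
    ((((queryProg d a r).run ρ s).var r : ℕ) : R) = G (s.var a) := by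
  have hNM := hP.length_le hk
  have h2P := hP.two_mul_pow_le
  rw [hP.pow] at ha
  set L := ρ 4 with hL
  set i₀ := s.var a with hi₀
  have hmod : (2 ^ L + i₀) % ρ 1 = 2 ^ L + i₀ := Nat.mod_eq_of_lt (by omega)
  have hlog : Nat.log 2 (2 ^ L + i₀) = L :=
    Nat.log_eq_of_pow_le_of_lt_pow (by omega) (by rw [pow_succ]; omega)
  obtain ⟨f, hf, hG⟩ := hG
  -- After `j` rounds, the leaves not yet accounted for are those to the left of the subtree of the
  -- current node `X`, which is the ancestor of the leaf in the level `j`.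
  have main : ∀ s', (queryProg d a r).run ρ s = s' → (s'.var r : R) +
      (∑ i ∈ Finset.range (2 ^ L), if (2 ^ L + i) / 2 ^ L < (2 ^ L + i₀) / 2 ^ L then f i else 0) =
      G i₀ := by
    rintro s' rfl
    refine (run_loop (ρ := ρ) (k := 4) (fun j s' => s'.var 20 = (2 ^ L + i₀) / 2 ^ j ∧
      (s'.var r : R) + (∑ i ∈ Finset.range (2 ^ L),
        if (2 ^ L + i) / 2 ^ j < (2 ^ L + i₀) / 2 ^ j then f i else 0) = G i₀) ?_ ?_).2
    · simp [Prog.run, Tm.ev, BinOp.eval, hP.pow, ← hi₀, hmod, ← hL, hr.symm, hG]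
    · rintro j hj s' - h0 ⟨h2, h3⟩
      have harr : s'.arr d = s.arr d := by
        rw [h0 d (by simp [Prog.KeepsA])]
        simp [Prog.run]
      set X := (2 ^ L + i₀) / 2 ^ j with hXdef
      have hle : X ≤ 2 ^ L + i₀ := Nat.div_le_self _ _
      have h4 : (X - 1) % ρ 2 = X - 1 := Nat.mod_eq_of_lt (by omega)
      have h5 : X / 2 % ρ 1 = X / 2 := Nat.mod_eq_of_lt (by omega)
      have h6 : (2 ^ L + i₀) / 2 ^ (j + 1) = X / 2 := by
        rw [hXdef, Nat.div_div_eq_div_mul, pow_succ]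
      have hX : Nat.log 2 X = L - j := by rw [hXdef, Nat.log_div_base_pow, hlog]
      have hpow : 2 ^ (L - j) ≤ X := hX ▸ Nat.pow_log_le_self 2 (by
        rintro h
        rw [h, Nat.log_zero_right] at hX
        omega)
      have hpow' : X < 2 ^ (L - j + 1) := hX ▸ Nat.lt_pow_succ_log_self (by norm_num) X
      have hsplit : ∀ u : ℕ, u < X ↔ (u / 2 < X / 2 ∨ (X - X / 2 * 2 ≠ 0 ∧ u = X - 1)) := by
        intro u
        omega
      have hsum : (∑ i ∈ Finset.range (2 ^ L), if (2 ^ L + i) / 2 ^ j < X then f i else 0) =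
          (∑ i ∈ Finset.range (2 ^ L), if (2 ^ L + i) / 2 ^ (j + 1) < X / 2 then f i else 0) +
          if X - X / 2 * 2 ≠ 0 then (s.arr d (X - 1) : R) else 0 := by
        by_cases hodd : X - X / 2 * 2 ≠ 0
        · have heven : 2 ^ (L - j) = 2 * 2 ^ (L - j - 1) := by
            rw [← pow_succ']
            congr 1
            omega
          have hlogX : Nat.log 2 (X - 1) = L - j :=
            Nat.log_eq_of_pow_le_of_lt_pow (by omega) (by omega)
          have e : L - (L - j) = j := by omega
          rw [if_pos hodd, hf (X - 1) (by omega) (by omega), hlogX, e, ← Finset.sum_add_distrib]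
          refine Finset.sum_congr rfl fun i _ => ?_
          rw [pow_succ, ← Nat.div_div_eq_div_mul]
          set u := (2 ^ L + i) / 2 ^ j
          by_cases h7 : u / 2 < X / 2
          · rw [if_pos h7, if_pos (by omega), if_neg (by omega), add_zero]
          · rw [if_neg h7, zero_add]
            exact if_congr (by omega) rfl rfl
        · rw [if_neg hodd, add_zero]
          refine Finset.sum_congr rfl fun i _ => ?_
          rw [pow_succ, ← Nat.div_div_eq_div_mul]
          exact if_congr (by omega) rfl rfl
      rw [hsum] at h3
      constructor
      · simp only [Prog.run]
        rw [h6]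
        have : ∀ s'' : St, s''.var 20 = X →
            (s''.setV 20 ((Tm.op BinOp.div (Tm.var 20) (Tm.const 2)).ev ρ s'' % ρ 1)).var 20 =
              X / 2 := by
          intro s'' h
          simp [Tm.ev, BinOp.eval, h, h5]
        apply this
        split <;> simp [h2, hr.symm]
      · rw [h6, ← h3]
        simp only [Prog.run, Tm.ev, BinOp.eval, St.setV_var, St.setV_arr]
        simp only [show (20 : ℕ) ≠ 21 by norm_num, if_false, h2, h4, harr, hr, hr']
        by_cases hodd : X - X / 2 * 2 ≠ 0
        · rw [if_pos hodd, if_pos hodd, St.setV_var, if_pos rfl, cast_mod hR]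
          push_cast
          ring
        · rw [if_neg hodd, if_neg hodd, St.setV_var, if_neg hr']
          ring
  have := main _ rfl
  rw [← this, eq_comm]
  refine add_eq_left.2 (Finset.sum_eq_zero fun i _ => if_neg ?_)
  have h1 : (2 ^ L + i₀) / 2 ^ L = 1 := Nat.div_eq_of_lt_le (by omega) (by omega)
  have h2 : 1 ≤ (2 ^ L + i) / 2 ^ L := (Nat.le_div_iff_mul_le (by positivity)).2 (by omega)
  omega

end Trees

/-! ### Weights given by dominance sums -/

/-- Weight functions on the points of a permutation that are built from the constant `1` by products
and by sums over the points to the south-west. -/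
inductive Weight
  | one
  | mul (a b : Weight)
  | sw (a : Weight)

/-- The value of a weight at the point `(x, y x)`. -/
def Weight.eval (n : ℕ) (y : ℕ → ℕ) : Weight → ℕ → ℕ
  | .one, _ => 1
  | .mul a b, x => a.eval n y x * b.eval n y x
  | .sw a, x => ∑ q ∈ Finset.range n, if q < x ∧ y q < y x then a.eval n y q else 0

/-- Tabulates the weight in the array `d`, using the arrays from `d` on and the tree in the
array `3`; the values `y x` are in the array `0`. -/
def Weight.prog : Weight → ℕ → Prog
  | .one, d => .loop 0 5 (.store d (.var 5) (.const 1))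
  | .mul a b, d => .seq (a.prog d) <| .seq (b.prog (d + 1)) <|
      .loop 0 5 (.store d (.var 5) (.op .mul (.get d (.var 5)) (.get (d + 1) (.var 5))))
  | .sw a, d => .seq (a.prog d) <| .seq (clearProg 3) <|
      .loop 0 5 <| .seq (.assign 6 (.get 0 (.var 5))) <| .seq (queryProg 3 6 7) <|
        .seq (.assign 8 (.get d (.var 5))) <| .seq (.store d (.var 5) (.var 7)) <|
        insertProg 3 6 8

theorem Weight.prog_keepsA (W : Weight) :
    ∀ {d d' : ℕ}, d' < d → d' ≠ 3 → (W.prog d).KeepsA d' := by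
  induction W with
  | one =>
    intro d d' h _
    simp only [Weight.prog, Prog.KeepsA]
    omega
  | mul a b iha ihb =>
    intro d d' h h'
    exact ⟨iha h h', ihb (by omega) h', by simp only [Prog.KeepsA]; omega⟩
  | sw a ih =>
    intro d d' h h'
    refine ⟨ih h h', ?_⟩
    simp [clearProg, queryProg, insertProg, Prog.KeepsA, h', h.ne]

theorem Weight.prog_expo (W : Weight) (k : ℕ) : ∀ d, (W.prog d).expo (paramExpo k) ≤ 3 := by
  induction W with
  | one => simp [Weight.prog, Prog.expo, paramExpo]
  | mul a b iha ihb =>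
    intro d
    simp [Weight.prog, Prog.expo, paramExpo, iha, ihb]
  | sw a ih =>
    intro d
    simp [Weight.prog, Prog.expo, paramExpo, ih, clearProg, queryProg, insertProg]

theorem sum_range_and {M : Type} [AddCommMonoid M] {n j : ℕ} (h : j ≤ n) (p : ℕ → Prop)
    [DecidablePred p] (f : ℕ → M) :
    (∑ q ∈ Finset.range n, if q < j ∧ p q then f q else 0) =
      ∑ q ∈ Finset.range j, if p q then f q else 0 := by
  rw [← Finset.sum_filter, ← Finset.sum_filter]
  refine Finset.sum_congr (Finset.ext fun q => ?_) fun _ _ => rfl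
  simp only [Finset.mem_filter, Finset.mem_range]
  constructor
  · exact fun h => h.2
  · exact fun h' => ⟨by omega, h'⟩

section Programs

variable {R : Type} [CommRing R] {k n : ℕ} {ρ : ℕ → ℕ}

theorem Params.lt_length (hP : Params k n ρ) {x : ℕ} (hx : x < n) : x < ρ 2 := by
  have := hP.length
  omega

theorem Params.lt_modulus (hk : 2 ≤ k) (hP : Params k n ρ) {x : ℕ} (hx : x ≤ n) : x < ρ 1 := by
  have := hP.length
  have := hP.length_le hk
  omega

/-- For a dominance sum, the points are inserted from left to right into a tree, at the positions
given by their heights, and the tree is queried just before each insertion. -/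
theorem Weight.run_prog (hk : 2 ≤ k) (hP : Params k n ρ) (hR : ((ρ 1 : ℕ) : R) = 0) {y : ℕ → ℕ}
    (hy : ∀ x < n, y x < n) (W : Weight) : ∀ (d : ℕ) (s : St), 5 ≤ d →
      (∀ x < n, s.arr 0 x = y x) →
      ∀ x < n, ((((W.prog d).run ρ s).arr d x : ℕ) : R) = (W.eval n y x : R) := by
  have h0 := hP.size
  induction W with
  | one =>
    intro d s _ _ x hx
    refine run_loop (ρ := ρ) (fun j s' => ∀ x < j, (s'.arr d x : R) = 1) (by simp)
      (fun j hj s' _ _ h x hx => ?_) x (by omega) |>.trans (by simp [Weight.eval])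
    have hj' := hP.lt_length (show j < n by omega)
    simp only [Prog.run, Tm.ev, St.setV_var, if_true, St.setA_arr_apply, true_and,
      Nat.mod_eq_of_lt hj', St.setV_arr]
    split
    · rw [cast_mod hR, Nat.cast_one]
    · exact h x (by omega)
  | mul a b iha ihb =>
    intro d s hd hs x hx
    simp only [Weight.prog, Prog.run.eq_4]
    set s₁ := (a.prog d).run ρ s with hs₁
    set s₂ := (b.prog (d + 1)).run ρ s₁ with hs₂
    have e1 := iha d s hd hs
    have e2 := ihb (d + 1) s₁ (by omega) (fun x hx => by
      rw [hs₁, Prog.run_arr (a.prog_keepsA (by omega) (by norm_num)), hs x hx])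
    have e3 : s₂.arr d = s₁.arr d := Prog.run_arr (b.prog_keepsA (by omega) (by omega))
    refine run_loop (ρ := ρ) (fun j s' => ∀ x < n, (s'.arr d x : R) =
      if x < j then (Weight.eval n y (.mul a b) x : R) else s₂.arr d x)
      (by simp) (fun j hj s' _ h' h x hx => ?_) x hx |>.trans (if_pos (by omega))
    have hj' := hP.lt_length (show j < n by omega)
    have hd' := h' (d + 1) (by simp [Prog.KeepsA])
    simp only [Prog.run, Tm.ev, St.setV_var, if_true, St.setA_arr_apply, true_and, BinOp.eval,
      Nat.mod_eq_of_lt hj', St.setV_arr]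
    by_cases hxj : x = j
    · subst hxj
      rw [if_pos rfl, if_pos (by omega), cast_mod hR, hd']
      push_cast
      rw [h x hx, if_neg (lt_irrefl x), e3, e1 x hx, e2 x hx, Weight.eval]
      push_cast
      rfl
    · rw [if_neg hxj, h x hx]
      exact if_congr (by omega) rfl rfl
  | sw a ih =>
    intro d s hd hs x hx
    simp only [Weight.prog, Prog.run.eq_4 (p := a.prog d), Prog.run.eq_4 (p := clearProg 3)]
    set s₁ := (a.prog d).run ρ s with hs₁
    set s₂ := (clearProg 3).run ρ s₁ with hs₂
    have e1 := ih d s hd hs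
    have e2 : ∀ d', d' ≠ 3 → s₂.arr d' = s₁.arr d' := fun d' hd' =>
      Prog.run_arr (by simp [clearProg, Prog.KeepsA, hd'])
    have e3 : ∀ x < n, s₂.arr 0 x = y x := fun x hx => by
      rw [e2 0 (by norm_num), hs₁, Prog.run_arr (a.prog_keepsA (by omega) (by norm_num)), hs x hx]
    refine (run_loop (ρ := ρ) (fun j s' => (∀ x < n, (s'.arr d x : R) =
      if x < j then (Weight.eval n y (.sw a) x : R) else a.eval n y x) ∧
      PrefixTree (ρ 4) (s'.arr 3) fun i => ∑ q ∈ Finset.range j,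
        if y q < i then (a.eval n y q : R) else 0) ⟨fun x hx => ?_, ?_⟩ ?_).1 x hx |>.trans
      (if_pos (by omega))
    · rw [if_neg (by omega), e2 d (by omega), e1 x hx]
    · simpa using run_clearProg (R := R) hP 3 s₁
    · rintro j hj s' - h' ⟨h1, h2⟩
      have hjn : j < n := by omega
      have hj' := hP.lt_length hjn
      have hyj : y j < ρ 3 := (hy j hjn).trans_le hP.le_pow
      have h3 : s'.arr 0 j = y j := by
        rw [h' 0 (by simp [Prog.KeepsA, queryProg, insertProg]; omega), e3 j hjn]
      simp only [Prog.run.eq_4]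
      set t₁ := (Prog.assign 6 (.get 0 (.var 5))).run ρ (s'.setV 5 j) with ht₁
      have v6 : t₁.var 6 = y j := by
        simp [ht₁, Prog.run, Tm.ev, Nat.mod_eq_of_lt hj', h3,
          Nat.mod_eq_of_lt (hP.lt_modulus hk (hy j hjn).le)]
      have v5 : t₁.var 5 = j := by simp [ht₁, Prog.run]
      have a1 : t₁.arr = s'.arr := rfl
      set t₂ := (queryProg 3 6 7).run ρ t₁ with ht₂
      have q7 : (t₂.var 7 : R) =
          ∑ q ∈ Finset.range j, if y q < y j then (a.eval n y q : R) else 0 := by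
        have := run_queryProg hk hP hR (d := 3) (a := 6) (r := 7) (by norm_num) (by norm_num)
          (s := t₁) (by rwa [v6]) (a1 ▸ h2)
        rwa [v6] at this
      have w6 : t₂.var 6 = y j := (Prog.run_var (by simp [Prog.KeepsV, queryProg])).trans v6
      have w5 : t₂.var 5 = j := (Prog.run_var (by simp [Prog.KeepsV, queryProg])).trans v5
      have a2 : t₂.arr = s'.arr := funext fun d =>
        Prog.run_arr (p := queryProg 3 6 7) (s := t₁) (by simp [Prog.KeepsA, queryProg])
      clear_value t₂
      set t₃ := (Prog.store d (.var 5) (.var 7)).run ρ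
        ((Prog.assign 8 (.get d (.var 5))).run ρ t₂) with ht₃
      have u6 : t₃.var 6 = y j := by simp [ht₃, Prog.run, w6]
      have u8 : (t₃.var 8 : R) = a.eval n y j := by
        have := h1 j hjn
        rw [if_neg (lt_irrefl j)] at this
        simp [ht₃, Prog.run, Tm.ev, w5, Nat.mod_eq_of_lt hj', a2, cast_mod hR, this]
      have a3 : t₃.arr 3 = s'.arr 3 := by
        simp [ht₃, Prog.run, St.setA_arr, show 3 ≠ d by omega, a2]
      have a4 : ∀ x, (t₃.arr d x : R) = if x = j then (t₂.var 7 : R) else s'.arr d x := by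
        intro x
        simp only [ht₃, Prog.run, Tm.ev, St.setA_arr_apply, true_and, St.setV_var, a2,
          St.setV_arr, show (5 : ℕ) ≠ 8 by norm_num, show (7 : ℕ) ≠ 8 by norm_num, if_false, w5,
          Nat.mod_eq_of_lt hj']
        split
        · rw [cast_mod hR]
        · rfl
      have a5 : ((insertProg 3 6 8).run ρ t₃).arr d = t₃.arr d :=
        Prog.run_arr (by simp [Prog.KeepsA, insertProg]; omega)
      refine ⟨fun x hx => ?_, ?_⟩
      · rw [a5, a4]
        by_cases hxj : x = j
        · subst hxj
          rw [if_pos rfl, if_pos (by omega), q7, Weight.eval, sum_range_and hx.le]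
          push_cast
          rfl
        · rw [if_neg hxj, h1 x hx]
          exact if_congr (by omega) rfl rfl
      · refine (run_insertProg hk hP hR (d := 3) (a := 6) (v := 8) (by norm_num) (by norm_num)
          (s := t₃) (by rwa [u6]) (a3 ▸ h2)).congr fun i => ?_
        rw [Finset.sum_range_succ, u6, u8]

end Programs

/-! ### Chains below a horizontal line -/

section Chains

variable {R : Type} [CommRing R]

/-- The sum of the weights `u` over the points before `z` and above it, below the height `h`. -/
def chainOne (c : ℕ → ℕ) (u : ℕ → R) (h z : ℕ) : R :=
  ∑ i ∈ Finset.range z, if c i < h ∧ c z < c i then u i else 0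

/-- If `two` is true, the weighted number of descending chains of two points before `z` and above
it, below the height `h`. Otherwise the same for chains of one point. -/
def chainTwo (two : Bool) (c : ℕ → ℕ) (u v : ℕ → R) (h z : ℕ) : R :=
  if two then ∑ i ∈ Finset.range z, if c i < h ∧ c z < c i then v i * chainOne c u h i else 0
  else chainOne c u h z

/-- The weighted number of descending chains before `z`, below the height `h`, whose last point is
in the same interval of length `r` as `z`. -/
def chainSum (two : Bool) (c : ℕ → ℕ) (u v w : ℕ → R) (h r z : ℕ) : R :=
  ∑ i ∈ Finset.range z, if r * (z / r) ≤ i ∧ c i < h then w i * chainTwo two c u v h i else 0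

/-- When an interval of length `r` is left, the sum over the chains starts afresh. -/
theorem chainSum_succ (two : Bool) (c : ℕ → ℕ) (u v w : ℕ → R) (h r z : ℕ) :
    chainSum two c u v w h r (z + 1) = if (z + 1) % r = 0 then 0 else
      chainSum two c u v w h r z + if c z < h then w z * chainTwo two c u v h z else 0 := by
  have hdm := Nat.div_add_mod (z + 1) r
  by_cases h1 : (z + 1) % r = 0
  · rw [if_pos h1]
    refine Finset.sum_eq_zero fun i hi => if_neg ?_
    rw [Finset.mem_range] at hi
    omega
  · have h2 : (z + 1) / r = z / r := by
      rw [Nat.succ_div, if_neg (fun h => h1 (Nat.mod_eq_zero_of_dvd h)), add_zero]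
    have h3 : r * (z / r) ≤ z := Nat.mul_div_le z r
    rw [if_neg h1]
    simp only [chainSum, h2, Finset.sum_range_succ, h3, true_and]

end Chains

/-- The step of a sweep for a point below the height `h`. The array `3` is a tree with the weights
of the points, the array `4` is a tree with the weights of the chains of two points; the position in
the tree is in the variable `13`, the point in `10`, the sum over all chains in `17`. -/
def chainProg (two : Bool) (U V W : ℕ) : Prog :=
  .seq (queryProg 3 13 15) <| .seq (queryProg 4 13 14) <|
  .seq (.assign 17 (.op .add (.var 17)
    (.op .mul (.get W (.var 10)) (.var (if two then 14 else 15))))) <|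
  .seq (.assign 16 (.op .mul (.get V (.var 10)) (.var 15))) <| .seq (insertProg 4 13 16) <|
  .seq (.assign 16 (.get U (.var 10))) <| insertProg 3 13 16

/-- The step of a sweep at the time in the variable `9`. The height `h` is in the variable `12`, the
result is added to the variable `18`. The array `O` contains the points in the order of the sweep,
the array `Key` their heights. The parameter `r` is the length of the intervals after which the sum
over the chains is reset. -/
def sweepStep (two : Bool) (O Key U V W r : ℕ) : Prog :=
  .seq (.assign 10 (.get O (.var 9))) <| .seq (.assign 11 (.get Key (.var 10))) <|
  .seq (.assign 13 (.op .sub (.op .sub (.par 0) (.const 1)) (.var 11))) <|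
  .seq (.ite (.op .lt (.var 11) (.var 12)) (chainProg two U V W)
    (.ite (.op .lt (.var 11) (.op .add (.var 12) (.par 5)))
      (.assign 18 (.op .add (.var 18) (.op .mul (.var 17) (.get 8 (.var 10))))) .skip)) <|
  .ite (.op .sub (.op .add (.var 9) (.const 1))
      (.op .mul (.op .div (.op .add (.var 9) (.const 1)) (.par r)) (.par r)))
    .skip (.assign 17 (.const 0))

/-- For each height `h` that is a multiple of the width `ρ 5` of the bands, sweep over all points.
-/
def sweepProg (two : Bool) (O Key U V W r : ℕ) : Prog :=
  .loop 6 5 <| .seq (.assign 12 (.op .mul (.var 5) (.par 5))) <| .seq (clearProg 3) <|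
    .seq (clearProg 4) <| .seq (.assign 17 (.const 0)) <| .loop 0 9 (sweepStep two O Key U V W r)

section Programs

variable {R : Type} [CommRing R] {k n : ℕ} {ρ : ℕ → ℕ}

theorem run_chainProg (hk : 2 ≤ k) (hP : Params k n ρ) (hR : ((ρ 1 : ℕ) : R) = 0) (two : Bool)
    {U V W : ℕ} (hU : U ≠ 4) {s : St} {x : ℕ}
    (hx : s.var 10 = x) (hxn : x < n) (h13 : s.var 13 < ρ 3) {G₃ G₄ : ℕ → R}
    (h3 : PrefixTree (ρ 4) (s.arr 3) G₃) (h4 : PrefixTree (ρ 4) (s.arr 4) G₄) :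
    let s' := (chainProg two U V W).run ρ s
    (s'.var 17 : R) =
        s.var 17 + s.arr W x * (if two then G₄ (s.var 13) else G₃ (s.var 13)) ∧
      PrefixTree (ρ 4) (s'.arr 3)
        (fun i => G₃ i + if s.var 13 < i then (s.arr U x : R) else 0) ∧
      PrefixTree (ρ 4) (s'.arr 4)
        (fun i => G₄ i + if s.var 13 < i then (s.arr V x : R) * G₃ (s.var 13) else 0) := by
  have hxN := Nat.mod_eq_of_lt (hP.lt_length hxn)
  simp only [chainProg, Prog.run.eq_4]
  set s₁ := (queryProg 3 13 15).run ρ s with hs₁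
  have q15 : (s₁.var 15 : R) = G₃ (s.var 13) :=
    run_queryProg hk hP hR (by norm_num) (by norm_num) h13 h3
  have v1 : ∀ v, v ≠ 15 → v ≠ 20 → v ≠ 21 → s₁.var v = s.var v := fun v h h' h'' =>
    Prog.run_var (by simp [queryProg, Prog.KeepsV, h, h', h''])
  have a1 : s₁.arr = s.arr := funext fun d =>
    Prog.run_arr (p := queryProg 3 13 15) (by simp [queryProg, Prog.KeepsA])
  clear_value s₁
  set s₂ := (queryProg 4 13 14).run ρ s₁ with hs₂
  have q14 : (s₂.var 14 : R) = G₄ (s.var 13) := by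
    have := run_queryProg hk hP hR (d := 4) (a := 13) (r := 14) (by norm_num) (by norm_num)
      (s := s₁) (by rwa [v1 13 (by norm_num) (by norm_num) (by norm_num)]) (a1 ▸ h4)
    rwa [v1 13 (by norm_num) (by norm_num) (by norm_num)] at this
  have v2 : ∀ v, v ≠ 14 → v ≠ 20 → v ≠ 21 → s₂.var v = s₁.var v := fun v h h' h'' =>
    Prog.run_var (by simp [queryProg, Prog.KeepsV, h, h', h''])
  have a2 : s₂.arr = s.arr := (funext fun d =>
    Prog.run_arr (p := queryProg 4 13 14) (by simp [queryProg, Prog.KeepsA])).trans a1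
  clear_value s₂
  have q15' : (s₂.var 15 : R) = G₃ (s.var 13) := by
    rw [v2 15 (by norm_num) (by norm_num) (by norm_num), q15]
  have v12 : ∀ v, v ≠ 14 → v ≠ 15 → v ≠ 20 → v ≠ 21 → s₂.var v = s.var v :=
    fun v h h' h'' h''' => (v2 v h h'' h''').trans (v1 v h' h'' h''')
  have x2 : s₂.var 10 = x := by
    rw [v12 10 (by norm_num) (by norm_num) (by norm_num) (by norm_num), hx]
  have m2 : s₂.var 13 = s.var 13 := v12 13 (by norm_num) (by norm_num) (by norm_num) (by norm_num)
  have t2 : s₂.var 17 = s.var 17 := v12 17 (by norm_num) (by norm_num) (by norm_num) (by norm_num)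
  set s₃ := (Prog.assign 17 (.op .add (.var 17)
    (.op .mul (.get W (.var 10)) (.var (if two then 14 else 15))))).run ρ s₂ with hs₃
  have q17 : (s₃.var 17 : R) =
      s.var 17 + s.arr W x * (if two then G₄ (s.var 13) else G₃ (s.var 13)) := by
    cases two
    · simp [hs₃, Prog.run, Tm.ev, BinOp.eval, x2, cast_mod hR, hxN, a2, q15', t2]
    · simp [hs₃, Prog.run, Tm.ev, BinOp.eval, x2, cast_mod hR, hxN, a2, q14, t2]
  have v3 : ∀ v, v ≠ 17 → s₃.var v = s₂.var v := fun v h => by simp [hs₃, Prog.run, h]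
  have a3 : s₃.arr = s.arr := a2
  clear_value s₃
  set s₄ := (Prog.assign 16 (.op .mul (.get V (.var 10)) (.var 15))).run ρ s₃ with hs₄
  have q16 : (s₄.var 16 : R) = s.arr V x * G₃ (s.var 13) := by
    simp [hs₄, Prog.run, Tm.ev, BinOp.eval, v3, x2, cast_mod hR, hxN, a3, q15']
  have v4 : ∀ v, v ≠ 16 → s₄.var v = s₃.var v := fun v h => by simp [hs₄, Prog.run, h]
  have a4 : s₄.arr = s.arr := a3
  clear_value s₄
  have m4 : s₄.var 13 = s.var 13 := by rw [v4 13 (by norm_num), v3 13 (by norm_num), m2]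
  set s₅ := (insertProg 4 13 16).run ρ s₄ with hs₅
  have p4 := run_insertProg hk hP hR (d := 4) (a := 13) (v := 16) (by norm_num) (by norm_num)
    (s := s₄) (by rwa [m4]) (a4 ▸ h4)
  rw [← hs₅, m4, q16] at p4
  have v5 : ∀ v, v ≠ 20 → v ≠ 21 → s₅.var v = s₄.var v := fun v h h' =>
    Prog.run_var (by simp [insertProg, Prog.KeepsV, h, h'])
  have a5 : ∀ d, d ≠ 4 → s₅.arr d = s.arr d := fun d h =>
    (Prog.run_arr (by simp [insertProg, Prog.KeepsA, h])).trans (congrFun a4 d)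
  clear_value s₅
  set s₆ := (Prog.assign 16 (.get U (.var 10))).run ρ s₅ with hs₆
  have q16' : (s₆.var 16 : R) = s.arr U x := by
    simp [hs₆, Prog.run, Tm.ev, v5, v4, v3, x2, cast_mod hR, hxN, a5 U hU]
  have v6 : ∀ v, v ≠ 16 → s₆.var v = s₅.var v := fun v h => by simp [hs₆, Prog.run, h]
  have a6 : s₆.arr = s₅.arr := rfl
  clear_value s₆
  have m6 : s₆.var 13 = s.var 13 := by
    rw [v6 13 (by norm_num), v5 13 (by norm_num) (by norm_num), m4]
  have p3 := run_insertProg hk hP hR (d := 3) (a := 13) (v := 16) (by norm_num) (by norm_num)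
    (s := s₆) (by rwa [m6]) (by rw [a6, a5 3 (by norm_num)]; exact h3)
  rw [m6, q16'] at p3
  refine ⟨?_, p3, ?_⟩
  · rw [Prog.run_var (by simp [insertProg, Prog.KeepsV]), v6 17 (by norm_num),
      v5 17 (by norm_num) (by norm_num), v4 17 (by norm_num), q17]
  · rw [Prog.run_arr (by simp [insertProg, Prog.KeepsA]), a6]
    exact p4

/-- The sum of the weights `f` over the points before `z`, below the height `h`, whose distance to
the top line is less than `i`. Measuring heights from the top turns sums over the points above a
line into prefix sums. -/
def heapSum (n : ℕ) (c : ℕ → ℕ) (h : ℕ) (f : ℕ → R) (z i : ℕ) : R :=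
  ∑ j ∈ Finset.range z, if c j < h ∧ n - 1 - c j < i then f j else 0

/-- The query of the tree at the position of the point `z` itself. -/
theorem heapSum_self {c : ℕ → ℕ} (hc : ∀ z < n, c z < n) (h : ℕ) (f : ℕ → R) {z : ℕ} (hz : z < n) :
    heapSum n c h f z (n - 1 - c z) =
      ∑ i ∈ Finset.range z, if c i < h ∧ c z < c i then f i else 0 := by
  refine Finset.sum_congr rfl fun i hi => if_congr ?_ rfl rfl
  have h1 := hc z hz
  have h2 := hc i ((Finset.mem_range.1 hi).trans hz)
  omega

theorem run_sweepStep (hk : 2 ≤ k) (hP : Params k n ρ) (hR : ((ρ 1 : ℕ) : R) = 0) (two : Bool)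
    {O Key U V W r h z : ℕ} (hU : U ≠ 4) {o κ : ℕ → ℕ} (ho : ∀ z < n, o z < n)
    (hκ : ∀ x < n, κ x < n) {s : St} (hO : ∀ z < n, s.arr O z = o z)
    (hK : ∀ x < n, s.arr Key x = κ x) (hz : z < n) (h9 : s.var 9 = z) (h12 : s.var 12 = h)
    {c : ℕ → ℕ} (hc : ∀ z, c z = κ (o z)) {u v w : ℕ → R} (hu : ∀ z < n, (s.arr U (o z) : R) = u z)
    (hv : ∀ z < n, (s.arr V (o z) : R) = v z) (hw : ∀ z < n, (s.arr W (o z) : R) = w z)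
    (h3 : PrefixTree (ρ 4) (s.arr 3) (heapSum n c h u z))
    (h4 : PrefixTree (ρ 4) (s.arr 4) (heapSum n c h (fun i => v i * chainOne c u h i) z))
    (h17 : (s.var 17 : R) = chainSum two c u v w h (ρ r) z) :
    let s' := (sweepStep two O Key U V W r).run ρ s
    PrefixTree (ρ 4) (s'.arr 3) (heapSum n c h u (z + 1)) ∧
      PrefixTree (ρ 4) (s'.arr 4) (heapSum n c h (fun i => v i * chainOne c u h i) (z + 1)) ∧
      (s'.var 17 : R) = chainSum two c u v w h (ρ r) (z + 1) ∧
      (s'.var 18 : R) = s.var 18 + if h ≤ c z ∧ c z < h + ρ 5 then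
        chainSum two c u v w h (ρ r) z * s.arr 8 (o z) else 0 := by
  have hzN := Nat.mod_eq_of_lt (hP.lt_length hz)
  have hx := ho z hz
  have hxN := Nat.mod_eq_of_lt (hP.lt_length hx)
  have hcn : ∀ z < n, c z < n := fun z hz => hc z ▸ hκ _ (ho z hz)
  have hcz := hcn z hz
  have h0 := hP.size
  have hPn := hP.le_pow
  simp only [sweepStep, Prog.run.eq_4]
  set s₁ := (Prog.assign 13 (.op .sub (.op .sub (.par 0) (.const 1)) (.var 11))).run ρ
    ((Prog.assign 11 (.get Key (.var 10))).run ρ ((Prog.assign 10 (.get O (.var 9))).run ρ s))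
    with hs₁
  have x10 : s₁.var 10 = o z := by
    simp [hs₁, Prog.run, Tm.ev, h9, hzN, hO z hz, Nat.mod_eq_of_lt (hP.lt_modulus hk hx.le)]
  have x11 : s₁.var 11 = c z := by
    have := Nat.mod_eq_of_lt (hP.lt_modulus hk (hκ _ hx).le)
    simp [hs₁, Prog.run, Tm.ev, h9, hzN, hO z hz, Nat.mod_eq_of_lt (hP.lt_modulus hk hx.le),
      hxN, hK _ hx, this, hc]
  have x13 : s₁.var 13 = n - 1 - c z := by
    have h1 := Nat.mod_eq_of_lt (hP.lt_modulus hk (hκ _ hx).le)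
    have h2 : (n - 1 - c z) % ρ 1 = n - 1 - c z :=
      Nat.mod_eq_of_lt (hP.lt_modulus hk (by omega))
    rw [hc] at h2
    simp [hs₁, Prog.run, Tm.ev, BinOp.eval, h9, hzN, hO z hz,
      Nat.mod_eq_of_lt (hP.lt_modulus hk hx.le), hxN, hK _ hx, h1, hc, h0, h2]
  have v1 : ∀ v, v ≠ 10 → v ≠ 11 → v ≠ 13 → s₁.var v = s.var v := fun v h h' h'' => by
    simp [hs₁, Prog.run, h, h', h'']
  have a1 : s₁.arr = s.arr := rfl
  have m17 : s₁.var 17 = s.var 17 := v1 17 (by norm_num) (by norm_num) (by norm_num)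
  have m18 : s₁.var 18 = s.var 18 := v1 18 (by norm_num) (by norm_num) (by norm_num)
  have m12 : s₁.var 12 = h := (v1 12 (by norm_num) (by norm_num) (by norm_num)).trans h12
  have m9 : s₁.var 9 = z := (v1 9 (by norm_num) (by norm_num) (by norm_num)).trans h9
  clear_value s₁
  set mid := Prog.ite (.op .lt (.var 11) (.var 12)) (chainProg two U V W)
    (.ite (.op .lt (.var 11) (.op .add (.var 12) (.par 5)))
      (.assign 18 (.op .add (.var 18) (.op .mul (.var 17) (.get 8 (.var 10))))) .skip) with hmid
  -- The state before the sum over the chains is reset.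
  have key : ∀ s₂, mid.run ρ s₁ = s₂ → PrefixTree (ρ 4) (s₂.arr 3) (heapSum n c h u (z + 1)) ∧
      PrefixTree (ρ 4) (s₂.arr 4) (heapSum n c h (fun i => v i * chainOne c u h i) (z + 1)) ∧
      (s₂.var 17 : R) = chainSum two c u v w h (ρ r) z +
        (if c z < h then w z * chainTwo two c u v h z else 0) ∧
      (s₂.var 18 : R) = s.var 18 + if h ≤ c z ∧ c z < h + ρ 5 then
        chainSum two c u v w h (ρ r) z * s.arr 8 (o z) else 0 := by
    intro s₂ hs₂
    by_cases hlt : c z < h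
    · have e : s₂ = (chainProg two U V W).run ρ s₁ := by
        rw [← hs₂]
        simp [hmid, Prog.run, Tm.ev, BinOp.eval, x11, m12, hlt]
      have e18 : s₂.var 18 = s.var 18 := by
        rw [e, Prog.run_var (by simp [chainProg, queryProg, insertProg, Prog.KeepsV]), m18]
      obtain ⟨b1, b2, b3⟩ := run_chainProg hk hP hR two (V := V) (W := W) hU x10 hx (s := s₁)
        (by rw [x13]; omega) (a1 ▸ h3) (a1 ▸ h4)
      rw [← e] at b1 b2 b3
      rw [x13] at b1 b2 b3
      rw [a1] at b1 b2 b3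
      rw [heapSum_self hcn h _ hz] at b1 b3
      rw [hw z hz, heapSum_self hcn h _ hz] at b1
      rw [hu z hz] at b2
      rw [hv z hz] at b3
      refine ⟨b2.congr fun i => ?_, b3.congr fun i => ?_, ?_, ?_⟩
      · rw [heapSum, Finset.sum_range_succ]
        simp only [hlt, true_and]
        rfl
      · rw [heapSum, Finset.sum_range_succ]
        simp only [hlt, true_and]
        rfl
      · rw [b1, m17, h17, if_pos hlt]
        rfl
      · rw [e18, if_neg (by omega), add_zero]
    · have e : s₂ = (Prog.ite (.op .lt (.var 11) (.op .add (.var 12) (.par 5)))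
          (.assign 18 (.op .add (.var 18) (.op .mul (.var 17) (.get 8 (.var 10)))))
          .skip).run ρ s₁ := by
        rw [← hs₂, hmid, Prog.run, if_neg]
        simp [Tm.ev, BinOp.eval, x11, m12, hlt]
      have e17 : s₂.var 17 = s.var 17 := by
        rw [e, Prog.run_var (by simp [Prog.KeepsV]), m17]
      have ea : ∀ d, s₂.arr d = s.arr d := fun d => by
        rw [e, Prog.run_arr (by simp [Prog.KeepsA]), a1]
      have hs : ∀ (f : ℕ → R) i, heapSum n c h f (z + 1) i = heapSum n c h f z i := fun f i => by
        rw [heapSum, Finset.sum_range_succ, if_neg (by tauto), add_zero]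
        rfl
      refine ⟨?_, ?_, ?_, ?_⟩
      · rw [ea]
        exact h3.congr (hs _)
      · rw [ea]
        exact h4.congr (hs _)
      · rw [e17, h17, if_neg hlt, add_zero]
      · rw [e]
        by_cases hlt' : c z < h + ρ 5
        · have : h ≤ c z ∧ c z < h + ρ 5 := by omega
          simp [Prog.run, Tm.ev, BinOp.eval, x11, m12, hlt', this, cast_mod hR, m18, m17, x10,
            hxN, a1, h17]
        · simp [Prog.run, Tm.ev, BinOp.eval, x11, m12, hlt', m18]
  obtain ⟨b1, b2, b3, b4⟩ := key _ rfl
  have m9' : (mid.run ρ s₁).var 9 = z := by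
    rw [Prog.run_var (by simp [hmid, chainProg, queryProg, insertProg, Prog.KeepsV]), m9]
  set s₂ := mid.run ρ s₁
  clear_value s₂
  refine ⟨?_, ?_, ?_, ?_⟩
  · rwa [Prog.run_arr (by simp [Prog.KeepsA])]
  · rwa [Prog.run_arr (by simp [Prog.KeepsA])]
  · rw [chainSum_succ, ← b3]
    have hdm := Nat.div_add_mod (z + 1) (ρ r)
    have hmul : (z + 1) / ρ r * ρ r = ρ r * ((z + 1) / ρ r) := mul_comm _ _
    simp only [Prog.run, Tm.ev, BinOp.eval, m9', hmul]
    by_cases hm : (z + 1) % ρ r = 0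
    · rw [if_pos hm, if_neg (by omega)]
      simp
    · rw [if_neg hm, if_pos (by omega)]
  · rw [Prog.run_var (by simp [Prog.KeepsV]), b4]

/-- The sum, over all points, of the weights of the chains whose first point is below the band of
the point, and whose last point is in the same interval of length `r`. -/
theorem run_sweepProg (hk : 2 ≤ k) (hP : Params k n ρ) (hR : ((ρ 1 : ℕ) : R) = 0) (two : Bool)
    {O Key U V W r : ℕ} (hU : U ≠ 3 ∧ U ≠ 4) (hV : V ≠ 3 ∧ V ≠ 4) (hW : W ≠ 3 ∧ W ≠ 4)
    (hO3 : O ≠ 3 ∧ O ≠ 4) (hK3 : Key ≠ 3 ∧ Key ≠ 4) {o κ : ℕ → ℕ} (ho : ∀ z < n, o z < n)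
    (hκ : ∀ x < n, κ x < n) {s : St} (hO : ∀ z < n, s.arr O z = o z)
    (hK : ∀ x < n, s.arr Key x = κ x)
    {c : ℕ → ℕ} (hc : ∀ z, c z = κ (o z)) {u v w w₃ : ℕ → R}
    (hu : ∀ z < n, (s.arr U (o z) : R) = u z) (hv : ∀ z < n, (s.arr V (o z) : R) = v z)
    (hw : ∀ z < n, (s.arr W (o z) : R) = w z) (hw₃ : ∀ z < n, (s.arr 8 (o z) : R) = w₃ z) :
    (((sweepProg two O Key U V W r).run ρ s).var 18 : R) = s.var 18 +
      ∑ z ∈ Finset.range n, chainSum two c u v w (ρ 5 * (c z / ρ 5)) (ρ r) z * w₃ z := by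
  have h0 := hP.size
  have hcn : ∀ z < n, c z < n := fun z hz => hc z ▸ hκ _ (ho z hz)
  have hkeepA : ∀ d, d ≠ 3 ∧ d ≠ 4 → (sweepStep two O Key U V W r).KeepsA d := fun d h => by
    simp [sweepStep, chainProg, queryProg, insertProg, Prog.KeepsA, h]
  have main := run_loop_sum (R := R) (ρ := ρ) (k := 6) (r := 5) (a := 18)
    (p := .seq (.assign 12 (.op .mul (.var 5) (.par 5))) <| .seq (clearProg 3) <|
    .seq (clearProg 4) <| .seq (.assign 17 (.const 0)) <| .loop 0 9 (sweepStep two O Key U V W r))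
    (s := s) (fun b => ∑ z ∈ Finset.range n, if b * ρ 5 ≤ c z ∧ c z < b * ρ 5 + ρ 5 then
        chainSum two c u v w (b * ρ 5) (ρ r) z * w₃ z else 0) (by norm_num) ?_
  · refine main.trans ?_
    congr 1
    rw [Finset.sum_comm]
    refine Finset.sum_congr rfl fun z hz => ?_
    have hz' := hcn z (Finset.mem_range.1 hz)
    have hmul : c z / ρ 5 * ρ 5 = ρ 5 * (c z / ρ 5) := mul_comm _ _
    have hdm := Nat.div_add_mod (c z) (ρ 5)
    have hmod := Nat.mod_lt (c z) hP.width_pos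
    rw [Finset.sum_eq_single (c z / ρ 5)]
    · rw [if_pos (by omega), hmul]
    · intro b _ hb
      refine if_neg fun h => hb ?_
      rw [Nat.div_eq_of_lt_le h.1]
      rw [add_mul]
      omega
    · intro h
      exfalso
      apply h
      rw [Finset.mem_range, hP.bands]
      have := Nat.div_le_div_right (c := ρ 5) hz'.le
      omega
  · intro b hb s' h5 hv' ha'
    have keep : ∀ d, d ≠ 3 ∧ d ≠ 4 → s'.arr d = s.arr d := fun d h => ha' d
      ⟨trivial, by simp [clearProg, Prog.KeepsA, h], by simp [clearProg, Prog.KeepsA, h], trivial,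
        hkeepA d h⟩
    have hbn : b * ρ 5 ≤ n := by
      rw [hP.bands] at hb
      exact (Nat.mul_le_mul_right _ (Nat.lt_succ_iff.1 hb)).trans (Nat.div_mul_le_self n _)
    simp only [Prog.run.eq_4]
    set s₁ := (Prog.assign 12 (.op .mul (.var 5) (.par 5))).run ρ s' with hs₁
    have x12 : s₁.var 12 = b * ρ 5 := by
      simp [hs₁, Prog.run, Tm.ev, BinOp.eval, h5, Nat.mod_eq_of_lt (hP.lt_modulus hk hbn)]
    have x18 : s₁.var 18 = s'.var 18 := by simp [hs₁, Prog.run]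
    have a1 : s₁.arr = s'.arr := rfl
    clear_value s₁
    set s₂ := (clearProg 3).run ρ s₁ with hs₂
    set s₃ := (clearProg 4).run ρ s₂ with hs₃
    have t3 : PrefixTree (ρ 4) (s₃.arr 3) (fun _ => (0 : R)) := by
      rw [hs₃, Prog.run_arr (by simp [clearProg, Prog.KeepsA])]
      exact run_clearProg hP 3 s₁
    have t4 : PrefixTree (ρ 4) (s₃.arr 4) (fun _ => (0 : R)) := run_clearProg hP 4 s₂
    have y12 : s₃.var 12 = b * ρ 5 := by
      rw [hs₃, Prog.run_var (by simp [clearProg, Prog.KeepsV]), hs₂,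
        Prog.run_var (by simp [clearProg, Prog.KeepsV]), x12]
    have y18 : s₃.var 18 = s'.var 18 := by
      rw [hs₃, Prog.run_var (by simp [clearProg, Prog.KeepsV]), hs₂,
        Prog.run_var (by simp [clearProg, Prog.KeepsV]), x18]
    have a3 : ∀ d, d ≠ 3 ∧ d ≠ 4 → s₃.arr d = s.arr d := fun d h => by
      rw [hs₃, Prog.run_arr (by simp [clearProg, Prog.KeepsA, h]), hs₂,
        Prog.run_arr (by simp [clearProg, Prog.KeepsA, h]), a1, keep d h]
    clear_value s₃
    set s₄ := (Prog.assign 17 (.const 0)).run ρ s₃ with hs₄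
    have z17 : s₄.var 17 = 0 := by simp [hs₄, Prog.run, Tm.ev]
    have z12 : s₄.var 12 = b * ρ 5 := by simp [hs₄, Prog.run, y12]
    have z18 : s₄.var 18 = s'.var 18 := by simp [hs₄, Prog.run, y18]
    have a4 : s₄.arr = s₃.arr := rfl
    clear_value s₄
    refine (run_loop (ρ := ρ) (k := 0) (fun z t =>
      PrefixTree (ρ 4) (t.arr 3) (heapSum n c (b * ρ 5) u z) ∧ PrefixTree (ρ 4) (t.arr 4)
        (heapSum n c (b * ρ 5) (fun i => v i * chainOne c u (b * ρ 5) i) z) ∧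
      (t.var 17 : R) = chainSum two c u v w (b * ρ 5) (ρ r) z ∧
      (t.var 18 : R) = s'.var 18 + ∑ z ∈ Finset.range z, if b * ρ 5 ≤ c z ∧ c z < b * ρ 5 + ρ 5 then
        chainSum two c u v w (b * ρ 5) (ρ r) z * w₃ z else 0) ?_ ?_).2.2.2.trans (by rw [h0])
    · refine ⟨?_, ?_, ?_, ?_⟩
      · rw [a4]
        exact t3.congr fun i => by simp [heapSum]
      · rw [a4]
        exact t4.congr fun i => by simp [heapSum]
      · simp [z17, chainSum]
      · simp [z18]
    · rintro z hz t hvt hat ⟨b1, b2, b3, b4⟩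
      have hzn : z < n := by omega
      have at' : ∀ d, d ≠ 3 ∧ d ≠ 4 → t.arr d = s.arr d := fun d h => by
        rw [hat d (hkeepA d h), a4, a3 d h]
      obtain ⟨c1, c2, c3, c4⟩ := run_sweepStep hk hP hR two (O := O) (Key := Key) (U := U) (V := V)
        (W := W) (r := r) (h := b * ρ 5) (z := z) (s := t.setV 9 z) hU.2 ho hκ
        (by simpa [at' O hO3] using hO) (by simpa [at' Key hK3] using hK) hzn (by simp)
        (by
          have := hvt 12 (by norm_num)
            (by simp [sweepStep, chainProg, queryProg, insertProg, Prog.KeepsV])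
          simpa [z12] using this)
        hc (u := u) (v := v) (w := w) (by simpa [at' U hU] using hu) (by simpa [at' V hV] using hv)
        (by simpa [at' W hW] using hw) b1 b2 (by simpa using b3)
      refine ⟨c1, c2, c3, ?_⟩
      have e8 : (((t.setV 9 z).arr 8 (o z) : ℕ) : R) = w₃ z := by
        rw [St.setV_arr, at' 8 (by norm_num), hw₃ z hzn]
      rw [c4, e8, Finset.sum_range_succ, ← add_assoc, ← b4]
      simp

end Programs

/-! ### Chains within the bands of a point -/

/-- The innermost step: `x₂`, `x₃`, `y₀` are in the variables `10`, `7`, `12`; the tree in the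
array `3` is queried at the key of the point `x₀` at the height `y₀`, and the answer, in the
variable `15`, may be used by the term `coef`. -/
def cellStep (Key : ℕ) (coef : Tm) : Prog :=
  .seq (.assign 13 (.get 1 (.var 12))) <| .seq (.assign 14 (.get Key (.var 13))) <|
  .seq (queryProg 3 14 15) <|
  .assign 18 (.op .add (.var 18) (.op .mul
    (.op .mul (.op .lt (.var 10) (.var 7))
      (.op .mul (.op .lt (.get 0 (.var 10)) (.var 12)) (.op .lt (.var 13) (.var 10))))
    (.op .mul (.op .mul (.get 5 (.var 13)) (.op .mul (.get 7 (.var 10)) (.get 8 (.var 7)))) coef)))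

/-- Runs through the heights `y₀` below the height `y₃`, which is in the variable `8`, in the same
band. -/
def cellRow (Key : ℕ) (coef : Tm) : Prog :=
  .loop 5 5 <|
    .seq (.assign 12 (.op .add (.op .mul (.op .div (.var 8) (.par 5)) (.par 5)) (.var 5)))
    (.ite (.op .lt (.var 12) (.var 8)) (cellStep Key coef) .skip)

/-- Runs through the points `x₃` in the same vertical band as the point `x₂`. -/
def cellColumn (Key : ℕ) (coef : Tm) : Prog :=
  .loop 5 6 <|
    .seq (.assign 7 (.op .add (.op .mul (.op .div (.var 10) (.par 5)) (.par 5)) (.var 6)))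
    (.ite (.op .lt (.var 7) (.par 0)) (.seq (.assign 8 (.get 0 (.var 7))) (cellRow Key coef)) .skip)

/-- Sweep over the points `x₂` in the order given by the array `O`; the tree in the array `3`
contains the weights, from the array `6`, of the points met so far, at the positions given by the
array `Key`. -/
def cellProg (O Key : ℕ) (coef : Tm) : Prog :=
  .seq (clearProg 3) <| .loop 0 9 <| .seq (.assign 10 (.get O (.var 9))) <|
    .seq (cellColumn Key coef) <| .seq (.assign 11 (.get Key (.var 10))) <|
    .seq (.assign 16 (.get 6 (.var 10))) <| insertProg 3 11 16

section Programs

variable {R : Type} [CommRing R] {k n : ℕ} {ρ : ℕ → ℕ}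

/-- The sum over the numbers below `m` in the band `b` of width `s`. -/
theorem sum_band {s n m : ℕ} (hs : 0 < s) (hm : m ≤ n) (b : ℕ) (F : ℕ → R) :
    (∑ i ∈ Finset.range s, if b * s + i < m then F (b * s + i) else 0) =
      ∑ x ∈ Finset.range n, if x / s = b ∧ x < m then F x else 0 := by
  rw [← Finset.sum_filter, ← Finset.sum_filter]
  refine Finset.sum_nbij' (fun i => b * s + i) (fun x => x - b * s) ?_ ?_ ?_ ?_ ?_
  · intro i hi
    simp only [Finset.mem_filter, Finset.mem_range] at hi ⊢
    refine ⟨by omega, ?_, hi.2⟩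
    rw [mul_comm, Nat.mul_add_div hs, Nat.div_eq_of_lt hi.1, add_zero]
  · intro x hx
    simp only [Finset.mem_filter, Finset.mem_range] at hx ⊢
    have h1 := Nat.div_add_mod x s
    have h2 := Nat.mod_lt x hs
    rw [hx.2.1, mul_comm] at h1
    omega
  · intro i _
    simp
  · intro x hx
    simp only [Finset.mem_filter, Finset.mem_range] at hx
    have h1 := Nat.div_add_mod x s
    rw [hx.2.1, mul_comm] at h1
    omega
  · intro i _
    rfl

/-- The term `coef` computes `cf x₀ x₂ q`, if `q` is the value of the variable `15`. -/
def Computes (ρ : ℕ → ℕ) (n : ℕ) (A : ℕ → ℕ) (coef : Tm) (cf : ℕ → ℕ → R → R) : Prop :=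
  ∀ s : St, s.var 13 < n → s.var 10 < n → s.arr 9 = A →
    (coef.ev ρ s : R) = cf (s.var 13) (s.var 10) (s.var 15 : R)

theorem run_cellStep (hk : 2 ≤ k) (hP : Params k n ρ) (hR : ((ρ 1 : ℕ) : R) = 0) {Key : ℕ}
    {y inv κ : ℕ → ℕ} {coef : Tm} {cf : ℕ → ℕ → R → R} {s : St}
    (hcf : Computes ρ n (s.arr 9) coef cf) (hinv : ∀ i < n, inv i < n) (hκ : ∀ x < n, κ x < n)
    (h0 : ∀ x < n, s.arr 0 x = y x) (h1 : ∀ x < n, s.arr 1 x = inv x)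
    (hK : ∀ x < n, s.arr Key x = κ x) {G : ℕ → R} (h3 : PrefixTree (ρ 4) (s.arr 3) G)
    {x₂ x₃ y₀ : ℕ} (e₂ : s.var 10 = x₂) (e₃ : s.var 7 = x₃) (e₀ : s.var 12 = y₀) (l₂ : x₂ < n)
    (l₃ : x₃ < n) (l₀ : y₀ < n) :
    (((cellStep Key coef).run ρ s).var 18 : R) = s.var 18 +
      if x₂ < x₃ ∧ y x₂ < y₀ ∧ inv y₀ < x₂ then
        (s.arr 5 (inv y₀) : R) * (s.arr 7 x₂ * s.arr 8 x₃) * cf (inv y₀) x₂ (G (κ (inv y₀)))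
      else 0 := by
  have li := hinv y₀ l₀
  have lk := hκ _ li
  have m0 := Nat.mod_eq_of_lt (hP.lt_length l₀)
  have mi := Nat.mod_eq_of_lt (hP.lt_length li)
  have m2 := Nat.mod_eq_of_lt (hP.lt_length l₂)
  have m3 := Nat.mod_eq_of_lt (hP.lt_length l₃)
  have Mi := Nat.mod_eq_of_lt (hP.lt_modulus hk li.le)
  have Mk := Nat.mod_eq_of_lt (hP.lt_modulus hk lk.le)
  simp only [cellStep, Prog.run.eq_4]
  set s₁ := (Prog.assign 14 (.get Key (.var 13))).run ρ
    ((Prog.assign 13 (.get 1 (.var 12))).run ρ s) with hs₁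
  have x13 : s₁.var 13 = inv y₀ := by
    simp [hs₁, Prog.run, Tm.ev, e₀, m0, h1 _ l₀, Mi]
  have x14 : s₁.var 14 = κ (inv y₀) := by
    simp [hs₁, Prog.run, Tm.ev, e₀, m0, h1 _ l₀, Mi, mi, hK _ li, Mk]
  have v1 : ∀ v, v ≠ 13 → v ≠ 14 → s₁.var v = s.var v := fun v h h' => by
    simp [hs₁, Prog.run, h, h']
  have a1 : s₁.arr = s.arr := rfl
  clear_value s₁
  set s₂ := (queryProg 3 14 15).run ρ s₁ with hs₂
  have q15 : (s₂.var 15 : R) = G (κ (inv y₀)) := by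
    have := run_queryProg hk hP hR (d := 3) (a := 14) (r := 15) (by norm_num) (by norm_num)
      (s := s₁) (by rw [x14]; exact lk.trans_le hP.le_pow) (a1 ▸ h3)
    rwa [x14] at this
  have v2 : ∀ v, v ≠ 15 → v ≠ 20 → v ≠ 21 → s₂.var v = s₁.var v := fun v h h' h'' =>
    Prog.run_var (by simp [queryProg, Prog.KeepsV, h, h', h''])
  have a2 : s₂.arr = s.arr := (funext fun d =>
    Prog.run_arr (p := queryProg 3 14 15) (by simp [queryProg, Prog.KeepsA])).trans a1
  clear_value s₂
  have z13 : s₂.var 13 = inv y₀ := by rw [v2 13 (by norm_num) (by norm_num) (by norm_num), x13]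
  have z : ∀ v, v ≠ 13 → v ≠ 14 → v ≠ 15 → v ≠ 20 → v ≠ 21 → s₂.var v = s.var v :=
    fun v h h' h'' h3 h4 => (v2 v h'' h3 h4).trans (v1 v h h')
  have z10 : s₂.var 10 = x₂ := by
    rw [z 10 (by norm_num) (by norm_num) (by norm_num) (by norm_num) (by norm_num), e₂]
  have z7 : s₂.var 7 = x₃ := by
    rw [z 7 (by norm_num) (by norm_num) (by norm_num) (by norm_num) (by norm_num), e₃]
  have z12 : s₂.var 12 = y₀ := by
    rw [z 12 (by norm_num) (by norm_num) (by norm_num) (by norm_num) (by norm_num), e₀]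
  have z18 : s₂.var 18 = s.var 18 :=
    z 18 (by norm_num) (by norm_num) (by norm_num) (by norm_num) (by norm_num)
  have hc := hcf s₂ (by rwa [z13]) (by rwa [z10]) (by rw [a2])
  rw [z13, z10, q15] at hc
  simp only [Prog.run, Tm.ev, BinOp.eval, St.setV_var, if_true, cast_mod hR]
  push_cast
  simp only [hc, z10, z7, z12, z13, z18, a2, m2, m3, mi, h0 _ l₂]
  congr 1
  split_ifs <;> first | (exfalso; tauto) | simp

theorem cellStep_keepsV (Key : ℕ) (coef : Tm) {v : ℕ} (h : v < 13) :
    (cellStep Key coef).KeepsV v := by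
  simp [cellStep, queryProg, Prog.KeepsV]
  omega

theorem cellStep_keepsA (Key : ℕ) (coef : Tm) (d : ℕ) : (cellStep Key coef).KeepsA d := by
  simp [cellStep, queryProg, Prog.KeepsA]

theorem run_cellRow (hk : 2 ≤ k) (hP : Params k n ρ) (hR : ((ρ 1 : ℕ) : R) = 0) {Key : ℕ}
    {y inv κ : ℕ → ℕ} {coef : Tm} {cf : ℕ → ℕ → R → R} {s : St}
    (hcf : Computes ρ n (s.arr 9) coef cf) (hinv : ∀ i < n, inv i < n) (hκ : ∀ x < n, κ x < n)
    (h0 : ∀ x < n, s.arr 0 x = y x) (h1 : ∀ x < n, s.arr 1 x = inv x)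
    (hK : ∀ x < n, s.arr Key x = κ x) {G : ℕ → R} (h3 : PrefixTree (ρ 4) (s.arr 3) G)
    {x₂ x₃ y₃ : ℕ} (e₂ : s.var 10 = x₂) (e₃ : s.var 7 = x₃) (e₀ : s.var 8 = y₃) (l₂ : x₂ < n)
    (l₃ : x₃ < n) (l₀ : y₃ < n) :
    (((cellRow Key coef).run ρ s).var 18 : R) = s.var 18 +
      ∑ y₀ ∈ Finset.range n, if y₀ / ρ 5 = y₃ / ρ 5 ∧ y₀ < y₃ then
        if x₂ < x₃ ∧ y x₂ < y₀ ∧ inv y₀ < x₂ then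
          (s.arr 5 (inv y₀) : R) * (s.arr 7 x₂ * s.arr 8 x₃) * cf (inv y₀) x₂ (G (κ (inv y₀)))
        else 0 else 0 := by
  rw [← sum_band hP.width_pos l₀.le]
  refine run_loop_sum (R := R) (ρ := ρ) _ (by norm_num) fun j hj s' hj' hv ha => ?_
  have hs' : ∀ d, s'.arr d = s.arr d := fun d =>
    ha d ⟨trivial, cellStep_keepsA Key coef d, trivial⟩
  have hv' : ∀ v, v ≠ 5 → v < 12 → s'.var v = s.var v := fun v h h' =>
    hv v h ⟨by simp only [Prog.KeepsV]; omega, cellStep_keepsV Key coef (by omega), trivial⟩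
  have hle : y₃ / ρ 5 * ρ 5 ≤ y₃ := Nat.div_mul_le_self _ _
  have hM : (y₃ / ρ 5 * ρ 5 + j) % ρ 1 = y₃ / ρ 5 * ρ 5 + j := by
    have h1 := hP.width_le_succ
    have h2 := hP.length
    have h3 := hP.length_le hk
    exact Nat.mod_eq_of_lt (by omega)
  simp only [Prog.run.eq_4]
  set s₁ := (Prog.assign 12 (.op .add (.op .mul (.op .div (.var 8) (.par 5)) (.par 5))
    (.var 5))).run ρ s' with hs₁
  have x12 : s₁.var 12 = y₃ / ρ 5 * ρ 5 + j := by
    simp [hs₁, Prog.run, Tm.ev, BinOp.eval, hj', hv', e₀, hM]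
  have v1 : ∀ v, v ≠ 12 → s₁.var v = s'.var v := fun v h => by simp [hs₁, Prog.run, h]
  have a1 : s₁.arr = s.arr := funext hs'
  clear_value s₁
  have x8 : s₁.var 8 = y₃ := by rw [v1 8 (by norm_num), hv' 8 (by norm_num) (by norm_num), e₀]
  have x18 : s₁.var 18 = s'.var 18 := v1 18 (by norm_num)
  by_cases hlt : y₃ / ρ 5 * ρ 5 + j < y₃
  · have := run_cellStep hk hP hR (s := s₁) (Key := Key) (coef := coef) (cf := cf) (y := y)
      (by rwa [a1]) hinv hκ (by rwa [a1])
      (by rwa [a1]) (by rwa [a1]) (by rwa [a1])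
      (by rw [v1 10 (by norm_num), hv' 10 (by norm_num) (by norm_num), e₂])
      (by rw [v1 7 (by norm_num), hv' 7 (by norm_num) (by norm_num), e₃]) x12 l₂ l₃
      (by omega)
    rw [if_pos hlt, Prog.run, if_pos (by simp [Tm.ev, BinOp.eval, x12, x8, hlt]), this, x18, a1]
  · rw [if_neg hlt, Prog.run, if_neg (by simp [Tm.ev, BinOp.eval, x12, x8, hlt]), add_zero,
      Prog.run, x18]

theorem cellRow_keepsV (Key : ℕ) (coef : Tm) {v : ℕ} (h : v < 12) (h5 : v ≠ 5) :
    (cellRow Key coef).KeepsV v :=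
  ⟨h5, by simp only [Prog.KeepsV]; omega, cellStep_keepsV Key coef (by omega), trivial⟩

theorem run_cellColumn (hk : 2 ≤ k) (hP : Params k n ρ) (hR : ((ρ 1 : ℕ) : R) = 0) {Key : ℕ}
    {y inv κ : ℕ → ℕ} {coef : Tm} {cf : ℕ → ℕ → R → R} {s : St}
    (hcf : Computes ρ n (s.arr 9) coef cf) (hinv : ∀ i < n, inv i < n) (hκ : ∀ x < n, κ x < n)
    (hy : ∀ x < n, y x < n) (h0 : ∀ x < n, s.arr 0 x = y x) (h1 : ∀ x < n, s.arr 1 x = inv x)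
    (hK : ∀ x < n, s.arr Key x = κ x) {G : ℕ → R} (h3 : PrefixTree (ρ 4) (s.arr 3) G)
    {x₂ : ℕ} (e₂ : s.var 10 = x₂) (l₂ : x₂ < n) :
    (((cellColumn Key coef).run ρ s).var 18 : R) = s.var 18 +
      ∑ x₃ ∈ Finset.range n, if x₃ / ρ 5 = x₂ / ρ 5 ∧ x₃ < n then
        ∑ y₀ ∈ Finset.range n, if y₀ / ρ 5 = y x₃ / ρ 5 ∧ y₀ < y x₃ then
          if x₂ < x₃ ∧ y x₂ < y₀ ∧ inv y₀ < x₂ then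
            (s.arr 5 (inv y₀) : R) * (s.arr 7 x₂ * s.arr 8 x₃) * cf (inv y₀) x₂ (G (κ (inv y₀)))
          else 0 else 0 else 0 := by
  rw [← sum_band hP.width_pos le_rfl]
  refine run_loop_sum (R := R) (ρ := ρ) _ (by norm_num) fun j hj s' hj' hv ha => ?_
  have hs' : ∀ d, s'.arr d = s.arr d := fun d =>
    ha d ⟨trivial, ⟨trivial, trivial, cellStep_keepsA Key coef d, trivial⟩, trivial⟩
  have hv' : ∀ v, 9 ≤ v → v < 12 → s'.var v = s.var v := fun v h h' =>
    hv v (by omega) ⟨by simp only [Prog.KeepsV]; omega,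
      ⟨by simp only [Prog.KeepsV]; omega, cellRow_keepsV Key coef (by omega) (by omega)⟩, trivial⟩
  have hle : x₂ / ρ 5 * ρ 5 ≤ x₂ := Nat.div_mul_le_self _ _
  have h0' := hP.size
  have hM : (x₂ / ρ 5 * ρ 5 + j) % ρ 1 = x₂ / ρ 5 * ρ 5 + j := by
    have h1 := hP.width_le_succ
    have h2 := hP.length
    have h3 := hP.length_le hk
    exact Nat.mod_eq_of_lt (by omega)
  simp only [Prog.run.eq_4]
  set s₁ := (Prog.assign 7 (.op .add (.op .mul (.op .div (.var 10) (.par 5)) (.par 5))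
    (.var 6))).run ρ s' with hs₁
  have x7 : s₁.var 7 = x₂ / ρ 5 * ρ 5 + j := by
    simp [hs₁, Prog.run, Tm.ev, BinOp.eval, hj', hv', e₂, hM]
  have v1 : ∀ v, v ≠ 7 → s₁.var v = s'.var v := fun v h => by simp [hs₁, Prog.run, h]
  have a1 : s₁.arr = s.arr := funext hs'
  clear_value s₁
  have x10 : s₁.var 10 = x₂ := by rw [v1 10 (by norm_num), hv' 10 (by norm_num) (by norm_num), e₂]
  have x18 : s₁.var 18 = s'.var 18 := v1 18 (by norm_num)
  by_cases hlt : x₂ / ρ 5 * ρ 5 + j < n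
  · rw [if_pos hlt, Prog.run, if_pos (by simp [Tm.ev, BinOp.eval, x7, h0', hlt])]
    set x₃ := x₂ / ρ 5 * ρ 5 + j with hx₃
    simp only [Prog.run.eq_4]
    set s₂ := (Prog.assign 8 (.get 0 (.var 7))).run ρ s₁ with hs₂
    have x8 : s₂.var 8 = y x₃ := by
      simp [hs₂, Prog.run, Tm.ev, x7, Nat.mod_eq_of_lt (hP.lt_length hlt), a1, h0 _ hlt,
        Nat.mod_eq_of_lt (hP.lt_modulus hk (hy _ hlt).le)]
    have v2 : ∀ v, v ≠ 8 → s₂.var v = s₁.var v := fun v h => by simp [hs₂, Prog.run, h]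
    have a2 : s₂.arr = s.arr := a1
    clear_value s₂
    have := run_cellRow hk hP hR (s := s₂) (Key := Key) (coef := coef) (cf := cf) (y := y)
      (by rwa [a2]) hinv hκ (by rwa [a2]) (by rwa [a2]) (by rwa [a2]) (by rwa [a2])
      (by rw [v2 10 (by norm_num), x10]) (by rw [v2 7 (by norm_num), x7]) x8 l₂ hlt (hy _ hlt)
    rw [this, v2 18 (by norm_num), x18, a2]
  · rw [if_neg hlt, Prog.run, if_neg (by simp [Tm.ev, BinOp.eval, x7, h0', hlt]), add_zero,
      Prog.run, x18]

theorem cellColumn_keepsV (Key : ℕ) (coef : Tm) {v : ℕ} (h : 9 ≤ v) (h' : v < 12) :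
    (cellColumn Key coef).KeepsV v :=
  ⟨by omega, by simp only [Prog.KeepsV]; omega,
    ⟨by simp only [Prog.KeepsV]; omega, cellRow_keepsV Key coef (by omega) (by omega)⟩, trivial⟩

theorem cellColumn_keepsA (Key : ℕ) (coef : Tm) (d : ℕ) : (cellColumn Key coef).KeepsA d :=
  ⟨trivial, ⟨trivial, trivial, cellStep_keepsA Key coef d, trivial⟩, trivial⟩

/-- The sum over the pairs of points `x₂`, `x₃` in the same vertical band and the heights `y₀` in
the band of `x₃`. -/
theorem run_cellProg (hk : 2 ≤ k) (hP : Params k n ρ) (hR : ((ρ 1 : ℕ) : R) = 0) {O Key : ℕ}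
    (hO3 : O ≠ 3) (hK3 : Key ≠ 3) {y inv o κ : ℕ → ℕ} {coef : Tm} {cf : ℕ → ℕ → R → R} {s : St}
    (hcf : Computes ρ n (s.arr 9) coef cf) (hinv : ∀ i < n, inv i < n) (hκ : ∀ x < n, κ x < n)
    (hy : ∀ x < n, y x < n) (ho : ∀ x < n, o x < n) (h0 : ∀ x < n, s.arr 0 x = y x)
    (h1 : ∀ x < n, s.arr 1 x = inv x) (hO : ∀ x < n, s.arr O x = o x)
    (hK : ∀ x < n, s.arr Key x = κ x) :
    (((cellProg O Key coef).run ρ s).var 18 : R) = s.var 18 +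
      ∑ z ∈ Finset.range n, ∑ x₃ ∈ Finset.range n, if x₃ / ρ 5 = o z / ρ 5 ∧ x₃ < n then
        ∑ y₀ ∈ Finset.range n, if y₀ / ρ 5 = y x₃ / ρ 5 ∧ y₀ < y x₃ then
          if o z < x₃ ∧ y (o z) < y₀ ∧ inv y₀ < o z then
            (s.arr 5 (inv y₀) : R) * (s.arr 7 (o z) * s.arr 8 x₃) * cf (inv y₀) (o z)
              (∑ i ∈ Finset.range z, if κ (o i) < κ (inv y₀) then (s.arr 6 (o i) : R) else 0)
          else 0 else 0 else 0 := by
  have h0' := hP.size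
  simp only [cellProg]
  rw [Prog.run.eq_4 (p := clearProg 3)]
  set s₁ := (clearProg 3).run ρ s with hs₁
  have t1 : PrefixTree (ρ 4) (s₁.arr 3) (fun _ => (0 : R)) := run_clearProg hP 3 s
  have a1 : ∀ d, d ≠ 3 → s₁.arr d = s.arr d := fun d h =>
    Prog.run_arr (by simp [clearProg, Prog.KeepsA, h])
  have x18 : s₁.var 18 = s.var 18 := Prog.run_var (by simp [clearProg, Prog.KeepsV])
  clear_value s₁
  refine (run_loop (ρ := ρ) (k := 0) (fun z t => PrefixTree (ρ 4) (t.arr 3) (fun j =>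
    ∑ i ∈ Finset.range z, if κ (o i) < j then (s.arr 6 (o i) : R) else 0) ∧
    (t.var 18 : R) = s.var 18 + ∑ z ∈ Finset.range z, ∑ x₃ ∈ Finset.range n,
      if x₃ / ρ 5 = o z / ρ 5 ∧ x₃ < n then
        ∑ y₀ ∈ Finset.range n, if y₀ / ρ 5 = y x₃ / ρ 5 ∧ y₀ < y x₃ then
          if o z < x₃ ∧ y (o z) < y₀ ∧ inv y₀ < o z then
            (s.arr 5 (inv y₀) : R) * (s.arr 7 (o z) * s.arr 8 x₃) * cf (inv y₀) (o z)
              (∑ i ∈ Finset.range z, if κ (o i) < κ (inv y₀) then (s.arr 6 (o i) : R) else 0)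
          else 0 else 0 else 0) ⟨by simpa using t1, by simp [x18]⟩ ?_).2.trans (by rw [h0'])
  rintro z hz t - hat ⟨b1, b2⟩
  have hzn : z < n := by omega
  have hx := ho z hzn
  have hzN := Nat.mod_eq_of_lt (hP.lt_length hzn)
  have hxN := Nat.mod_eq_of_lt (hP.lt_length hx)
  have hxM := Nat.mod_eq_of_lt (hP.lt_modulus hk hx.le)
  have hkM := Nat.mod_eq_of_lt (hP.lt_modulus hk (hκ _ hx).le)
  have at' : ∀ d, d ≠ 3 → t.arr d = s.arr d := fun d h => by
    rw [hat d ⟨trivial, cellColumn_keepsA Key coef d, trivial, trivial,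
      by simp [insertProg, Prog.KeepsA, h]⟩, a1 d h]
  simp only [Prog.run.eq_4]
  set s₂ := (Prog.assign 10 (.get O (.var 9))).run ρ (t.setV 9 z) with hs₂
  have x10 : s₂.var 10 = o z := by
    simp [hs₂, Prog.run, Tm.ev, hzN, at' O hO3, hO z hzn, hxM]
  have y18 : s₂.var 18 = t.var 18 := by simp [hs₂, Prog.run]
  have a2 : s₂.arr = t.arr := rfl
  clear_value s₂
  set s₃ := (cellColumn Key coef).run ρ s₂ with hs₃
  have e3 := run_cellColumn hk hP hR (s := s₂) (Key := Key) (coef := coef) (cf := cf) (y := y)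
    (by rwa [a2, at' 9 (by norm_num)]) hinv hκ hy (by rwa [a2, at' 0 (by norm_num)])
    (by rwa [a2, at' 1 (by norm_num)]) (by rwa [a2, at' Key hK3]) (a2 ▸ b1) x10 hx
  rw [← hs₃, y18, a2, at' 5 (by norm_num), at' 7 (by norm_num), at' 8 (by norm_num)] at e3
  have y10 : s₃.var 10 = o z :=
    (Prog.run_var (cellColumn_keepsV Key coef (by norm_num) (by norm_num))).trans x10
  have a3 : s₃.arr = t.arr :=
    (funext fun d => Prog.run_arr (cellColumn_keepsA Key coef d)).trans a2
  clear_value s₃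
  set s₄ := (Prog.assign 16 (.get 6 (.var 10))).run ρ
    ((Prog.assign 11 (.get Key (.var 10))).run ρ s₃) with hs₄
  have z11 : s₄.var 11 = κ (o z) := by
    simp [hs₄, Prog.run, Tm.ev, y10, hxN, a3, at' Key hK3, hK _ hx, hkM]
  have z16 : (s₄.var 16 : R) = s.arr 6 (o z) := by
    simp [hs₄, Prog.run, Tm.ev, y10, hxN, a3, at' 6, cast_mod hR]
  have z18 : s₄.var 18 = s₃.var 18 := by simp [hs₄, Prog.run]
  have a4 : s₄.arr = t.arr := a3
  clear_value s₄
  refine ⟨?_, ?_⟩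
  · refine (run_insertProg hk hP hR (d := 3) (a := 11) (v := 16) (by norm_num) (by norm_num)
      (s := s₄) (by rw [z11]; exact (hκ _ hx).trans_le hP.le_pow) (a4 ▸ b1)).congr fun j => ?_
    rw [Finset.sum_range_succ, z11, z16]
  · rw [Prog.run_var (by simp [insertProg, Prog.KeepsV]), z18, e3, b2, Finset.sum_range_succ,
      add_assoc]

end Programs

/-! ### The decomposition of the sum over all patterns -/

section Patterns

variable {R : Type} [CommRing R] {n : ℕ}

/-- The sum of the weights `v` over the points strictly inside the rectangle spanned by the points
`z₀` and `z₂`; it is replaced by `1` if `two` is false. -/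
def innerSum (two : Bool) (n : ℕ) (c : ℕ → ℕ) (v : ℕ → R) (z₀ z₂ : ℕ) : R :=
  if two then ∑ i ∈ Finset.range n, if z₀ < i ∧ i < z₂ ∧ c z₂ < c i ∧ c i < c z₀ then v i else 0
  else 1

theorem chainTwo_eq (two : Bool) (c : ℕ → ℕ) (u v : ℕ → R) (h : ℕ) {z : ℕ} (hz : z ≤ n) :
    chainTwo two c u v h z = ∑ i ∈ Finset.range n, if i < z ∧ c i < h ∧ c z < c i then
      u i * innerSum two n c v i z else 0 := by
  cases two
  · simp only [chainTwo, innerSum, Bool.false_eq_true, if_false, mul_one]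
    rw [chainOne, sum_range_and hz]
  · simp only [chainTwo, innerSum, if_true]
    have e1 : ∀ i ∈ Finset.range z, (if c i < h ∧ c z < c i then v i * chainOne c u h i else 0) =
        ∑ j ∈ Finset.range n, if j < i ∧ c j < h ∧ c i < c j ∧ c z < c i then
          u j * v i else 0 := by
      intro i hi
      have hin : i ≤ n := (Finset.mem_range.1 hi).le.trans hz
      rw [chainOne, ← sum_range_and hin, Finset.mul_sum]
      by_cases hc : c i < h ∧ c z < c i
      · rw [if_pos hc]
        refine Finset.sum_congr rfl fun j _ => ?_
        rw [mul_ite, mul_zero]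
        exact if_congr (by tauto) (mul_comm _ _) rfl
      · rw [if_neg hc]
        refine (Finset.sum_eq_zero fun j _ => if_neg ?_).symm
        rintro ⟨-, h1, h2, h3⟩
        exact hc ⟨h2.trans h1, h3⟩
    rw [Finset.sum_congr rfl e1, Finset.sum_comm]
    refine Finset.sum_congr rfl fun j _ => ?_
    rw [← sum_range_and hz]
    by_cases hc : j < z ∧ c j < h ∧ c z < c j
    · rw [if_pos hc, Finset.mul_sum]
      refine Finset.sum_congr rfl fun i _ => ?_
      rw [mul_ite, mul_zero]
      exact if_congr (by tauto) rfl rfl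
    · rw [if_neg hc]
      refine Finset.sum_eq_zero fun i _ => if_neg ?_
      rintro ⟨h1, h2, h3, h4, h5⟩
      exact hc ⟨h2.trans h1, h3, h5.trans h4⟩

/-- The sum computed by a sweep, as a sum over triples. -/
theorem sum_chainSum (two : Bool) (c : ℕ → ℕ) (u v w w₃ : ℕ → R) (h : ℕ → ℕ) (r : ℕ) :
    (∑ z₃ ∈ Finset.range n, chainSum two c u v w (h z₃) r z₃ * w₃ z₃) =
      ∑ z₃ ∈ Finset.range n, ∑ z₂ ∈ Finset.range n, ∑ z₀ ∈ Finset.range n,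
        if z₂ < z₃ ∧ r * (z₃ / r) ≤ z₂ ∧ c z₂ < h z₃ ∧ z₀ < z₂ ∧ c z₀ < h z₃ ∧ c z₂ < c z₀ then
          u z₀ * innerSum two n c v z₀ z₂ * w z₂ * w₃ z₃ else 0 := by
  refine Finset.sum_congr rfl fun z₃ h₃ => ?_
  rw [chainSum, ← sum_range_and (Finset.mem_range.1 h₃).le, Finset.sum_mul]
  refine Finset.sum_congr rfl fun z₂ h₂ => ?_
  rw [chainTwo_eq two c u v (h z₃) (Finset.mem_range.1 h₂).le]
  by_cases hc : z₂ < z₃ ∧ r * (z₃ / r) ≤ z₂ ∧ c z₂ < h z₃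
  · rw [if_pos hc, Finset.mul_sum, Finset.sum_mul]
    refine Finset.sum_congr rfl fun z₀ _ => ?_
    rw [mul_ite, mul_zero, ite_mul, zero_mul]
    refine if_congr (by tauto) ?_ rfl
    ring
  · rw [if_neg hc, zero_mul]
    refine (Finset.sum_eq_zero fun z₀ _ => if_neg ?_).symm
    tauto

/-- `y` and `inv` are inverse permutations of the numbers below `n`. -/
structure InversePerms (n : ℕ) (y inv : ℕ → ℕ) : Prop where
  lt : ∀ x < n, y x < n
  inv_lt : ∀ x < n, inv x < n
  inv_apply : ∀ x < n, inv (y x) = x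
  apply_inv : ∀ x < n, y (inv x) = x

variable {y inv : ℕ → ℕ}

theorem InversePerms.sum (h : InversePerms n y inv) (F : ℕ → R) :
    ∑ z ∈ Finset.range n, F z = ∑ x ∈ Finset.range n, F (y x) := by
  refine Finset.sum_nbij' inv y ?_ ?_ ?_ ?_ ?_
  · exact fun z hz => Finset.mem_range.2 (h.inv_lt z (Finset.mem_range.1 hz))
  · exact fun z hz => Finset.mem_range.2 (h.lt z (Finset.mem_range.1 hz))
  · exact fun z hz => h.apply_inv z (Finset.mem_range.1 hz)
  · exact fun z hz => h.inv_apply z (Finset.mem_range.1 hz)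
  · intro z hz
    rw [h.apply_inv z (Finset.mem_range.1 hz)]

theorem InversePerms.innerSum_inv (h : InversePerms n y inv) (two : Bool) (v : ℕ → R) {x₀ x₂ : ℕ}
    (h₀ : x₀ < n) (h₂ : x₂ < n) :
    innerSum two n inv (fun z => v (inv z)) (y x₂) (y x₀) = innerSum two n y v x₀ x₂ := by
  cases two
  · rfl
  · simp only [innerSum, if_true]
    rw [h.sum]
    refine Finset.sum_congr rfl fun x hx => ?_
    rw [h.inv_apply x (Finset.mem_range.1 hx), h.inv_apply x₀ h₀, h.inv_apply x₂ h₂]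
    exact if_congr (by tauto) rfl rfl

/-- The sum of the weights `v` over the points to the south-west of `(a, b)`. -/
def cornerSum (n : ℕ) (y : ℕ → ℕ) (v : ℕ → R) (a b : ℕ) : R :=
  ∑ i ∈ Finset.range n, if i < a ∧ y i < b then v i else 0

/-- Inclusion and exclusion for a rectangle. -/
theorem InversePerms.innerSum_eq (h : InversePerms n y inv) (v : ℕ → R) {x₀ x₂ : ℕ}
    (h₀ : x₀ < n) (h₂ : x₂ < n) (hx : x₀ < x₂) (hy : y x₂ < y x₀) :
    innerSum true n y v x₀ x₂ = (cornerSum n y v x₂ (y x₀) - cornerSum n y v x₀ (y x₀)) +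
      (cornerSum n y v x₀ (y x₂) - cornerSum n y v x₂ (y x₂)) := by
  simp only [innerSum, if_true, cornerSum]
  rw [← Finset.sum_sub_distrib, ← Finset.sum_sub_distrib, ← Finset.sum_add_distrib]
  refine Finset.sum_congr rfl fun x hxn => ?_
  have e₀ : y x = y x₀ ↔ x = x₀ := by
    constructor
    · intro e
      rw [← h.inv_apply x (Finset.mem_range.1 hxn), e, h.inv_apply x₀ h₀]
    · rintro rfl
      rfl
  have e₂ : y x = y x₂ ↔ x = x₂ := by
    constructor
    · intro e
      rw [← h.inv_apply x (Finset.mem_range.1 hxn), e, h.inv_apply x₂ h₂]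
    · rintro rfl
      rfl
  split_ifs <;> first | (exfalso; omega) | simp

/-- The coefficient of the chain `x₀`, `x₂` in the sweep by position within the bands, where `q` is
the sum over the points to the south-west of the corner `(x₂, y x₀)` and `S x₀` that of the corner
`(x₀, y x₀)` of the rectangle. -/
def firstCoef (two : Bool) (S : ℕ → R) (x₀ _ : ℕ) (q : R) : R := if two then q - S x₀ else 1

/-- The coefficient of the chain `x₀`, `x₂` in the sweep by height within the bands, where `q` and
`S x₂` are the sums for the corners `(x₀, y x₂)` and `(x₂, y x₂)`. Without the point `2`, every
chain has been counted in the first sweep. -/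
def secondCoef (two : Bool) (S : ℕ → R) (_ x₂ : ℕ) (q : R) : R := if two then q - S x₂ else 0

/-- The sum over all occurrences of the pattern `3 2 1 4`, or `2 1 3` if `two` is false. -/
def patternSum (two : Bool) (n : ℕ) (y : ℕ → ℕ) (w₀ w₁ w₂ w₃ : ℕ → R) : R :=
  ∑ x₃ ∈ Finset.range n, ∑ x₂ ∈ Finset.range n, ∑ x₀ ∈ Finset.range n,
    if x₀ < x₂ ∧ x₂ < x₃ ∧ y x₂ < y x₀ ∧ y x₀ < y x₃ then
      w₀ x₀ * innerSum two n y w₁ x₀ x₂ * w₂ x₂ * w₃ x₃ else 0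

/-- The sum computed by a sweep within the bands. -/
def cellSum (n s : ℕ) (y inv o κ : ℕ → ℕ) (w₀ w₁ w₂ w₃ : ℕ → R) (cf : ℕ → ℕ → R → R) : R :=
  ∑ z ∈ Finset.range n, ∑ x₃ ∈ Finset.range n, if x₃ / s = o z / s ∧ x₃ < n then
    ∑ y₀ ∈ Finset.range n, if y₀ / s = y x₃ / s ∧ y₀ < y x₃ then
      if o z < x₃ ∧ y (o z) < y₀ ∧ inv y₀ < o z then
        w₀ (inv y₀) * (w₂ (o z) * w₃ x₃) * cf (inv y₀) (o z)
          (∑ i ∈ Finset.range z, if κ (o i) < κ (inv y₀) then w₁ (o i) else 0)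
      else 0 else 0 else 0

/-- The pattern `x₀`, `x₂`, `x₃` occurs with `x₂`, `x₃` in one vertical band and the heights of
`x₀`, `x₃` in one horizontal band. -/
def InCell (s : ℕ) (y : ℕ → ℕ) (x₃ x₂ x₀ : ℕ) : Prop :=
  x₃ / s = x₂ / s ∧ y x₀ / s = y x₃ / s ∧ x₀ < x₂ ∧ x₂ < x₃ ∧ y x₂ < y x₀ ∧ y x₀ < y x₃

instance (s : ℕ) (y : ℕ → ℕ) (x₃ x₂ x₀ : ℕ) : Decidable (InCell s y x₃ x₂ x₀) := by
  unfold InCell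
  infer_instance

theorem InversePerms.cellSum_eq (h : InversePerms n y inv) (s : ℕ) (o κ : ℕ → ℕ)
    (w₀ w₁ w₂ w₃ : ℕ → R) (cf : ℕ → ℕ → R → R) :
    cellSum n s y inv o κ w₀ w₁ w₂ w₃ cf = ∑ z ∈ Finset.range n, ∑ x₃ ∈ Finset.range n,
      ∑ x₀ ∈ Finset.range n, if InCell s y x₃ (o z) x₀ then
        w₀ x₀ * w₂ (o z) * w₃ x₃ * cf x₀ (o z)
          (∑ i ∈ Finset.range z, if κ (o i) < κ x₀ then w₁ (o i) else 0) else 0 := by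
  refine Finset.sum_congr rfl fun z _ => Finset.sum_congr rfl fun x₃ h₃ => ?_
  rw [h.sum]
  by_cases hc : x₃ / s = o z / s ∧ x₃ < n
  · rw [if_pos hc]
    refine Finset.sum_congr rfl fun x₀ h₀ => ?_
    rw [h.inv_apply x₀ (Finset.mem_range.1 h₀), ← ite_and]
    refine if_congr ?_ (by ring) rfl
    unfold InCell
    tauto
  · rw [if_neg hc]
    refine (Finset.sum_eq_zero fun x₀ _ => if_neg fun hi => hc ?_).symm
    exact ⟨hi.1, Finset.mem_range.1 h₃⟩

theorem InversePerms.cellSum_first (h : InversePerms n y inv) (s : ℕ) (w₀ w₁ w₂ w₃ : ℕ → R)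
    (cf : ℕ → ℕ → R → R) :
    cellSum n s y inv id y w₀ w₁ w₂ w₃ cf = ∑ x₃ ∈ Finset.range n, ∑ x₂ ∈ Finset.range n,
      ∑ x₀ ∈ Finset.range n, if InCell s y x₃ x₂ x₀ then
        w₀ x₀ * w₂ x₂ * w₃ x₃ * cf x₀ x₂ (cornerSum n y w₁ x₂ (y x₀)) else 0 := by
  rw [h.cellSum_eq, Finset.sum_comm]
  refine Finset.sum_congr rfl fun x₃ _ => Finset.sum_congr rfl fun x₂ h₂ =>
    Finset.sum_congr rfl fun x₀ _ => ?_
  rw [cornerSum, sum_range_and (Finset.mem_range.1 h₂).le]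
  rfl

theorem InversePerms.cellSum_second (h : InversePerms n y inv) (s : ℕ) (w₀ w₁ w₂ w₃ : ℕ → R)
    (cf : ℕ → ℕ → R → R) :
    cellSum n s y inv inv id w₀ w₁ w₂ w₃ cf = ∑ x₃ ∈ Finset.range n, ∑ x₂ ∈ Finset.range n,
      ∑ x₀ ∈ Finset.range n, if InCell s y x₃ x₂ x₀ then
        w₀ x₀ * w₂ x₂ * w₃ x₃ * cf x₀ x₂ (cornerSum n y w₁ x₀ (y x₂)) else 0 := by
  rw [h.cellSum_eq, h.sum, Finset.sum_comm]
  refine Finset.sum_congr rfl fun x₃ _ => Finset.sum_congr rfl fun x₂ h₂ =>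
    Finset.sum_congr rfl fun x₀ _ => ?_
  have hx₂ := Finset.mem_range.1 h₂
  have e : (∑ i ∈ Finset.range (y x₂), if id (inv i) < id x₀ then w₁ (inv i) else 0) =
      cornerSum n y w₁ x₀ (y x₂) := by
    rw [cornerSum, ← sum_range_and (h.lt x₂ hx₂).le, h.sum]
    refine Finset.sum_congr rfl fun x hx => ?_
    rw [h.inv_apply x (Finset.mem_range.1 hx)]
    exact if_congr and_comm rfl rfl
  rw [h.inv_apply x₂ hx₂, e]

/-- The sum computed by the sweep by height: there the chain begins with `x₂` and ends with `x₀`. -/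
theorem InversePerms.sum_chainSum_inv (h : InversePerms n y inv) (s : ℕ) (two : Bool)
    (w₀ w₁ w₂ w₃ : ℕ → R) :
    (∑ z ∈ Finset.range n, chainSum two inv (fun z => w₂ (inv z)) (fun z => w₁ (inv z))
        (fun z => w₀ (inv z)) (s * (inv z / s)) s z * w₃ (inv z)) =
      ∑ x₃ ∈ Finset.range n, ∑ x₂ ∈ Finset.range n, ∑ x₀ ∈ Finset.range n,
        if y x₀ < y x₃ ∧ s * (y x₃ / s) ≤ y x₀ ∧ x₀ < s * (x₃ / s) ∧ y x₂ < y x₀ ∧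
          x₂ < s * (x₃ / s) ∧ x₀ < x₂ then
          w₀ x₀ * innerSum two n y w₁ x₀ x₂ * w₂ x₂ * w₃ x₃ else 0 := by
  rw [sum_chainSum (h := fun z => s * (inv z / s)) (w₃ := fun z => w₃ (inv z)), h.sum]
  refine Finset.sum_congr rfl fun x₃ h₃ => ?_
  rw [h.sum]
  refine (Finset.sum_congr rfl fun x₀ h₀ => h.sum _).trans ?_
  rw [Finset.sum_comm]
  refine Finset.sum_congr rfl fun x₂ h₂ => Finset.sum_congr rfl fun x₀ h₀ => ?_
  rw [Finset.mem_range] at h₀ h₂ h₃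
  rw [h.inv_apply x₃ h₃, h.inv_apply x₂ h₂, h.inv_apply x₀ h₀, h.innerSum_inv two w₁ h₀ h₂]
  refine if_congr Iff.rfl ?_ rfl
  ring

/-- The decomposition of the sum over all patterns: the height of `x₀` is in a lower band than the
height of `x₃`; the heights are in one band, but `x₂` is in a vertical band to the left of `x₃`;
both are in one band. -/
theorem InversePerms.patternSum_eq (h : InversePerms n y inv) {s N : ℕ} (hs : 0 < s) (hN : n ≤ N)
    (two : Bool) (w₀ w₁ w₂ w₃ : ℕ → R) :
    patternSum two n y w₀ w₁ w₂ w₃ =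
      (∑ z ∈ Finset.range n, chainSum two y w₀ w₁ w₂ (s * (y z / s)) N z * w₃ z) +
      (∑ z ∈ Finset.range n, chainSum two inv (fun z => w₂ (inv z)) (fun z => w₁ (inv z))
        (fun z => w₀ (inv z)) (s * (inv z / s)) s z * w₃ (inv z)) +
      (cellSum n s y inv id y w₀ w₁ w₂ w₃
        (firstCoef two fun x => cornerSum n y w₁ x (y x)) +
      cellSum n s y inv inv id w₀ w₁ w₂ w₃
        (secondCoef two fun x => cornerSum n y w₁ x (y x))) := by
  rw [sum_chainSum (h := fun z => s * (y z / s)), h.sum_chainSum_inv, h.cellSum_first,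
    h.cellSum_second]
  simp only [← Finset.sum_add_distrib]
  refine Finset.sum_congr rfl fun x₃ h₃ => Finset.sum_congr rfl fun x₂ h₂ =>
    Finset.sum_congr rfl fun x₀ h₀ => ?_
  rw [Finset.mem_range] at h₀ h₂ h₃
  set F := w₀ x₀ * innerSum two n y w₁ x₀ x₂ * w₂ x₂ * w₃ x₃ with hF
  have hcell : ((if InCell s y x₃ x₂ x₀ then w₀ x₀ * w₂ x₂ * w₃ x₃ * firstCoef two
      (fun x => cornerSum n y w₁ x (y x)) x₀ x₂ (cornerSum n y w₁ x₂ (y x₀)) else 0) +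
      if InCell s y x₃ x₂ x₀ then w₀ x₀ * w₂ x₂ * w₃ x₃ * secondCoef two
      (fun x => cornerSum n y w₁ x (y x)) x₀ x₂ (cornerSum n y w₁ x₀ (y x₂)) else 0) =
      if InCell s y x₃ x₂ x₀ then F else 0 := by
    by_cases hc : InCell s y x₃ x₂ x₀
    · rw [if_pos hc, if_pos hc, if_pos hc, hF]
      cases two
      · simp [firstCoef, secondCoef, innerSum]
      · rw [h.innerSum_eq w₁ h₀ h₂ hc.2.2.1 hc.2.2.2.2.1]
        simp only [firstCoef, secondCoef, if_true]
        ring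
    · rw [if_neg hc, if_neg hc, if_neg hc, add_zero]
  rw [hcell]
  have q₁ : y x₀ < s * (y x₃ / s) ↔ y x₀ / s < y x₃ / s := by
    rw [mul_comm, Nat.div_lt_iff_lt_mul hs]
  have q₂ : x₂ < s * (x₃ / s) ↔ x₂ / s < x₃ / s := by
    rw [mul_comm, Nat.div_lt_iff_lt_mul hs]
  have l₁ : s * (y x₃ / s) ≤ y x₃ := Nat.mul_div_le _ _
  have l₂ : s * (x₃ / s) ≤ x₃ := Nat.mul_div_le _ _
  have m₁ : y x₀ < y x₃ → y x₀ / s ≤ y x₃ / s := fun h => Nat.div_le_div_right h.le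
  have m₂ : x₂ < x₃ → x₂ / s ≤ x₃ / s := fun h => Nat.div_le_div_right h.le
  have hN' : N * (x₃ / N) = 0 := by rw [Nat.div_eq_of_lt (h₃.trans_le hN), mul_zero]
  have hI : InCell s y x₃ x₂ x₀ ↔ (x₃ / s = x₂ / s ∧ y x₀ / s = y x₃ / s ∧ x₀ < x₂ ∧ x₂ < x₃ ∧
      y x₂ < y x₀ ∧ y x₀ < y x₃) := Iff.rfl
  rw [hN', if_congr hI rfl rfl]
  clear hI hcell hF
  clear_value F
  split_ifs <;> first | (exfalso; omega) | simp

end Patterns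

/-! ### The program for the sum over all patterns -/

/-- Tabulates the inverse permutation, the identity and the weights. -/
def tableProg (W₀ W₁ W₂ W₃ : Weight) : Prog :=
  .seq (.loop 0 5 (.seq (.store 2 (.var 5) (.var 5)) (.store 1 (.get 0 (.var 5)) (.var 5)))) <|
  .seq (W₀.prog 5) <| .seq (W₁.prog 6) <| .seq (W₂.prog 7) <| .seq (W₃.prog 8) <|
  (Weight.sw W₁).prog 9

/-- A term for `firstCoef`, respectively `secondCoef`, if `v` is the variable of the point `x₀`,
respectively `x₂`. The sum in the array `9` is subtracted modulo the parameter `1`. -/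
def coefTerm (two : Bool) (v c : ℕ) : Tm :=
  if two then .op .add (.var 15) (.op .sub (.par 1) (.get 9 (.var v))) else .const c

/-- Computes the sum over all patterns, by two sweeps over the points and two sweeps within the
bands. The second sweep goes by height, so that the weights of `x₀` and `x₂` change places. The
total is kept in the variable `18`, and in the end put into the variable `0`. -/
def patternProg (two : Bool) (W₀ W₁ W₂ W₃ : Weight) : Prog :=
  .seq (tableProg W₀ W₁ W₂ W₃) <| .seq (.assign 18 (.const 0)) <|
  .seq (sweepProg two 2 0 5 6 7 2) <| .seq (sweepProg two 1 2 7 6 5 5) <|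
  .seq (cellProg 2 0 (coefTerm two 13 1)) <| .seq (cellProg 1 2 (coefTerm two 10 0)) <|
  .assign 0 (.var 18)

/-- The sweeps take `n ^ (2/3)` rounds of time `n`; within the bands there are `n` rounds of time
`n ^ (1/3) * n ^ (1/3)`. -/
theorem patternProg_expo (two : Bool) (W₀ W₁ W₂ W₃ : Weight) (k : ℕ) :
    (patternProg two W₀ W₁ W₂ W₃).expo (paramExpo k) ≤ 5 := by
  have h₀ := W₀.prog_expo k 5
  have h₁ := W₁.prog_expo k 6
  have h₂ := W₂.prog_expo k 7
  have h₃ := W₃.prog_expo k 8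
  have h₄ := (Weight.sw W₁).prog_expo k 9
  simp [patternProg, tableProg, Prog.expo, sweepProg, sweepStep, chainProg, clearProg, cellProg,
    cellColumn, cellRow, cellStep, queryProg, insertProg, paramExpo]
  omega

section Programs

variable {R : Type} [CommRing R] {k n : ℕ} {ρ : ℕ → ℕ} {y inv : ℕ → ℕ}

theorem Prog.run_arr_lt (h1 : 0 < ρ 1) (p : Prog) : ∀ s : St, (∀ d i, s.arr d i < ρ 1) →
    ∀ d i, (p.run ρ s).arr d i < ρ 1 := by
  induction p with
  | skip => exact fun s h => h
  | assign r e => exact fun s h => h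
  | store d i e =>
    intro s h d' i'
    simp only [Prog.run, St.setA_arr_apply]
    split
    · exact Nat.mod_lt _ h1
    · exact h d' i'
  | seq p q ihp ihq => exact fun s h => ihq _ (ihp s h)
  | ite b p q ihp ihq =>
    intro s h
    simp only [Prog.run]
    split
    · exact ihp s h
    · exact ihq s h
  | loop k r p ih =>
    intro s h
    exact iter_inv (fun _ (s' : St) => ∀ d i, s'.arr d i < ρ 1) h fun j _ s' hs' =>
      ih (s'.setV r j) (by simpa using hs')

/-- The arrays contain the permutation and the tables of the inverse, the identity, and the
weights. -/
structure Tables (R : Type) [CommRing R] (n : ℕ) (y inv : ℕ → ℕ) (W₀ W₁ W₂ W₃ : Weight)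
    (a : ℕ → ℕ → ℕ) : Prop where
  perm : ∀ x < n, a 0 x = y x
  inverse : ∀ x < n, a 1 x = inv x
  ident : ∀ x < n, a 2 x = x
  w₀ : ∀ x < n, (a 5 x : R) = W₀.eval n y x
  w₁ : ∀ x < n, (a 6 x : R) = W₁.eval n y x
  w₂ : ∀ x < n, (a 7 x : R) = W₂.eval n y x
  w₃ : ∀ x < n, (a 8 x : R) = W₃.eval n y x
  sw : ∀ x < n, (a 9 x : R) = cornerSum n y (fun x => (W₁.eval n y x : R)) x (y x)

theorem Tables.congr {W₀ W₁ W₂ W₃ : Weight} {a b : ℕ → ℕ → ℕ} (h : Tables R n y inv W₀ W₁ W₂ W₃ a)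
    (e : ∀ d, d ≠ 3 → d ≠ 4 → b d = a d) : Tables R n y inv W₀ W₁ W₂ W₃ b := by
  refine ⟨?_, ?_, ?_, ?_, ?_, ?_, ?_, ?_⟩ <;> rw [e _ (by norm_num) (by norm_num)]
  exacts [h.perm, h.inverse, h.ident, h.w₀, h.w₁, h.w₂, h.w₃, h.sw]

theorem run_tableProg (hk : 2 ≤ k) (hP : Params k n ρ) (hR : ((ρ 1 : ℕ) : R) = 0)
    (h : InversePerms n y inv) (W₀ W₁ W₂ W₃ : Weight) {s : St} (hs : ∀ x < n, s.arr 0 x = y x) :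
    Tables R n y inv W₀ W₁ W₂ W₃ ((tableProg W₀ W₁ W₂ W₃).run ρ s).arr := by
  have hloop := run_loop (ρ := ρ) (k := 0) (r := 5) (s := s)
    (p := .seq (.store 2 (.var 5) (.var 5)) (.store 1 (.get 0 (.var 5)) (.var 5)))
    (fun j t => (∀ x < j, t.arr 2 x = x) ∧ ∀ x < j, t.arr 1 (y x) = x)
    ⟨fun x hx => absurd hx (Nat.not_lt_zero x), fun x hx => absurd hx (Nat.not_lt_zero x)⟩ ?_
  · rw [hP.size] at hloop
    simp only [tableProg]
    rw [Prog.run.eq_4]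
    set s₁ := (Prog.loop 0 5 (.seq (.store 2 (.var 5) (.var 5))
      (.store 1 (.get 0 (.var 5)) (.var 5)))).run ρ s with hs₁
    have a0 : s₁.arr 0 = s.arr 0 := Prog.run_arr (by simp [Prog.KeepsA])
    clear_value s₁
    have keeps : ∀ (W : Weight) (d : ℕ) (t : St) (d' : ℕ), d' < d → d' ≠ 3 →
        ((W.prog d).run ρ t).arr d' = t.arr d' := fun W d t d' h h' =>
      Prog.run_arr (W.prog_keepsA h h')
    simp only [Prog.run.eq_4]
    set s₂ := (W₀.prog 5).run ρ s₁ with hs₂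
    set s₃ := (W₁.prog 6).run ρ s₂ with hs₃
    set s₄ := (W₂.prog 7).run ρ s₃ with hs₄
    set s₅ := (W₃.prog 8).run ρ s₄ with hs₅
    set s₆ := ((Weight.sw W₁).prog 9).run ρ s₅ with hs₆
    have k2 : ∀ d, d < 5 → d ≠ 3 → s₂.arr d = s₁.arr d := keeps W₀ 5 s₁
    have k3 : ∀ d, d < 6 → d ≠ 3 → s₃.arr d = s₂.arr d := keeps W₁ 6 s₂
    have k4 : ∀ d, d < 7 → d ≠ 3 → s₄.arr d = s₃.arr d := keeps W₂ 7 s₃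
    have k5 : ∀ d, d < 8 → d ≠ 3 → s₅.arr d = s₄.arr d := keeps W₃ 8 s₄
    have k6 : ∀ d, d < 9 → d ≠ 3 → s₆.arr d = s₅.arr d := keeps (.sw W₁) 9 s₅
    have p1 : ∀ x < n, s₁.arr 0 x = y x := a0 ▸ hs
    have p2 : ∀ x < n, s₂.arr 0 x = y x := k2 0 (by norm_num) (by norm_num) ▸ p1
    have p3 : ∀ x < n, s₃.arr 0 x = y x := k3 0 (by norm_num) (by norm_num) ▸ p2
    have p4 : ∀ x < n, s₄.arr 0 x = y x := k4 0 (by norm_num) (by norm_num) ▸ p3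
    have p5 : ∀ x < n, s₅.arr 0 x = y x := k5 0 (by norm_num) (by norm_num) ▸ p4
    have e5 := W₀.run_prog hk hP hR h.lt 5 s₁ (by norm_num) p1
    have e6 := W₁.run_prog hk hP hR h.lt 6 s₂ (by norm_num) p2
    have e7 := W₂.run_prog hk hP hR h.lt 7 s₃ (by norm_num) p3
    have e8 := W₃.run_prog hk hP hR h.lt 8 s₄ (by norm_num) p4
    have e9 := (Weight.sw W₁).run_prog hk hP hR h.lt 9 s₅ (by norm_num) p5
    rw [← hs₂] at e5
    rw [← hs₃] at e6
    rw [← hs₄] at e7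
    rw [← hs₅] at e8
    rw [← hs₆] at e9
    clear_value s₂ s₃ s₄ s₅ s₆
    have q : ∀ d, d < 5 → d ≠ 3 → s₆.arr d = s₁.arr d := fun d h h' => by
      rw [k6 d (by omega) h', k5 d (by omega) h', k4 d (by omega) h', k3 d (by omega) h', k2 d h h']
    refine ⟨?_, ?_, ?_, ?_, ?_, ?_, ?_, ?_⟩
    · rwa [q 0 (by norm_num) (by norm_num)]
    · intro x hx
      rw [q 1 (by norm_num) (by norm_num)]
      have := hloop.2 (inv x) (h.inv_lt x hx)
      rwa [h.apply_inv x hx] at this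
    · rw [q 2 (by norm_num) (by norm_num)]
      exact hloop.1
    · rwa [k6 5 (by norm_num) (by norm_num), k5 5 (by norm_num) (by norm_num),
        k4 5 (by norm_num) (by norm_num), k3 5 (by norm_num) (by norm_num)]
    · rwa [k6 6 (by norm_num) (by norm_num), k5 6 (by norm_num) (by norm_num),
        k4 6 (by norm_num) (by norm_num)]
    · rwa [k6 7 (by norm_num) (by norm_num), k5 7 (by norm_num) (by norm_num)]
    · rwa [k6 8 (by norm_num) (by norm_num)]
    · intro x hx
      rw [e9 x hx, Weight.eval, cornerSum]
      push_cast
      rfl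
  · rintro j hj t - ha ⟨h1, h2⟩
    rw [hP.size] at hj
    have a0 : t.arr 0 j = y j := by rw [ha 0 (by simp [Prog.KeepsA]), hs j hj]
    have mj := Nat.mod_eq_of_lt (hP.lt_length hj)
    have my := Nat.mod_eq_of_lt (hP.lt_length (h.lt j hj))
    have Mj := Nat.mod_eq_of_lt (hP.lt_modulus hk hj.le)
    simp only [Prog.run, Tm.ev, St.setA_arr_apply, St.setA_var, St.setV_var, St.setV_arr, if_true,
      mj, Mj, a0, my, true_and, show (0 : ℕ) ≠ 2 by norm_num, show (1 : ℕ) ≠ 2 by norm_num,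
      show (2 : ℕ) ≠ 1 by norm_num, false_and, if_false]
    refine ⟨fun x hx => ?_, fun x hx => ?_⟩
    · split
      · omega
      · exact h1 x (by omega)
    · split
      · rename_i hxy
        rw [← h.inv_apply x (by omega), hxy, h.inv_apply j hj]
      · rename_i hxy
        refine h2 x ?_
        have : x ≠ j := fun e => hxy (by rw [e])
        omega

theorem computes_coefTerm (hP : Params k n ρ) (hR : ((ρ 1 : ℕ) : R) = 0) (two : Bool)
    {A : ℕ → ℕ} {S : ℕ → R} (hA : ∀ i, A i < ρ 1) (hS : ∀ x < n, (A x : R) = S x) :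
    Computes ρ n A (coefTerm two 13 1) (firstCoef two S) ∧
      Computes ρ n A (coefTerm two 10 0) (secondCoef two S) := by
  constructor
  all_goals
    intro s h₀ h₂ ha
    cases two
    · simp [coefTerm, firstCoef, secondCoef, Tm.ev]
    · simp only [coefTerm, firstCoef, secondCoef, if_true, Tm.ev, BinOp.eval, ha]
      rw [Nat.mod_eq_of_lt (hP.lt_length (by assumption)), Nat.cast_add,
        Nat.cast_sub (hA _).le, hR, hS _ (by assumption)]
      ring

theorem run_patternProg (hk : 2 ≤ k) (hP : Params k n ρ) (hR : ((ρ 1 : ℕ) : R) = 0)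
    (h : InversePerms n y inv) (two : Bool) (W₀ W₁ W₂ W₃ : Weight) {s : St}
    (hs : ∀ x < n, s.arr 0 x = y x) (hlt : ∀ d i, s.arr d i < ρ 1) :
    (((patternProg two W₀ W₁ W₂ W₃).run ρ s).var 0 : R) =
      patternSum two n y (fun x => (W₀.eval n y x : R)) (fun x => (W₁.eval n y x : R))
        (fun x => (W₂.eval n y x : R)) (fun x => (W₃.eval n y x : R)) := by
  have h1 : 0 < ρ 1 := (Nat.zero_le _).trans_lt (hlt 0 0)
  have hidn : ∀ x < n, id x < n := fun x hx => hx
  simp only [patternProg, Prog.run.eq_4]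
  set s₁ := (Prog.assign 18 (.const 0)).run ρ ((tableProg W₀ W₁ W₂ W₃).run ρ s) with hs₁
  have T₁ : Tables R n y inv W₀ W₁ W₂ W₃ s₁.arr := run_tableProg hk hP hR h W₀ W₁ W₂ W₃ hs
  have L₁ : ∀ d i, s₁.arr d i < ρ 1 := Prog.run_arr_lt h1 _ _ (Prog.run_arr_lt h1 _ _ hlt)
  have v₁ : s₁.var 18 = 0 := by simp [hs₁, Prog.run, Tm.ev]
  clear_value s₁
  set s₂ := (sweepProg two 2 0 5 6 7 2).run ρ s₁ with hs₂
  have a₂ : ∀ d, d ≠ 3 → d ≠ 4 → s₂.arr d = s₁.arr d := fun d h h' =>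
    Prog.run_arr (by simp [sweepProg, sweepStep, chainProg, queryProg, insertProg, clearProg,
      Prog.KeepsA, h, h'])
  have v₂ := run_sweepProg hk hP hR two (O := 2) (Key := 0) (U := 5) (V := 6) (W := 7) (r := 2)
    (by norm_num) (by norm_num) (by norm_num) (by norm_num) (by norm_num) hidn h.lt
    T₁.ident T₁.perm (c := y) (fun _ => rfl) T₁.w₀ T₁.w₁ T₁.w₂ T₁.w₃
  rw [← hs₂, v₁, Nat.cast_zero, zero_add] at v₂
  have T₂ := T₁.congr a₂
  have L₂ : ∀ d i, s₂.arr d i < ρ 1 := Prog.run_arr_lt h1 _ _ L₁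
  clear_value s₂
  set s₃ := (sweepProg two 1 2 7 6 5 5).run ρ s₂ with hs₃
  have a₃ : ∀ d, d ≠ 3 → d ≠ 4 → s₃.arr d = s₂.arr d := fun d h h' =>
    Prog.run_arr (by simp [sweepProg, sweepStep, chainProg, queryProg, insertProg, clearProg,
      Prog.KeepsA, h, h'])
  have v₃ := run_sweepProg hk hP hR two (O := 1) (Key := 2) (U := 7) (V := 6) (W := 5) (r := 5)
    (by norm_num) (by norm_num) (by norm_num) (by norm_num) (by norm_num) h.inv_lt hidn
    T₂.inverse T₂.ident (c := inv) (fun _ => rfl) (fun z hz => T₂.w₂ _ (h.inv_lt z hz))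
    (fun z hz => T₂.w₁ _ (h.inv_lt z hz)) (fun z hz => T₂.w₀ _ (h.inv_lt z hz))
    (fun z hz => T₂.w₃ _ (h.inv_lt z hz))
  rw [← hs₃, v₂] at v₃
  have T₃ := T₂.congr a₃
  have L₃ : ∀ d i, s₃.arr d i < ρ 1 := Prog.run_arr_lt h1 _ _ L₂
  clear_value s₃
  have C₃ := computes_coefTerm hP hR two (L₃ 9) T₃.sw
  set s₄ := (cellProg 2 0 (coefTerm two 13 1)).run ρ s₃ with hs₄
  have a₄ : ∀ d, d ≠ 3 → d ≠ 4 → s₄.arr d = s₃.arr d := fun d h _ =>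
    Prog.run_arr (by simp [cellProg, cellColumn, cellRow, cellStep, queryProg, insertProg,
      clearProg, Prog.KeepsA, h])
  have v₄ := run_cellProg hk hP hR (O := 2) (Key := 0) (by norm_num) (by norm_num) C₃.1 h.inv_lt
    h.lt h.lt hidn T₃.perm T₃.inverse T₃.ident T₃.perm
  rw [← hs₄, v₃] at v₄
  have T₄ := T₃.congr a₄
  have L₄ : ∀ d i, s₄.arr d i < ρ 1 := Prog.run_arr_lt h1 _ _ L₃
  clear_value s₄
  have C₄ := computes_coefTerm hP hR two (L₄ 9) T₄.sw
  set s₅ := (cellProg 1 2 (coefTerm two 10 0)).run ρ s₄ with hs₅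
  have v₅ := run_cellProg hk hP hR (O := 1) (Key := 2) (by norm_num) (by norm_num) C₄.2 h.inv_lt
    hidn h.lt h.inv_lt T₄.perm T₄.inverse T₄.inverse T₄.ident
  rw [← hs₅, v₄] at v₅
  clear_value s₅
  have hN : n ≤ ρ 2 := by
    have := hP.length
    omega
  have cell : ∀ {o κ : ℕ → ℕ} {a : ℕ → ℕ → ℕ} (cf : ℕ → ℕ → R → R), (∀ z < n, o z < n) →
      Tables R n y inv W₀ W₁ W₂ W₃ a →
      cellSum n (ρ 5) y inv o κ (fun x => (a 5 x : R)) (fun x => (a 6 x : R))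
        (fun x => (a 7 x : R)) (fun x => (a 8 x : R)) cf =
      cellSum n (ρ 5) y inv o κ (fun x => (W₀.eval n y x : R)) (fun x => (W₁.eval n y x : R))
        (fun x => (W₂.eval n y x : R)) (fun x => (W₃.eval n y x : R)) cf := by
    intro o κ a cf ho T
    refine Finset.sum_congr rfl fun z hz => Finset.sum_congr rfl fun x₃ h₃ => ?_
    rw [Finset.mem_range] at hz h₃
    refine if_congr Iff.rfl (Finset.sum_congr rfl fun y₀ hy₀ => ?_) rfl
    rw [Finset.mem_range] at hy₀
    refine if_congr Iff.rfl (if_congr Iff.rfl ?_ rfl) rfl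
    beta_reduce
    rw [T.w₀ _ (h.inv_lt y₀ hy₀), T.w₂ _ (ho z hz), T.w₃ _ h₃]
    congr 2
    refine Finset.sum_congr rfl fun i hi => if_congr Iff.rfl (T.w₁ _ (ho i ?_)) rfl
    exact (Finset.mem_range.1 hi).trans hz
  have e : (((Prog.assign 0 (.var 18)).run ρ s₅).var 0 : R) = (s₅.var 18 : R) := by
    simp [Prog.run, Tm.ev, cast_mod hR]
  rw [e, v₅, h.patternSum_eq hP.width_pos hN, ← cell _ hidn T₃, ← cell _ h.inv_lt T₄, ← add_assoc]
  rfl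

end Programs

/-! ### Summation over the positions of a forest -/

/-- The values of a permutation, as a function on the natural numbers. -/
def permVal {n : ℕ} (σ : Equiv.Perm (Fin n)) (x : ℕ) : ℕ := if h : x < n then (σ ⟨x, h⟩ : ℕ) else 0

theorem permVal_of_lt {n : ℕ} (σ : Equiv.Perm (Fin n)) {x : ℕ} (h : x < n) :
    permVal σ x = σ ⟨x, h⟩ := dif_pos h

@[simp] theorem permVal_val {n : ℕ} (σ : Equiv.Perm (Fin n)) (x : Fin n) : permVal σ x = σ x :=
  permVal_of_lt σ x.2

theorem inversePerms_permVal {n : ℕ} (σ : Equiv.Perm (Fin n)) :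
    InversePerms n (permVal σ) (permVal σ.symm) := by
  refine ⟨fun x h => ?_, fun x h => ?_, fun x h => ?_, fun x h => ?_⟩
  · rw [permVal_of_lt σ h]
    exact Fin.is_lt _
  · rw [permVal_of_lt _ h]
    exact Fin.is_lt _
  · rw [permVal_of_lt σ h, permVal_val, Equiv.symm_apply_apply]
  · rw [permVal_of_lt _ h, permVal_val, Equiv.apply_symm_apply]

/-- `a` precedes `b` in both orders of the permutation. -/
def Below {n : ℕ} (σ : Equiv.Perm (Fin n)) (a b : Fin n) : Prop := a < b ∧ σ a < σ b

instance {n : ℕ} (σ : Equiv.Perm (Fin n)) (a b : Fin n) : Decidable (Below σ a b) :=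
  inferInstanceAs (Decidable (a < b ∧ σ a < σ b))

theorem Weight.eval_sw {n : ℕ} (σ : Equiv.Perm (Fin n)) (W : Weight) (x : Fin n) :
    (Weight.sw W).eval n (permVal σ) x =
      ∑ q : Fin n, if Below σ q x then W.eval n (permVal σ) q else 0 := by
  rw [Weight.eval, Finset.sum_range]
  refine Finset.sum_congr rfl fun q _ => if_congr ?_ rfl rfl
  rw [permVal_val, permVal_val]
  rfl

/-- The sum over all positions of a single point below its parent `p`, of which the weight `e p` is
then multiplied by a dominance sum. -/
theorem sum_leaf {n : ℕ} (σ : Equiv.Perm (Fin n)) {Q : Type} [Fintype Q] [DecidableEq Q]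
    (e : Q → Weight) (w : Weight) (p : Q) (X : Q → Fin n) :
    (∑ x : Fin n, if Below σ x (X p) then
        w.eval n (permVal σ) x * ∏ q, (e q).eval n (permVal σ) (X q) else 0) =
      ∏ q, (if q = p then (e q).mul w.sw else e q).eval n (permVal σ) (X q) := by
  have h : ∀ q, (if q = p then (e q).mul w.sw else e q).eval n (permVal σ) (X q) =
      (e q).eval n (permVal σ) (X q) *
        if q = p then w.sw.eval n (permVal σ) (X q) else 1 := by
    intro q
    split
    · rfl
    · rw [mul_one]
  simp only [h]
  rw [Finset.prod_mul_distrib, Finset.prod_ite_eq' Finset.univ p, if_pos (Finset.mem_univ p),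
    Weight.eval_sw, Finset.mul_sum]
  refine Finset.sum_congr rfl fun x _ => ?_
  rw [mul_ite, mul_zero, mul_comm]

open Classical in
/-- The sum over all positions of the vertices `V` of a rooted forest such that every vertex is
below its parent, where the roots have parents in a set `C` of points with fixed positions. It is a
product of weights of the points in `C`: vertices of maximal rank are leaves, and the sum over the
position of a leaf multiplies the weight of its parent by a dominance sum. -/
theorem exists_weights {C : Type} [Fintype C] (m : ℕ) : ∀ (V : Type) [Fintype V],
    Fintype.card V = m → ∀ (parent : V → V ⊕ C) (rank : V → ℕ),
    (∀ v w, parent v = Sum.inl w → rank w < rank v) → ∀ e : V ⊕ C → Weight,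
    ∃ W : C → Weight, ∀ (n : ℕ) (σ : Equiv.Perm (Fin n)) (g : C → Fin n),
      (∑ h : V → Fin n, if ∀ v, Below σ (h v) (Sum.elim h g (parent v)) then
        ∏ q, (e q).eval n (permVal σ) (Sum.elim h g q : Fin n) else 0) =
      ∏ c, (W c).eval n (permVal σ) (g c) := by
  induction m with
  | zero =>
    intro V _ hV parent rank _ e
    have := Fintype.card_eq_zero_iff.1 hV
    refine ⟨fun c => e (Sum.inr c), fun n σ g => ?_⟩
    simp
  | succ m ih =>
    intro V _ hV parent rank hrank e
    have : Nonempty V := Fintype.card_pos_iff.1 (by omega)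
    obtain ⟨v, hv⟩ := Finite.exists_max rank
    let ε : Option {w // w ≠ v} ≃ V := Equiv.optionSubtypeNe v
    have hp : ∀ w, ∃ p : {w // w ≠ v} ⊕ C, parent w = Sum.map (fun u => ε (some u)) id p := by
      intro w
      rcases hw : parent w with u | c
      · refine ⟨Sum.inl ⟨u, ?_⟩, rfl⟩
        rintro rfl
        exact (hrank w u hw).not_ge (hv w)
      · exact ⟨Sum.inr c, rfl⟩
    choose p hp using hp
    obtain ⟨W, hW⟩ := ih {w // w ≠ v} (by rw [Fintype.card_subtype_compl, hV]; simp)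
      (fun w => p w) (fun w => rank w) (fun w u hwu => hrank w u (by rw [hp, hwu]; rfl))
      (fun q => if q = p v then (e (Sum.map (fun u => ε (some u)) id q)).mul (e (Sum.inl v)).sw
        else e (Sum.map (fun u => ε (some u)) id q))
    refine ⟨W, fun n σ g => ?_⟩
    rw [← hW n σ g]
    -- split the positions into those of the vertices other than `v` and that of `v`
    rw [← ((Equiv.piOptionEquivProd (β := fun _ => Fin n)).symm.trans
      (Equiv.arrowCongr ε (Equiv.refl _))).sum_comp, Fintype.sum_prod_type, Finset.sum_comm]
    refine Finset.sum_congr (Finset.ext fun _ => by simp) fun h _ => ?_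
    let H : Fin n → V → Fin n := fun x =>
      ((Equiv.piOptionEquivProd (β := fun _ => Fin n)).symm.trans
        (Equiv.arrowCongr ε (Equiv.refl _))) (x, h)
    change (∑ x : Fin n, if ∀ w, Below σ (H x w) (Sum.elim (H x) g (parent w)) then
      ∏ q, (e q).eval n (permVal σ) (Sum.elim (H x) g q : Fin n) else 0) = _
    have H0 : ∀ x, H x v = x := fun x => by
      simp [H, ε, Equiv.piOptionEquivProd]
    have H1 : ∀ x (w : {w // w ≠ v}), H x w = h w := fun x w => by
      simp [H, ε, Equiv.piOptionEquivProd, Equiv.optionSubtypeNe_symm_of_ne w.2]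
    clear_value H
    have H2 : ∀ x q, Sum.elim (H x) g (Sum.map (fun u => ε (some u)) id q) = Sum.elim h g q := by
      rintro x (u | c)
      · exact H1 x u
      · rfl
    have hall : ∀ x, (∀ w, Below σ (H x w) (Sum.elim (H x) g (parent w))) ↔
        (∀ w : {w // w ≠ v}, Below σ (h w) (Sum.elim h g (p w))) ∧
          Below σ x (Sum.elim h g (p v)) := by
      intro x
      constructor
      · intro hx
        refine ⟨fun w => ?_, ?_⟩
        · have := hx w
          rwa [hp, H2, H1] at this
        · have := hx v
          rwa [hp, H2, H0] at this
      · rintro ⟨h1, h2⟩ w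
        by_cases hw : w = v
        · rw [hw, hp, H2, H0]
          exact h2
        · have := h1 ⟨w, hw⟩
          rwa [hp, H2, show H x w = h ⟨w, hw⟩ from H1 x ⟨w, hw⟩]
    have hprod : ∀ x, ∏ q, (e q).eval n (permVal σ) (Sum.elim (H x) g q : Fin n) =
        (e (Sum.inl v)).eval n (permVal σ) x * ∏ q, (e (Sum.map (fun u => ε (some u)) id q)).eval n
          (permVal σ) (Sum.elim h g q : Fin n) := by
      intro x
      rw [Fintype.prod_sum_type, Fintype.prod_sum_type, ← ε.prod_comp, Fintype.prod_option,
        mul_assoc]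
      congr 1
      · exact congrArg _ (congrArg Fin.val (H0 x))
      · congr 1
        exact Finset.prod_congr rfl fun w _ => congrArg _ (congrArg Fin.val (H1 x w))
    simp only [hall, hprod]
    by_cases hc : ∀ w : {w // w ≠ v}, Below σ (h w) (Sum.elim h g (p w))
    · rw [if_pos hc]
      simp only [hc, implies_true, true_and]
      exact sum_leaf σ _ _ (p v) (Sum.elim h g)
    · rw [if_neg hc]
      exact Finset.sum_eq_zero fun x _ => if_neg fun h => hc h.1

end WordRAM

/-! ### The parents in a dangling tree -/

namespace DanglingTree

variable (T : DanglingTree)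

theorem not_arrow_root (u : T.V) : ¬ T.tree.arrow u T.root := fun h => by
  have := T.outward u T.root h
  rw [SimpleGraph.dist_self] at this
  exact Nat.not_lt_zero _ this

theorem adj_of_arrow {u v : T.V} (h : T.tree.arrow u v) :
    (SimpleGraph.fromRel T.tree.arrow).Adj u v := by
  refine (SimpleGraph.fromRel_adj _ _ _).2 ⟨?_, Or.inl h⟩
  rintro rfl
  exact T.tree.asymm _ _ h h

theorem exists_arrow {v : T.V} (hv : v ≠ T.root) : ∃ u, T.tree.arrow u v := by
  obtain ⟨p, hp⟩ := T.tree.isTree.1.exists_walk_length_eq_dist T.root v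
  have hnil : ¬ p.Nil := SimpleGraph.Walk.not_nil_of_ne hv.symm
  have hadj := p.adj_penultimate hnil
  refine ⟨p.penultimate, ?_⟩
  rcases ((SimpleGraph.fromRel_adj _ _ _).1 hadj).2 with h | h
  · exact h
  · -- an arrow towards the root along a shortest path contradicts the orientation
    have h1 := T.outward _ _ h
    have h2 := SimpleGraph.dist_le p.dropLast
    have h3 := SimpleGraph.Walk.length_dropLast_add_one hnil
    omega

/-- Shortest paths from the root to two different sources of arrows to `v` would extend to two
different paths from the root to `v`. -/
theorem arrow_unique {u u' v : T.V} (h : T.tree.arrow u v) (h' : T.tree.arrow u' v) : u = u' := by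
  have key : ∀ {u : T.V}, T.tree.arrow u v → ∀ hadj : (SimpleGraph.fromRel T.tree.arrow).Adj u v,
      ∃ p : (SimpleGraph.fromRel T.tree.arrow).Walk T.root u, (p.concat hadj).IsPath := by
    intro u h hadj
    obtain ⟨p, hp, hl⟩ := T.tree.isTree.1.exists_path_of_dist T.root u
    refine ⟨p, hp.concat (fun hmem => ?_) hadj⟩
    classical
    have h1 := SimpleGraph.dist_le (p.takeUntil v hmem)
    have h2 := p.length_takeUntil_le_length hmem
    have h3 := T.outward u v h
    omega
  obtain ⟨p, hp⟩ := key h (T.adj_of_arrow h)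
  obtain ⟨p', hp'⟩ := key h' (T.adj_of_arrow h')
  have := (T.tree.isTree.existsUnique_path T.root v).unique hp hp'
  rw [← p.penultimate_concat (T.adj_of_arrow h), this, p'.penultimate_concat]

end DanglingTree

namespace WordRAM

/-! ### Summation over the positions of the core -/

/-- The points of `[3 2 1 4]`, with or without the point `2`. -/
abbrev CorePoint (two : Bool) : Type := {k : Fin 4 // two = true ∨ k ≠ 1}

/-- The points `g` of the permutation `σ` form the pattern `[3 2 1 4]`, or the part of it. -/
def IsPattern {n : ℕ} (σ : Equiv.Perm (Fin n)) {two : Bool} (g : CorePoint two → Fin n) : Prop :=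
  (∀ u v, u.1 < v.1 → g u < g v) ∧ ∀ u v, perm3214 u.1 < perm3214 v.1 → σ (g u) < σ (g v)

/-- The positions of the four points as a tuple. -/
def quadEquiv (α : Type) : (CorePoint true → α) ≃ α × α × α × α where
  toFun g := (g ⟨3, Or.inl rfl⟩, g ⟨2, Or.inl rfl⟩, g ⟨0, Or.inl rfl⟩, g ⟨1, Or.inl rfl⟩)
  invFun a k := ![a.2.2.1, a.2.2.2, a.2.1, a.1] k.1
  left_inv g := by
    funext ⟨k, hk⟩
    fin_cases k <;> rfl
  right_inv a := rfl

/-- The positions of the three points other than the point `2` as a tuple. -/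
def tripleEquiv (α : Type) : (CorePoint false → α) ≃ α × α × α where
  toFun g := (g ⟨3, Or.inr (by decide)⟩, g ⟨2, Or.inr (by decide)⟩, g ⟨0, Or.inr (by decide)⟩)
  invFun a k := ![a.2.2, a.2.2, a.2.1, a.1] k.1
  left_inv g := by
    funext ⟨k, hk⟩
    fin_cases k <;> first | rfl | (exfalso; revert hk; decide)
  right_inv a := rfl

theorem isPattern_true_iff {n : ℕ} (σ : Equiv.Perm (Fin n)) {g : CorePoint true → Fin n}
    {d c a b : Fin n} (hd : g ⟨3, Or.inl rfl⟩ = d) (hc : g ⟨2, Or.inl rfl⟩ = c)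
    (ha : g ⟨0, Or.inl rfl⟩ = a) (hb : g ⟨1, Or.inl rfl⟩ = b) :
    IsPattern σ g ↔
      (a < c ∧ c < d ∧ σ c < σ a ∧ σ a < σ d) ∧ a < b ∧ b < c ∧ σ c < σ b ∧ σ b < σ a := by
  subst hd hc ha hb
  constructor
  · rintro ⟨h1, h2⟩
    have e1 := fun i j => h1 ⟨i, Or.inl rfl⟩ ⟨j, Or.inl rfl⟩
    have e2 := fun i j => h2 ⟨i, Or.inl rfl⟩ ⟨j, Or.inl rfl⟩
    exact ⟨⟨e1 0 2 (by decide), e1 2 3 (by decide), e2 2 0 (by decide), e2 0 3 (by decide)⟩,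
      e1 0 1 (by decide), e1 1 2 (by decide), e2 2 1 (by decide), e2 1 0 (by decide)⟩
  · rintro ⟨⟨h1, h2, h3, h4⟩, h5, h6, h7, h8⟩
    constructor
    all_goals
      rintro ⟨u, hu⟩ ⟨v, hv⟩ huv
      fin_cases u <;> fin_cases v <;>
        first
          | (exfalso; revert hu hv huv; decide)
          | assumption
          | (dsimp only [Fin.reduceFinMk, Fin.zero_eta, Fin.mk_one]; omega)

theorem isPattern_false_iff {n : ℕ} (σ : Equiv.Perm (Fin n)) {g : CorePoint false → Fin n}
    {d c a : Fin n} (hd : g ⟨3, Or.inr (by decide)⟩ = d) (hc : g ⟨2, Or.inr (by decide)⟩ = c)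
    (ha : g ⟨0, Or.inr (by decide)⟩ = a) :
    IsPattern σ g ↔ a < c ∧ c < d ∧ σ c < σ a ∧ σ a < σ d := by
  subst hd hc ha
  constructor
  · rintro ⟨h1, h2⟩
    have e1 := fun i j hi hj => h1 ⟨i, Or.inr hi⟩ ⟨j, Or.inr hj⟩
    have e2 := fun i j hi hj => h2 ⟨i, Or.inr hi⟩ ⟨j, Or.inr hj⟩
    exact ⟨e1 0 2 (by decide) (by decide) (by decide), e1 2 3 (by decide) (by decide) (by decide),
      e2 2 0 (by decide) (by decide) (by decide), e2 0 3 (by decide) (by decide) (by decide)⟩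
  · rintro ⟨h1, h2, h3, h4⟩
    constructor
    all_goals
      rintro ⟨u, hu⟩ ⟨v, hv⟩ huv
      fin_cases u <;> fin_cases v <;>
        first
          | (exfalso; revert hu hv huv; decide)
          | (dsimp only [Fin.reduceFinMk, Fin.zero_eta, Fin.mk_one]; omega)

open Classical in
/-- Splits a sum over the patterns formed by the core into the sums over the single points. -/
theorem exists_patternSum (two : Bool) (W : CorePoint two → Weight) :
    ∃ W₀ W₁ W₂ W₃ : Weight, ∀ (n : ℕ) (σ : Equiv.Perm (Fin n)) (R : Type) [CommRing R],
      ((∑ g : CorePoint two → Fin n, if IsPattern σ g then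
        ∏ c, (W c).eval n (permVal σ) (g c) else 0 : ℕ) : R) =
      patternSum two n (permVal σ) (fun x => (W₀.eval n (permVal σ) x : R))
        (fun x => (W₁.eval n (permVal σ) x : R)) (fun x => (W₂.eval n (permVal σ) x : R))
        (fun x => (W₃.eval n (permVal σ) x : R)) := by
  let W' : Fin 4 → Weight := fun k => if h : two = true ∨ k ≠ 1 then W ⟨k, h⟩ else .one
  refine ⟨W' 0, W' 1, W' 2, W' 3, fun n σ R _ => ?_⟩
  have hprod : ∀ g : CorePoint two → Fin n, ∏ c, (W c).eval n (permVal σ) (g c) =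
      ∏ k : Fin 4, if h : two = true ∨ k ≠ 1 then
        (W' k).eval n (permVal σ) (g ⟨k, h⟩) else 1 := by
    intro g
    rw [Fintype.prod_dite, Finset.prod_const_one, mul_one]
    refine Finset.prod_congr rfl fun c _ => ?_
    simp only [W', dif_pos c.2]
  simp only [hprod]
  clear hprod
  clear_value W'
  simp only [patternSum, Finset.sum_range, permVal_val]
  cases two
  · rw [← (tripleEquiv (Fin n)).symm.sum_comp, Fintype.sum_prod_type]
    simp only [Fintype.sum_prod_type]
    push_cast
    refine Finset.sum_congr rfl fun d _ => Finset.sum_congr rfl fun c _ =>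
      Finset.sum_congr rfl fun a _ => ?_
    rw [if_congr (isPattern_false_iff σ (d := d) (c := c) (a := a) rfl rfl rfl) rfl rfl]
    refine if_congr (by simp only [Fin.lt_def]) ?_ rfl
    simp [Fin.prod_univ_four, innerSum]
    rfl
  · rw [← (quadEquiv (Fin n)).symm.sum_comp, Fintype.sum_prod_type]
    simp only [Fintype.sum_prod_type]
    push_cast
    refine Finset.sum_congr rfl fun d _ => Finset.sum_congr rfl fun c _ =>
      Finset.sum_congr rfl fun a _ => ?_
    simp only [Fin.val_fin_lt]
    by_cases hc : a < c ∧ c < d ∧ σ c < σ a ∧ σ a < σ d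
    · rw [if_pos hc, innerSum, if_pos rfl, Finset.sum_range, Finset.mul_sum, Finset.sum_mul,
        Finset.sum_mul]
      refine Finset.sum_congr rfl fun b _ => ?_
      rw [if_congr (isPattern_true_iff σ (d := d) (c := c) (a := a) (b := b) rfl rfl rfl rfl)
        rfl rfl]
      simp only [hc, true_and, and_self, permVal_val, Fin.lt_def, mul_ite, ite_mul, mul_zero,
        zero_mul]
      refine if_congr Iff.rfl ?_ rfl
      simp [Fin.prod_univ_four]
      ring_nf
      rfl
    · rw [if_neg hc]
      refine Finset.sum_eq_zero fun b _ => if_neg ?_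
      rw [isPattern_true_iff σ (d := d) (c := c) (a := a) (b := b) rfl rfl rfl rfl]
      exact fun h => hc h.1

end WordRAM

/-! ### Counting morphisms -/

namespace DoublePoset

theorem DPCmor_congr {A B : DoublePoset} (h : A.IsIso B) (P : DoublePoset) :
    DPCmor P A = DPCmor P B := by
  obtain ⟨e, h1, h2⟩ := h
  refine Nat.card_congr ((Equiv.arrowCongr e (Equiv.refl _)).subtypeEquiv fun f => ?_)
  simp [← e.forall_congr_right, h1, h2]

end DoublePoset

namespace ArboNEData

open WordRAM

variable (A : ArboNEData)

/-- With values in a transitive relation, preserving the transitive closure means preserving the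
generating relation. -/
theorem forall_transGen {α β : Type} {r : α → α → Prop} {s : β → β → Prop}
    (hs : ∀ {a b c}, s a b → s b c → s a c) (f : α → β) :
    (∀ a b, Relation.TransGen r a b → s (f a) (f b)) ↔ ∀ a b, r a b → s (f a) (f b) := by
  refine ⟨fun h a b hab => h a b (.single hab), fun h a b hab => ?_⟩
  induction hab with
  | single hab => exact h _ _ hab
  | tail _ hbc ih => exact hs ih (h _ _ hbc)

/-- The vertices of all dangling trees. -/
abbrev TreeVertex : Type := Σ i, (A.T i).V

open Classical in
/-- The parent of a vertex of a dangling tree; the parent of the root is the base of the tree. -/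
noncomputable def parent (v : A.TreeVertex) : A.TreeVertex ⊕ A.Core :=
  if h : v.2 = (A.T v.1).root then Sum.inr (A.base v.1)
  else Sum.inl ⟨v.1, ((A.T v.1).exists_arrow h).choose⟩

theorem parent_root (i : A.ι) : A.parent ⟨i, (A.T i).root⟩ = Sum.inr (A.base i) := dif_pos rfl

theorem parent_of_arrow {i : A.ι} {u v : (A.T i).V} (h : (A.T i).tree.arrow u v) :
    A.parent ⟨i, v⟩ = Sum.inl ⟨i, u⟩ := by
  have hv : v ≠ (A.T i).root := by
    rintro rfl
    exact (A.T i).not_arrow_root u h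
  rw [parent, dif_neg hv]
  exact congrArg (fun u => (Sum.inl ⟨i, u⟩ : A.TreeVertex ⊕ A.Core))
    ((A.T i).arrow_unique ((A.T i).exists_arrow hv).choose_spec h)

/-- Either `v` is a root, or there is an arrow to `v` from its parent. -/
theorem parent_cases (v : A.TreeVertex) : v.2 = (A.T v.1).root ∨
    ∃ u, (A.T v.1).tree.arrow u v.2 := by
  by_cases h : v.2 = (A.T v.1).root
  · exact Or.inl h
  · exact Or.inr ((A.T v.1).exists_arrow h)

/-- A map to a permutation is a morphism if it maps the core to a pattern and every vertex of a tree
below its parent: all arrows lead away from the roots and are labelled `S`. -/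
theorem isMor_iff {n : ℕ} (σ : Equiv.Perm (Fin n)) (f : A.Vertex → Fin n) :
    ((∀ a b, A.toDoublePoset.west a b → (DoublePoset.ofPerm σ).west (f a) (f b)) ∧
      ∀ a b, A.toDoublePoset.south a b → (DoublePoset.ofPerm σ).south (f a) (f b)) ↔
    IsPattern σ (two := A.hasTwo) (fun c => f (Sum.inl c)) ∧ ∀ v : A.TreeVertex,
      Below σ (f (Sum.inr v)) (Sum.elim (fun v => f (Sum.inr v)) (fun c => f (Sum.inl c))
        (A.parent v)) := by
  have h1 := forall_transGen (r := A.WestGen) (s := (DoublePoset.ofPerm σ).west)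
    (fun {a b c} hab hbc => lt_trans (α := Fin n) hab hbc) f
  have h2 := forall_transGen (r := A.SouthGen) (s := (DoublePoset.ofPerm σ).south)
    (fun {a b c} hab hbc => lt_trans (α := Fin n) hab hbc) f
  refine (and_congr h1 h2).trans ⟨?_, ?_⟩
  · rintro ⟨hW, hS⟩
    refine ⟨⟨fun u v h => hW _ _ (.core u v h), fun u v h => hS _ _ (.core u v h)⟩, ?_⟩
    rintro ⟨i, v⟩
    rcases A.parent_cases ⟨i, v⟩ with h | ⟨u, h⟩
    · obtain rfl : v = (A.T i).root := h
      rw [parent_root]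
      exact ⟨hW _ _ (.attach i), hS _ _ (.attach i)⟩
    · rw [A.parent_of_arrow h]
      exact ⟨hW _ _ (.tree i v u h), hS _ _ (.tree i v u (Or.inl ⟨h, (A.T i).all_south u v h⟩))⟩
  · rintro ⟨⟨hW, hS⟩, hB⟩
    constructor
    · rintro _ _ (⟨u, v, h⟩ | ⟨i, u, v, h⟩ | ⟨i⟩)
      · exact hW u v h
      · have := hB ⟨i, u⟩
        rw [A.parent_of_arrow h] at this
        exact this.1
      · have := hB ⟨i, (A.T i).root⟩
        rw [parent_root] at this
        exact this.1
    · rintro _ _ (⟨u, v, h⟩ | ⟨i, u, v, h⟩ | ⟨i⟩)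
      · exact hS u v h
      · rcases h with ⟨h, -⟩ | ⟨h, hl⟩
        · have := hB ⟨i, u⟩
          rw [A.parent_of_arrow h] at this
          exact this.2
        · rw [(A.T i).all_south u v h] at hl
          cases hl
      · have := hB ⟨i, (A.T i).root⟩
        rw [parent_root] at this
        exact this.2

instance : Finite A.TreeVertex := by
  have := A.finite
  have := fun i => (A.T i).finite
  infer_instance

open Classical in
/-- The number of morphisms to a permutation is a sum over its patterns. -/
theorem exists_DPCmor_eq : ∃ W₀ W₁ W₂ W₃ : Weight,
    ∀ (n : ℕ) (σ : Equiv.Perm (Fin n)) (R : Type) [CommRing R],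
      (DoublePoset.DPCmor (DoublePoset.ofPerm σ) A.toDoublePoset : R) =
      patternSum A.hasTwo n (permVal σ) (fun x => (W₀.eval n (permVal σ) x : R))
        (fun x => (W₁.eval n (permVal σ) x : R)) (fun x => (W₂.eval n (permVal σ) x : R))
        (fun x => (W₃.eval n (permVal σ) x : R)) := by
  have := Fintype.ofFinite A.TreeVertex
  obtain ⟨W, hW⟩ := exists_weights (C := A.Core) _ A.TreeVertex rfl A.parent
    (fun v => (SimpleGraph.fromRel (A.T v.1).tree.arrow).dist (A.T v.1).root v.2) (by
      rintro ⟨i, v⟩ w h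
      rcases A.parent_cases ⟨i, v⟩ with h' | ⟨u, h'⟩
      · obtain rfl : v = (A.T i).root := h'
        rw [parent_root] at h
        cases h
      · rw [A.parent_of_arrow h'] at h
        obtain rfl := Sum.inl.inj h
        exact (A.T i).outward u v h') (fun _ => .one)
  obtain ⟨W₀, W₁, W₂, W₃, h⟩ := exists_patternSum A.hasTwo W
  refine ⟨W₀, W₁, W₂, W₃, fun n σ R _ => ?_⟩
  rw [← h n σ R]
  congr 1
  have e : DoublePoset.DPCmor (DoublePoset.ofPerm σ) A.toDoublePoset =
      Nat.card {f : A.Vertex → Fin n // IsPattern σ (two := A.hasTwo) (fun c => f (Sum.inl c)) ∧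
        ∀ v : A.TreeVertex, Below σ (f (Sum.inr v))
          (Sum.elim (fun v => f (Sum.inr v)) (fun c => f (Sum.inl c)) (A.parent v))} :=
    Nat.card_congr (Equiv.subtypeEquivRight (A.isMor_iff σ))
  rw [e, Nat.card_eq_fintype_card, Fintype.card_subtype, Finset.card_filter,
    ← (Equiv.sumArrowEquivProdArrow A.Core A.TreeVertex (Fin n)).symm.sum_comp,
    Fintype.sum_prod_type]
  refine Finset.sum_congr rfl fun g _ => ?_
  by_cases hg : IsPattern σ (two := A.hasTwo) g
  · rw [if_pos hg, ← hW n σ g]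
    refine Finset.sum_congr (Finset.ext fun _ => by simp) fun h _ => ?_
    exact if_congr (and_iff_right hg) (Finset.prod_eq_one fun q _ => rfl).symm rfl
  · rw [if_neg hg]
    exact Finset.sum_eq_zero fun h _ => if_neg fun h => hg h.1

theorem DPCmor_le {n : ℕ} (σ : Equiv.Perm (Fin n)) :
    DoublePoset.DPCmor (DoublePoset.ofPerm σ) A.toDoublePoset ≤ n ^ Nat.card A.Vertex := by
  have h : Nat.card (A.Vertex → Fin n) = n ^ Nat.card A.Vertex := by
    rw [Nat.card_fun, Nat.card_fin]
  rw [← h]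
  exact Nat.card_le_card_of_injective (fun f : DoublePoset.Mor _ _ => f.1) Subtype.val_injective

end ArboNEData

theorem mainTheorem1 (D : DoublePoset) (hD : D ∈ ArboNE) :
    FeasibleIn (fun _ σ => DoublePoset.DPCmor (DoublePoset.ofPerm σ) D)
      (fun n => (n : ℝ) ^ ((5 : ℝ) / 3)) (fun n => (n : ℝ)) := by
  obtain ⟨A, hA⟩ := hD
  obtain ⟨W₀, W₁, W₂, W₃, hW⟩ := A.exists_DPCmor_eq
  have hk : 2 ≤ Nat.card A.Vertex + 2 := by omega
  refine WordRAM.feasibleIn_of_prog hk (WordRAM.patternProg A.hasTwo W₀ W₁ W₂ W₃)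
    (WordRAM.patternProg_expo _ _ _ _ _ _) 0 fun n σ ρ s hP hs hlt => ?_
  rw [DoublePoset.DPCmor_congr hA]
  set N := DoublePoset.DPCmor (DoublePoset.ofPerm σ) A.toDoublePoset with hN
  -- the number is less than the modulus, hence determined by its residue
  have hN1 : N < ρ 1 := by
    rw [hP.modulus]
    calc N ≤ n ^ Nat.card A.Vertex := A.DPCmor_le σ
      _ ≤ (n + 2) ^ Nat.card A.Vertex := Nat.pow_le_pow_left (by omega) _
      _ < (n + 2) ^ (Nat.card A.Vertex + 2) := Nat.pow_lt_pow_right (by omega) (by omega)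
  have h := WordRAM.run_patternProg (R := ZMod (ρ 1)) hk hP (ZMod.natCast_self _)
    (WordRAM.inversePerms_permVal σ) A.hasTwo W₀ W₁ W₂ W₃ (s := s)
    (fun x hx => by rw [hs x hx, WordRAM.permVal_of_lt σ hx]) hlt
  rw [← hW n σ, ← hN, ZMod.natCast_eq_natCast_iff', Nat.mod_eq_of_lt hN1] at h
  rw [← h]
  refine (Nat.mod_eq_of_lt ?_).symm
  simp only [WordRAM.patternProg, WordRAM.Prog.run, WordRAM.St.setV_var, if_true]
  exact Nat.mod_lt _ (by omega)
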